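/- Let $(X,g)$ be a closed oriented smooth Riemannian 4-manifold with scalar curvature $k_g$ and a spin$^c$ structure, with positive spinor bundle $\mathcal S^+$ and determinant line bundle $\mathcal L=\Lambda^2\mathcal S^+$ (both Hermitian). Fix a smooth unitary connection $A_0$ on $\mathcal L$ and let $\nabla^{A_0}$ be the spin$^c$ connection that it induces on $\mathcal S^+$ together with the Levi-Civita connection. Fix $c\in\mathbb R$, and let $\Theta\in\Omega^1(X,i\mathbb R)$ act on spinors by $\Theta(\phi)=c\,\Theta\otimes\phi$ (so $c=1$ if $\Theta$ acts by scalar multiplication, and $c=\tfrac12$ for the action under which $\nabla^A$ below is the spin$^c$ connection induced by $A$ for every $A$). For $A=A_0+a$ with $a\in L^{1,2}(T^*X\otimes i\mathbb R)$ and $\phi\in L^{1,2}(\mathcal S^+)$ put $F_A=F_{A_0}+da$, $\nabla^A\phi=\nabla^{A_0}\phi+a(\phi)$ and $$\mathcal{SW}_\alpha(A,\phi)=\int_X\Big\{\tfrac14|F_A|^2+|\nabla^A\phi|^2+\tfrac18|\phi|^4+\tfrac14k_g|\phi|^2\Big\}\,dv_g .$$ Here $L^{1,2}$ is the closure of the smooth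 sections in the norm $(\int|\sigma|^2+|\nabla\sigma|^2)^{1/2}$. The integrand is integrable for all such $(A,\phi)$. Moreover, $(A,\phi)$ is a critical point, i.e. $\frac{d}{dt}\big|_{t=0}\mathcal{SW}_\alpha(A+t\Theta,\phi+t\Lambda)=0$ for all $\Theta\in L^{1,2}(T^*X\otimes i\mathbb R)$ and $\Lambda\in L^{1,2}(\mathcal S^+)$, if and only if $$\Delta_A\phi+\frac{|\phi|^2}{4}\phi+\frac{k_g}{4}\phi=0\qquad\text{and}\qquad d^*F_A+4\,\Phi^*(\nabla^A\phi)=0 .$$ Here $\Delta_A=(\nabla^A)^*\nabla^A$; the operators $(\nabla^A)^*$ and $d^*$ are the $L^2$-adjoints of $\nabla^A$ and $d$, taken in the sense of distributions; and $\Phi^*$ is the adjoint, with respect to the real inner products, of $\Phi(\Theta)=\Theta(\phi)$. -/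

import Mathlib

open MeasureTheory Bundle Filter
open scoped Manifold ContDiff Topology Bundle ENNReal

noncomputable section

namespace SeibergWitten

/-- The model of the base manifold and of the underlying real spaces of the spinor fibres. -/
abbrev R4 : Type := EuclideanSpace ℝ (Fin 4)

/-- The model of the underlying real space of the fibres of a complex line bundle. -/
abbrev R2 : Type := EuclideanSpace ℝ (Fin 2)

section Tangent

variable {X : Type*} [TopologicalSpace X] [ChartedSpace R4 X]

/-- The tangent space of the 4-manifold `X` at `x`. -/
abbrev Tan (x : X) : Type := TangentSpace (𝓡 4) x

instance instFiniteDimensionalTan (x : X) : FiniteDimensional ℝ (Tan x) :=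
  inferInstanceAs (FiniteDimensional ℝ R4)

end Tangent

section Sections

variable {X : Type*} [TopologicalSpace X] [ChartedSpace R4 X]
  (F : Type*) [NormedAddCommGroup F] [NormedSpace ℝ F]
  {V : X → Type*} [TopologicalSpace (TotalSpace F V)] [∀ x, TopologicalSpace (V x)]
  [FiberBundle F V]

/-- `σ` is a smooth section of the bundle `V` (with model fibre `F`). -/
def IsSmoothSection (σ : Π x, V x) : Prop :=
  ContMDiff (𝓡 4) ((𝓡 4).prod 𝓘(ℝ, F)) ∞ (fun x => TotalSpace.mk' F x (σ x))

end Sections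

/-! ### Riemannian geometry of the base -/

section Riemannian

variable {X : Type*} [TopologicalSpace X] [ChartedSpace R4 X] [IsManifold (𝓡 4) ∞ X]
  [RiemannianBundle (fun x : X => Tan x)]

/-- A (noncanonical) orthonormal basis of the tangent space at `x`. -/
def frame (x : X) :
    OrthonormalBasis (Fin (Module.finrank ℝ (Tan x))) ℝ (Tan x) :=
  stdOrthonormalBasis ℝ (Tan x)

/-- The Gram matrix `g(∂ᵢ, ∂ⱼ)` of the coordinate vector fields of the chart around `p`, at the
point with coordinates `z`. -/
def gram (p : X) (z : R4) : Matrix (Fin 4) (Fin 4) ℝ :=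
  Matrix.of fun i j =>
    inner ℝ
      ((mfderiv 𝓘(ℝ, R4) (𝓡 4) (extChartAt (𝓡 4) p).symm z
        (EuclideanSpace.basisFun (Fin 4) ℝ i) : Tan ((extChartAt (𝓡 4) p).symm z)))
      ((mfderiv 𝓘(ℝ, R4) (𝓡 4) (extChartAt (𝓡 4) p).symm z
        (EuclideanSpace.basisFun (Fin 4) ℝ j) : Tan ((extChartAt (𝓡 4) p).symm z)))

variable [MeasurableSpace X] [BorelSpace X]

/-- The Riemannian measure `√(det g) dx¹ dx² dx³ dx⁴` on the domain of the chart around `p`,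
extended by zero. -/
def chartVol (p : X) : Measure X :=
  Measure.map (extChartAt (𝓡 4) p).symm
    (((volume : Measure R4).restrict (extChartAt (𝓡 4) p).target).withDensity
      fun z => ENNReal.ofReal (Real.sqrt (gram p z).det))

/-- The Riemannian measure `dv_g`: the measures `chartVol p` agree on the overlaps of the charts,
and their supremum is the measure obtained by gluing them. -/
def vol : Measure X := ⨆ p : X, chartVol p

end Riemannian

/-! ### Connections, curvature -/

section Curvature

variable {X : Type*} [TopologicalSpace X] [ChartedSpace R4 X] [IsManifold (𝓡 4) ∞ X]
  {F : Type*} [NormedAddCommGroup F] [NormedSpace ℝ F]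
  {V : X → Type*} [TopologicalSpace (TotalSpace F V)]
  [∀ x, AddCommGroup (V x)] [∀ x, Module ℝ (V x)] [∀ x, TopologicalSpace (V x)]
  [∀ x, IsTopologicalAddGroup (V x)] [∀ x, ContinuousSMul ℝ (V x)]
  [FiberBundle F V]

/-- The curvature `R(v, w) s = ∇_v ∇_w s - ∇_w ∇_v s - ∇_[v, w] s` of a connection; the vectors
`v`, `w`, `s` at `x` are extended to sections that are smooth near `x`. -/
def curvature (nabla : CovariantDerivative (𝓡 4) F V) (x : X) (v w : Tan x) (s : V x) : V x :=
  let W₁ : Π y : X, Tan y := FiberBundle.extend R4 v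
  let W₂ : Π y : X, Tan y := FiberBundle.extend R4 w
  let σ : Π y : X, V y := FiberBundle.extend F s
  nabla (fun y => nabla σ y (W₂ y)) x v - nabla (fun y => nabla σ y (W₁ y)) x w
    - nabla σ x (VectorField.mlieBracket (𝓡 4) W₁ W₂ x)

end Curvature

section LeviCivita

variable {X : Type*} [TopologicalSpace X] [ChartedSpace R4 X] [IsManifold (𝓡 4) ∞ X]
  [RiemannianBundle (fun x : X => Tan x)]

instance instRiemannianOneTan
    [h : IsContMDiffRiemannianBundle (𝓡 4) ∞ R4 (fun x : X => Tan x)] :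
    IsContMDiffRiemannianBundle (𝓡 4) 1 R4 (fun x : X => Tan x) :=
  IsContMDiffRiemannianBundle.of_le (n := ∞) (by norm_cast)

/-- `nabla` is the Levi-Civita connection: a smooth, metric, torsion-free connection on the tangent
bundle. -/
structure IsLeviCivita [IsContMDiffRiemannianBundle (𝓡 4) ∞ R4 (fun x : X => Tan x)]
    (nabla : CovariantDerivative (𝓡 4) R4 (fun x : X => Tan x)) : Prop where
  smooth : nabla.ContMDiffCovariantDerivative ∞
  metric : nabla.IsMetricCompatible
  torsion : nabla.torsion = 0

/-- The scalar curvature `k_g` (positive on round spheres), `nabla` being the Levi-Civita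
connection of `g`. -/
def scalarCurvature (nabla : CovariantDerivative (𝓡 4) R4 (fun x : X => Tan x)) (x : X) : ℝ :=
  ∑ i, ∑ j, inner ℝ (curvature nabla x (frame x i) (frame x j) (frame x j)) (frame x i)

end LeviCivita

/-! ### Hermitian bundles and spin^c structures -/

section Hermitian

variable {X : Type*} [TopologicalSpace X] [ChartedSpace R4 X] [IsManifold (𝓡 4) ∞ X]
  (F : Type*) [NormedAddCommGroup F] [NormedSpace ℝ F]
  (V : X → Type*) [TopologicalSpace (TotalSpace F V)]
  [∀ x, NormedAddCommGroup (V x)] [∀ x, InnerProductSpace ℝ (V x)]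
  [FiberBundle F V] [VectorBundle ℝ F V]

/-- A smooth orthogonal complex structure on a Riemannian vector bundle: it makes `V` a Hermitian
vector bundle, with `J` the multiplication by `i`, with Hermitian product
`⟪v, w⟫ + i ⟪v, J w⟫` (complex linear in `v`); so the inner product of `V` is the real part of the
Hermitian product. -/
structure HermitianStructure where
  /-- multiplication by `i` -/
  J : Π x, V x →L[ℝ] V x
  J_J : ∀ x v, J x (J x v) = -v
  inner_J_J : ∀ x v w, inner ℝ (J x v) (J x w) = inner ℝ v w
  smooth : ∀ σ : Π x, V x, IsSmoothSection F σ → IsSmoothSection F (fun x => J x (σ x))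

variable {F V}

/-- `nabla` is a smooth unitary connection on the Hermitian bundle `(V, h)`. -/
structure IsUnitaryConnection [FiniteDimensional ℝ F] [ContMDiffVectorBundle ∞ F V (𝓡 4)]
    [IsContMDiffRiemannianBundle (𝓡 4) ∞ F V]
    (h : HermitianStructure F V) (nabla : CovariantDerivative (𝓡 4) F V) : Prop where
  smooth : nabla.ContMDiffCovariantDerivative ∞
  metric : nabla.IsMetricCompatible
  complex : ∀ σ : Π x, V x, IsSmoothSection F σ → ∀ x v,
    nabla (fun y => h.J y (σ y)) x v = h.J x (nabla σ x v)

end Hermitian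

section Spinc

variable {X : Type*} [TopologicalSpace X] [ChartedSpace R4 X] [IsManifold (𝓡 4) ∞ X]
  [RiemannianBundle (fun x : X => Tan x)]
  (Sp Sm L : X → Type*)
  [TopologicalSpace (TotalSpace R4 Sp)]
  [∀ x, NormedAddCommGroup (Sp x)] [∀ x, InnerProductSpace ℝ (Sp x)]
  [FiberBundle R4 Sp] [VectorBundle ℝ R4 Sp]
  [TopologicalSpace (TotalSpace R4 Sm)]
  [∀ x, NormedAddCommGroup (Sm x)] [∀ x, InnerProductSpace ℝ (Sm x)]
  [FiberBundle R4 Sm] [VectorBundle ℝ R4 Sm]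
  [TopologicalSpace (TotalSpace R2 L)]
  [∀ x, NormedAddCommGroup (L x)] [∀ x, InnerProductSpace ℝ (L x)]
  [FiberBundle R2 L] [VectorBundle ℝ R2 L]

/-- A spin^c structure on the Riemannian 4-manifold `X`, given by its complex spinor bundles
`S⁺ = Sp` and `S⁻ = Sm` (Hermitian, of complex rank 2, so of real rank 4), the Clifford
multiplication `TX → Hom(S⁺, S⁻)`, `ρ(v)* ρ(v) = |v|²`, and its determinant line bundle `L`,
identified with `Λ² S⁺` by the Hermitian isomorphism `φ ∧ ψ ↦ det φ ψ`.
The orientation of `X` is the one for which `S⁺` is the bundle of positive spinors. -/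
structure SpincStructure where
  hp : HermitianStructure R4 Sp
  hm : HermitianStructure R4 Sm
  hL : HermitianStructure R2 L
  /-- Clifford multiplication -/
  cliff : Π x : X, Tan x →L[ℝ] Sp x →L[ℝ] Sm x
  cliff_J : ∀ x v s, cliff x v (hp.J x s) = hm.J x (cliff x v s)
  norm_cliff : ∀ x v s, ‖cliff x v s‖ = ‖v‖ * ‖s‖
  cliff_smooth : ∀ (W : Π x : X, Tan x) (σ : Π x, Sp x), IsSmoothSection R4 W →
    IsSmoothSection R4 σ → IsSmoothSection R4 (fun x => cliff x (W x) (σ x))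
  /-- the wedge product `S⁺ × S⁺ → Λ² S⁺ = L` -/
  det : Π x : X, Sp x →L[ℝ] Sp x →L[ℝ] L x
  det_J : ∀ x s t, det x (hp.J x s) t = hL.J x (det x s t)
  det_self : ∀ x s, det x s s = 0
  norm_det : ∀ x s t, inner ℝ s t = 0 → inner ℝ s (hp.J x t) = 0 →
    ‖det x s t‖ = ‖s‖ * ‖t‖
  det_smooth : ∀ σ τ : Π x, Sp x, IsSmoothSection R4 σ → IsSmoothSection R4 τ →
    IsSmoothSection R2 (fun x => det x (σ x) (τ x))

variable {Sp Sm L}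
variable [IsContMDiffRiemannianBundle (𝓡 4) ∞ R4 (fun x : X => Tan x)]
  [ContMDiffVectorBundle ∞ R4 Sp (𝓡 4)] [IsContMDiffRiemannianBundle (𝓡 4) ∞ R4 Sp]
  [ContMDiffVectorBundle ∞ R4 Sm (𝓡 4)] [IsContMDiffRiemannianBundle (𝓡 4) ∞ R4 Sm]
  [ContMDiffVectorBundle ∞ R2 L (𝓡 4)] [IsContMDiffRiemannianBundle (𝓡 4) ∞ R2 L]

/-- The pair `(nablap, nablam)` is the spin^c connection on `S⁺ ⊕ S⁻` induced by the Levi-Civita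
connection `nabla` of `X` and by the unitary connection `nablaL` on the determinant line bundle:
unitary connections for which Clifford multiplication and the wedge product are parallel. -/
structure IsSpincConnection (S : SpincStructure Sp Sm L)
    (nabla : CovariantDerivative (𝓡 4) R4 (fun x : X => Tan x))
    (nablap : CovariantDerivative (𝓡 4) R4 Sp) (nablam : CovariantDerivative (𝓡 4) R4 Sm)
    (nablaL : CovariantDerivative (𝓡 4) R2 L) : Prop where
  unitaryp : IsUnitaryConnection S.hp nablap
  unitarym : IsUnitaryConnection S.hm nablam
  unitaryL : IsUnitaryConnection S.hL nablaL
  cliff : ∀ (W : Π x : X, Tan x) (σ : Π x, Sp x), IsSmoothSection R4 W → IsSmoothSection R4 σ →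
    ∀ x v, nablam (fun y => S.cliff y (W y) (σ y)) x v
      = S.cliff x (nabla W x v) (σ x) + S.cliff x (W x) (nablap σ x v)
  det : ∀ σ τ : Π x, Sp x, IsSmoothSection R4 σ → IsSmoothSection R4 τ →
    ∀ x v, nablaL (fun y => S.det y (σ y) (τ y)) x v
      = S.det x (nablap σ x v) (τ x) + S.det x (σ x) (nablap τ x v)

end Spinc

/-! ### Sobolev sections -/

section Sobolev

variable {X : Type*} [TopologicalSpace X] [ChartedSpace R4 X] [IsManifold (𝓡 4) ∞ X]
  [RiemannianBundle (fun x : X => Tan x)]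
  {F : Type*} [NormedAddCommGroup F] [NormedSpace ℝ F]
  {V : X → Type*} [TopologicalSpace (TotalSpace F V)]
  [∀ x, NormedAddCommGroup (V x)] [∀ x, InnerProductSpace ℝ (V x)]
  [FiberBundle F V]

/-- The inner product of two elements of `T*_x X ⊗ V_x = Hom(T_x X, V_x)`. -/
def hsInner {x : X} (α β : Tan x →L[ℝ] V x) : ℝ :=
  ∑ i, inner ℝ (α (frame x i)) (β (frame x i))

/-- A section of `V`, not necessarily continuous, together with a candidate for its covariant
derivative. -/
abbrev Jet (V : X → Type*) [∀ x, NormedAddCommGroup (V x)] [∀ x, InnerProductSpace ℝ (V x)] :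
    Type _ :=
  Π x : X, V x × (Tan x →L[ℝ] V x)

/-- `σ` together with its covariant derivative. -/
def jet (nabla : CovariantDerivative (𝓡 4) F V) (σ : Π x, V x) : Jet V :=
  fun x => (σ x, nabla σ x)

variable [MeasurableSpace X] [BorelSpace X]

/-- `u = (σ, ∇σ)` with `σ` in the Sobolev space `L^{1,2}(V)` and `∇σ` its (weak) covariant
derivative: `u` is a limit of smooth sections and their covariant derivatives, in the norm
`(∫ |σ|² + |∇σ|²)^{1/2}` and almost everywhere. (A sequence that converges in this norm has a
subsequence that converges almost everywhere; the second requirement makes `u` measurable.) -/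
def IsL12 (nabla : CovariantDerivative (𝓡 4) F V) (u : Jet V) : Prop :=
  ∃ σ : ℕ → Π x, V x, (∀ n, IsSmoothSection F (σ n)) ∧
    (∀ᵐ x ∂(vol : Measure X), Tendsto (fun n => jet nabla (σ n) x) atTop (𝓝 (u x))) ∧
    Tendsto (fun n => ∫⁻ x, ENNReal.ofReal (‖σ n x - (u x).1‖ ^ 2
      + hsInner (nabla (σ n) x - (u x).2) (nabla (σ n) x - (u x).2)) ∂(vol : Measure X))
      atTop (𝓝 0)

end Sobolev

/-! ### The Seiberg–Witten functional

Imaginary-valued one-forms `Θ = i ⟨θ, ·⟩` are given by the real vector field `θ`, metrically dual to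
the real one-form; imaginary-valued two-forms `i β` are given by the real two-form `β`. The
covariant derivative of a form is that of the dual vector field, as the metric is parallel. -/

section Functional

variable {X : Type*} [TopologicalSpace X] [ChartedSpace R4 X] [IsManifold (𝓡 4) ∞ X]
  [RiemannianBundle (fun x : X => Tan x)]
  {Sp Sm L : X → Type*}
  [TopologicalSpace (TotalSpace R4 Sp)]
  [∀ x, NormedAddCommGroup (Sp x)] [∀ x, InnerProductSpace ℝ (Sp x)]
  [FiberBundle R4 Sp] [VectorBundle ℝ R4 Sp]
  [TopologicalSpace (TotalSpace R4 Sm)]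
  [∀ x, NormedAddCommGroup (Sm x)] [∀ x, InnerProductSpace ℝ (Sm x)]
  [FiberBundle R4 Sm] [VectorBundle ℝ R4 Sm]
  [TopologicalSpace (TotalSpace R2 L)]
  [∀ x, NormedAddCommGroup (L x)] [∀ x, InnerProductSpace ℝ (L x)]
  [FiberBundle R2 L] [VectorBundle ℝ R2 L]

/-- The exterior derivative `dθ (v, w) = (∇_v θ)(w) - (∇_w θ)(v)` of a one-form, in terms of its
covariant derivative `gradθ` with respect to the Levi-Civita connection. -/
def extD {x : X} (gradθ : Tan x →L[ℝ] Tan x) (v w : Tan x) : ℝ :=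
  inner ℝ (gradθ v) w - inner ℝ (gradθ w) v

/-- The inner product of two-forms, `∑_{i < j} α(eᵢ, eⱼ) β(eᵢ, eⱼ)`. -/
def formInner {x : X} (α β : Tan x → Tan x → ℝ) : ℝ :=
  (1 / 2) * ∑ i, ∑ j, α (frame x i) (frame x j) * β (frame x i) (frame x j)

/-- The curvature form `β` of a unitary connection on the Hermitian line bundle `L`: the curvature
is `i β`, that is `R(v, w) s = β(v, w) J s`, and `L` has real rank 2. -/
def lineCurvature (hL : HermitianStructure R2 L) (nablaL : CovariantDerivative (𝓡 4) R2 L)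
    (x : X) (v w : Tan x) : ℝ :=
  letI : FiniteDimensional ℝ (L x) :=
    Module.Finite.equiv
      ((trivializationAt R2 L x).linearEquivAt ℝ x
        (FiberBundle.mem_baseSet_trivializationAt' x)).symm
  (1 / 2) * ∑ k, inner ℝ (curvature nablaL x v w (stdOrthonormalBasis ℝ (L x) k))
    (hL.J x (stdOrthonormalBasis ℝ (L x) k))

/-- `F_A` for the connection `A = A₀ + a`: the two-form `F_{A₀} + da`. -/
def curvA (hL : HermitianStructure R2 L) (nablaL : CovariantDerivative (𝓡 4) R2 L)
    (a : Jet (fun x : X => Tan x)) (x : X) (v w : Tan x) : ℝ :=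
  lineCurvature hL nablaL x v w + extD (a x).2 v w

/-- The operator `Φ(Θ) = Θ(φ)` at `x`: the one-form `Θ = i ⟨θ, ·⟩` acts on the spinor `s` by
`v ↦ c Θ(v) s`, where `c` is the weight of the action of `u₁ = iℝ` on spinors: `c = 1` if `Θ` acts
by scalar multiplication, `c = 1/2` for the spin^c connection induced by a connection on `L`. -/
def Phi (hp : HermitianStructure R4 Sp) (c : ℝ) {x : X} (s : Sp x) (θ : Tan x) :
    Tan x →L[ℝ] Sp x :=
  c • (innerSL ℝ θ).smulRight (hp.J x s)

/-- The pointwise adjoint `Φ*` of `Φ` with respect to the real inner products, see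
`hsInner_Phi`. -/
def PhiAdj (hp : HermitianStructure R4 Sp) (c : ℝ) {x : X} (s : Sp x) (ψ : Tan x →L[ℝ] Sp x) :
    Tan x :=
  ∑ i, (c * inner ℝ (ψ (frame x i)) (hp.J x s)) • frame x i

theorem hsInner_Phi (hp : HermitianStructure R4 Sp) (c : ℝ) {x : X} (s : Sp x)
    (ψ : Tan x →L[ℝ] Sp x) (θ : Tan x) :
    hsInner ψ (Phi hp c s θ) = inner ℝ (PhiAdj hp c s ψ) θ := by
  simp only [hsInner, Phi, PhiAdj, sum_inner, inner_smul_left, smul_apply,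
    ContinuousLinearMap.smulRight_apply, inner_smul_right, innerSL_apply_apply]
  refine Finset.sum_congr rfl fun i _ => ?_
  rw [real_inner_comm (frame x i) θ]
  simp
  ring

/-- `∇^A φ = ∇^{A₀} φ + a(φ)` for `A = A₀ + a`. -/
def covA (hp : HermitianStructure R4 Sp) (c : ℝ) (a : Jet (fun x : X => Tan x)) (φ : Jet Sp)
    (x : X) : Tan x →L[ℝ] Sp x :=
  (φ x).2 + Phi hp c (φ x).1 (a x).1

/-- The integrand `¼ |F_A|² + |∇^A φ|² + ⅛ |φ|⁴ + ¼ k_g |φ|²`. -/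
def density (S : SpincStructure Sp Sm L)
    (nabla : CovariantDerivative (𝓡 4) R4 (fun x : X => Tan x))
    (nablaL : CovariantDerivative (𝓡 4) R2 L) (c : ℝ)
    (a : Jet (fun x : X => Tan x)) (φ : Jet Sp) (x : X) : ℝ :=
  (1 / 4) * formInner (curvA S.hL nablaL a x) (curvA S.hL nablaL a x)
    + hsInner (covA S.hp c a φ x) (covA S.hp c a φ x)
    + (1 / 8) * ‖(φ x).1‖ ^ 4
    + (1 / 4) * scalarCurvature nabla x * ‖(φ x).1‖ ^ 2

variable [MeasurableSpace X] [BorelSpace X]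

/-- The Seiberg–Witten functional, at `(A₀ + a, φ)`. -/
def SW (S : SpincStructure Sp Sm L)
    (nabla : CovariantDerivative (𝓡 4) R4 (fun x : X => Tan x))
    (nablaL : CovariantDerivative (𝓡 4) R2 L) (c : ℝ)
    (a : Jet (fun x : X => Tan x)) (φ : Jet Sp) : ℝ :=
  ∫ x, density S nabla nablaL c a φ x ∂vol

/-- `(A₀ + a, φ)` is a critical point of the functional on the space of `L^{1,2}` pairs: its
derivatives in all `L^{1,2}` directions `(Θ, Λ)` are zero. -/
def IsCritical (S : SpincStructure Sp Sm L)
    (nabla : CovariantDerivative (𝓡 4) R4 (fun x : X => Tan x))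
    (nablap : CovariantDerivative (𝓡 4) R4 Sp)
    (nablaL : CovariantDerivative (𝓡 4) R2 L) (c : ℝ)
    (a : Jet (fun x : X => Tan x)) (φ : Jet Sp) : Prop :=
  ∀ (Θ : Jet (fun x : X => Tan x)) (Λ : Jet Sp), IsL12 nabla Θ → IsL12 nablap Λ →
    HasDerivAt (fun t : ℝ => SW S nabla nablaL c (a + t • Θ) (φ + t • Λ)) 0 0

/-- `u = (∇^A)* ψ`, where `(∇^A)*` is the `L²`-adjoint of `∇^A`, in the sense of distributions:
`∫ ⟨u, Λ⟩ = ∫ ⟨ψ, ∇^A Λ⟩` for all smooth spinors `Λ`. -/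
def IsCovAdjoint (hp : HermitianStructure R4 Sp) (nablap : CovariantDerivative (𝓡 4) R4 Sp) (c : ℝ)
    (a : Jet (fun x : X => Tan x)) (ψ : Π x, Tan x →L[ℝ] Sp x) (u : Π x, Sp x) : Prop :=
  ∀ Λ : Π x, Sp x, IsSmoothSection R4 Λ →
    Integrable (fun x => inner ℝ (u x) (Λ x)) vol ∧
    Integrable (fun x => hsInner (ψ x) (covA hp c a (jet nablap Λ) x)) vol ∧
    ∫ x, inner ℝ (u x) (Λ x) ∂vol = ∫ x, hsInner (ψ x) (covA hp c a (jet nablap Λ) x) ∂vol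

/-- `η = d* β`, where `d*` is the `L²`-adjoint of `d` from one-forms to two-forms, in the sense of
distributions: `∫ ⟨η, Θ⟩ = ∫ ⟨β, dΘ⟩` for all smooth one-forms `Θ`. -/
def IsCodifferential (nabla : CovariantDerivative (𝓡 4) R4 (fun x : X => Tan x))
    (β : Π x : X, Tan x → Tan x → ℝ) (η : Π x : X, Tan x) : Prop :=
  ∀ Θ : Π x : X, Tan x, IsSmoothSection R4 Θ →
    Integrable (fun x => inner ℝ (η x) (Θ x)) vol ∧
    Integrable (fun x => formInner (β x) (extD (nabla Θ x))) vol ∧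
    ∫ x, inner ℝ (η x) (Θ x) ∂vol = ∫ x, formInner (β x) (extD (nabla Θ x)) ∂vol

/-- The equation `Δ_A φ + (|φ|²/4) φ + (k_g/4) φ = 0`, where `Δ_A φ = (∇^A)* ∇^A φ`. -/
def SpinorEquation (S : SpincStructure Sp Sm L)
    (nabla : CovariantDerivative (𝓡 4) R4 (fun x : X => Tan x))
    (nablap : CovariantDerivative (𝓡 4) R4 Sp) (c : ℝ)
    (a : Jet (fun x : X => Tan x)) (φ : Jet Sp) : Prop :=
  ∃ Δφ : Π x, Sp x, IsCovAdjoint S.hp nablap c a (covA S.hp c a φ) Δφ ∧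
    ∀ᵐ x ∂(vol : Measure X), Δφ x + (‖(φ x).1‖ ^ 2 / 4) • (φ x).1
      + (scalarCurvature nabla x / 4) • (φ x).1 = 0

/-- The equation `d* F_A + 4 Φ*(∇^A φ) = 0`, where `Φ(Θ) = Θ(φ)`. -/
def CurvatureEquation (S : SpincStructure Sp Sm L)
    (nabla : CovariantDerivative (𝓡 4) R4 (fun x : X => Tan x))
    (nablaL : CovariantDerivative (𝓡 4) R2 L) (c : ℝ)
    (a : Jet (fun x : X => Tan x)) (φ : Jet Sp) : Prop :=
  ∃ δF : Π x : X, Tan x, IsCodifferential nabla (curvA S.hL nablaL a) δF ∧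
    ∀ᵐ x ∂(vol : Measure X), δF x + (4 : ℝ) • PhiAdj S.hp c (φ x).1 (covA S.hp c a φ x) = 0

end Functional

end SeibergWitten

end

/-!
The integrand is a polynomial in the pair `(A, φ)` and its derivatives: along a line
`(A + tΘ, φ + tΛ)` it is a polynomial of degree four in `t`. If its coefficients are integrable, the
functional is a polynomial in `t`, and its derivative at `t = 0` is the integral of the linear
coefficient (`exists_density_expansion`, `hasDerivAt_SW`). This coefficient is the sum of a part
linear in the jet of `Λ` and a part linear in the jet of `Θ`; for smooth `Λ` and `Θ` their integrals
vanish exactly when the two equations hold in the sense of distributions (`spinorEquation_iff`,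
`curvatureEquation_iff`).

What has to be proved is thus analytic. The quartic terms are integrable because `L^{1,2} ⊆ L⁴` in
dimension four. The Gagliardo–Nirenberg–Sobolev inequality of `ℝ⁴` is carried to the manifold in
charts, where the Riemannian measure is comparable to the Lebesgue measure
(`exists_chart_comparison`), and it is applied to the functions `√(ε² + |σ|²)`, whose derivative is
at most `|∇σ|` since the connection is metric (`exists_eLpNorm_four_section_le`). By Fatou's lemma
the `L^{1,2}`-limits of smooth sections are limits in `L⁴` (`IsL12.exists_tendsto`). So the first
variation is bounded on `L^{1,2}`, and it vanishes there as soon as it vanishes in smooth directions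
(`IsL12.integral_eq_zero_of_smooth`).

The remaining coefficients are the scalar curvature and the curvature of the determinant line
bundle, which are continuous, hence bounded: the curvature is defined by extending vectors to local
sections, and it is tensorial (`curvature_apply`), so that it can be computed in smooth local
orthonormal frames (`exists_orthonormalBasis_sections`). Tensoriality in the section follows from
that in the vector fields, as the curvature of a metric connection is skew-symmetric
(`inner_curvatureField`).
-/

noncomputable section

set_option linter.unusedSectionVars false

namespace SeibergWitten

/-! ### Smooth sections and local orthonormal frames -/

section SmoothSections

variable {X : Type*} [TopologicalSpace X] [ChartedSpace R4 X] [IsManifold (𝓡 4) ∞ X]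
  {F : Type*} [NormedAddCommGroup F] [NormedSpace ℝ F]
  {V : X → Type*} [TopologicalSpace (TotalSpace F V)]
  [∀ x, NormedAddCommGroup (V x)] [∀ x, InnerProductSpace ℝ (V x)]
  [FiberBundle F V] [VectorBundle ℝ F V]

theorem isSmoothSection_zero : IsSmoothSection F (0 : Π x, V x) :=
  contMDiff_zeroSection ℝ V

theorem IsSmoothSection.add {σ τ : Π x, V x} (hσ : IsSmoothSection F σ)
    (hτ : IsSmoothSection F τ) : IsSmoothSection F (σ + τ) :=
  ContMDiff.add_section hσ hτ

theorem IsSmoothSection.sub {σ τ : Π x, V x} (hσ : IsSmoothSection F σ)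
    (hτ : IsSmoothSection F τ) : IsSmoothSection F (σ - τ) :=
  ContMDiff.sub_section hσ hτ

theorem IsSmoothSection.smul {f : X → ℝ} {σ : Π x, V x} (hf : ContMDiff (𝓡 4) 𝓘(ℝ) ∞ f)
    (hσ : IsSmoothSection F σ) : IsSmoothSection F (f • σ) :=
  ContMDiff.smul_section hf hσ

theorem IsSmoothSection.const_smul (c : ℝ) {σ : Π x, V x}
    (hσ : IsSmoothSection F σ) : IsSmoothSection F (c • σ) :=
  ContMDiff.const_smul_section hσ

theorem IsSmoothSection.sum {ι : Type*} {s : Finset ι} {σ : ι → Π x, V x}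
    (hσ : ∀ i ∈ s, IsSmoothSection F (σ i)) : IsSmoothSection F (fun x => ∑ i ∈ s, σ i x) :=
  ContMDiff.sum_section hσ

theorem IsSmoothSection.mdifferentiableAt {σ : Π x, V x} (hσ : IsSmoothSection F σ) (x : X) :
    MDifferentiableAt (𝓡 4) ((𝓡 4).prod 𝓘(ℝ, F)) (fun x => TotalSpace.mk' F x (σ x)) x :=
  (hσ x).mdifferentiableAt (by simp)

theorem IsSmoothSection.inner [IsContMDiffRiemannianBundle (𝓡 4) ∞ F V] {σ τ : Π x, V x}
    (hσ : IsSmoothSection F σ) (hτ : IsSmoothSection F τ) :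
    ContMDiff (𝓡 4) 𝓘(ℝ) ∞ (fun x => inner ℝ (σ x) (τ x)) :=
  ContMDiff.inner_bundle (b := fun x => x) hσ hτ

/-- A section that is smooth near `p` agrees near `p` with a global smooth section. -/
theorem exists_isSmoothSection_eventuallyEq [T2Space X] {p : X} {U : Set X} (hU : U ∈ 𝓝 p)
    {σ : Π x, V x}
    (hσ : ContMDiffOn (𝓡 4) ((𝓡 4).prod 𝓘(ℝ, F)) ∞ (fun x => TotalSpace.mk' F x (σ x)) U) :
    ∃ τ : Π x, V x, IsSmoothSection F τ ∧ ∀ᶠ x in 𝓝 p, τ x = σ x := by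
  obtain ⟨f, -, hf⟩ := (SmoothBumpFunction.nhds_basis_tsupport (I := 𝓡 4) p).mem_iff.1
    (interior_mem_nhds.2 hU)
  refine ⟨(f : X → ℝ) • σ, ?_, ?_⟩
  · exact ContMDiffOn.smul_section_of_tsupport (u := interior U) f.contMDiff.contMDiffOn
      isOpen_interior hf (hσ.mono interior_subset)
  · filter_upwards [f.eventuallyEq_one] with x hx
    simp [hx]

variable (F) in
/-- The local extension of a vector that enters the definition of the curvature agrees near the
base point with a global smooth section. -/
theorem exists_isSmoothSection_extend [T2Space X] [ContMDiffVectorBundle ∞ F V (𝓡 4)] {p : X}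
    (v : V p) :
    ∃ τ : Π x, V x, IsSmoothSection F τ ∧ ∀ᶠ x in 𝓝 p, τ x = FiberBundle.extend F v x := by
  obtain ⟨s, hs, h⟩ := FiberBundle.exists_contMDiffOn_extend (k := ∞) (𝓡 4) F v
  exact exists_isSmoothSection_eventuallyEq hs h

variable (F) in
theorem exists_isSmoothSection_apply_eq [T2Space X] [ContMDiffVectorBundle ∞ F V (𝓡 4)] {p : X}
    (v : V p) : ∃ τ : Π x, V x, IsSmoothSection F τ ∧ τ p = v := by
  obtain ⟨τ, hτ, h⟩ := exists_isSmoothSection_extend F v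
  exact ⟨τ, hτ, by simpa using h.self_of_nhds⟩

variable (F) in
theorem finrank_fiber [ContMDiffVectorBundle ∞ F V (𝓡 4)] (x : X) :
    Module.finrank ℝ (V x) = Module.finrank ℝ F :=
  (VectorBundle.continuousLinearEquivAt ℝ F V x).toLinearEquiv.finrank_eq

variable [IsContMDiffRiemannianBundle (𝓡 4) ∞ F V] [ContMDiffVectorBundle ∞ F V (𝓡 4)]

variable (F V) in
/-- Local smooth orthonormal systems, by induction on their length: a vector orthogonal to the
system at `p` is extended to a smooth section, projected to the orthogonal complement of the
system, and normalised near `p`. -/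
theorem exists_orthonormal_sections [T2Space X] [FiniteDimensional ℝ F] (p : X) (k : ℕ)
    (hk : k ≤ Module.finrank ℝ F) :
    ∃ s : Fin k → Π x, V x, (∀ i, IsSmoothSection F (s i)) ∧
      ∀ᶠ x in 𝓝 p, Orthonormal ℝ (fun i => s i x) := by
  induction k with
  | zero => exact ⟨fun i => i.elim0, fun i => i.elim0, Eventually.of_forall fun x =>
      ⟨fun i => i.elim0, fun i => i.elim0⟩⟩
  | succ k ih =>
    obtain ⟨s, hs, hon⟩ := ih (by omega)
    have : FiniteDimensional ℝ (V p) := VectorBundle.finiteDimensional ℝ F V p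
    -- a nonzero vector orthogonal to the system at `p`
    obtain ⟨w, hw, hw0⟩ : ∃ w : V p, (∀ i, inner ℝ w (s i p) = 0) ∧ w ≠ 0 := by
      have hne : (Submodule.span ℝ (Set.range fun i => s i p))ᗮ ≠ ⊥ := by
        rw [Ne, Submodule.orthogonal_eq_bot_iff]
        intro htop
        have h1 := finrank_range_le_card (R := ℝ) (fun i => s i p)
        rw [Set.finrank, htop, finrank_top, finrank_fiber F p, Fintype.card_fin] at h1
        omega
      obtain ⟨w, hw, hw0⟩ := Submodule.exists_mem_ne_zero_of_ne_bot hne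
      refine ⟨w, fun i => ?_, hw0⟩
      rw [real_inner_comm]
      exact (Submodule.mem_orthogonal _ _).1 hw _ (Submodule.subset_span ⟨i, rfl⟩)
    obtain ⟨σ, hσ, hσp⟩ := exists_isSmoothSection_apply_eq F w
    let σ' : Π x, V x := σ - fun x => ∑ i, ((fun y => inner ℝ (σ y) (s i y)) • s i) x
    have hσ' : IsSmoothSection F σ' :=
      hσ.sub (IsSmoothSection.sum (σ := fun i => (fun y => inner ℝ (σ y) (s i y)) • s i)
        fun i _ => IsSmoothSection.smul (hσ.inner (hs i)) (hs i))
    have hσ'p : σ' p = w := by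
      simp [σ', hσp, hw]
    let r : X → ℝ := fun x => inner ℝ (σ' x) (σ' x)
    have hr : ContMDiff (𝓡 4) 𝓘(ℝ) ∞ r := hσ'.inner hσ'
    have hrp : r p ≠ 0 := by simpa [r, hσ'p] using hw0
    let U : Set X := {x | r x ≠ 0}
    have hUo : IsOpen U := isOpen_ne_fun hr.continuous continuous_const
    have hU : U ∈ 𝓝 p := hUo.mem_nhds hrp
    have hg : ContMDiffOn (𝓡 4) 𝓘(ℝ) ∞ (fun x => (√(r x))⁻¹) U := by
      intro x hx
      have h1 : ContDiffAt ℝ ∞ (fun t : ℝ => (√t)⁻¹) (r x) :=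
        (Real.contDiffAt_sqrt hx).inv (Real.sqrt_ne_zero'.2
          (lt_of_le_of_ne real_inner_self_nonneg (Ne.symm hx)))
      exact (ContMDiffAt.comp x h1.contMDiffAt (hr x)).contMDiffWithinAt
    have hgσ : ContMDiffOn (𝓡 4) ((𝓡 4).prod 𝓘(ℝ, F)) ∞
        (fun x => TotalSpace.mk' F x (((fun x => (√(r x))⁻¹) • σ' : Π x, V x) x)) U :=
      ContMDiffOn.smul_section (s := σ') hg (ContMDiff.contMDiffOn hσ')
    obtain ⟨τ, hτ, hτe⟩ := exists_isSmoothSection_eventuallyEq hU hgσ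
    refine ⟨Fin.cons τ s, ?_, ?_⟩
    · intro i
      refine Fin.cases ?_ (fun j => ?_) i
      · simpa using hτ
      · simpa using hs j
    · filter_upwards [hon, hτe, hU] with x hx hτx hrx
      have hτx' : τ x = (√(r x))⁻¹ • σ' x := hτx
      have hnorm : ‖τ x‖ = 1 := by
        have h0 : √(r x) = ‖σ' x‖ := by
          simp only [r, real_inner_self_eq_norm_sq]
          exact Real.sqrt_sq (norm_nonneg _)
        have hne : ‖σ' x‖ ≠ 0 := by
          rw [← h0]
          exact Real.sqrt_ne_zero'.2 (lt_of_le_of_ne real_inner_self_nonneg (Ne.symm hrx))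
        rw [hτx', h0, norm_smul, norm_inv, norm_norm, inv_mul_cancel₀ hne]
      have horth : ∀ j, inner ℝ (τ x) (s j x) = 0 := by
        intro j
        have h1 : inner ℝ (σ' x) (s j x) = 0 := by
          simp only [σ', Pi.sub_apply, Pi.smul_apply', inner_sub_left, sum_inner,
            inner_smul_left]
          simp [orthonormal_iff_ite.1 hx]
        rw [hτx', inner_smul_left, h1, mul_zero]
      constructor
      · intro i
        refine Fin.cases ?_ (fun j => ?_) i
        · simpa using hnorm
        · simpa using hx.1 j
      · intro i j
        refine Fin.cases ?_ (fun i => ?_) i <;> refine Fin.cases ?_ (fun j => ?_) j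
        · simp
        · intro _; simpa using horth j
        · intro _; simpa [real_inner_comm] using horth i
        · intro hij
          simpa using hx.2 (i := i) (j := j) (by simpa using hij)

variable (F V) in
/-- Every point `p` has global smooth sections that form an orthonormal basis of the fibres
near `p`. -/
theorem exists_orthonormalBasis_sections [T2Space X] [FiniteDimensional ℝ F] (p : X) :
    ∃ s : Fin (Module.finrank ℝ F) → Π x, V x, (∀ i, IsSmoothSection F (s i)) ∧
      ∀ᶠ x in 𝓝 p, ∃ b : OrthonormalBasis (Fin (Module.finrank ℝ F)) ℝ (V x),
        ∀ i, b i = s i x := by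
  obtain ⟨s, hs, h⟩ := exists_orthonormal_sections F V p _ le_rfl
  refine ⟨s, hs, h.mono fun x hx => ?_⟩
  have : FiniteDimensional ℝ (V x) := VectorBundle.finiteDimensional ℝ F V x
  have hspan : ⊤ ≤ Submodule.span ℝ (Set.range fun i => s i x) :=
    (hx.linearIndependent.span_eq_top_of_card_eq_finrank' (by
      rw [Fintype.card_fin, finrank_fiber F x])).ge
  exact ⟨OrthonormalBasis.mk hx hspan, fun i => by simp⟩

end SmoothSections

/-! ### Contractions with orthonormal bases -/

section Contraction

/-- The trace of a bilinear form does not depend on the orthonormal basis. -/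
theorem sum_apply_orthonormalBasis_eq {E ι κ : Type*} [NormedAddCommGroup E]
    [InnerProductSpace ℝ E] [Fintype ι] [Fintype κ] (b : OrthonormalBasis ι ℝ E)
    (b' : OrthonormalBasis κ ℝ E) (B : E →ₗ[ℝ] E →ₗ[ℝ] ℝ) :
    ∑ i, B (b i) (b i) = ∑ j, B (b' j) (b' j) := by
  classical
  have h1 : ∀ i, B (b i) (b i)
      = ∑ j, ∑ k, (inner ℝ (b' j) (b i) * inner ℝ (b i) (b' k)) * B (b' j) (b' k) := by
    intro i
    conv_lhs => rw [← b'.sum_repr' (b i)]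
    simp only [map_sum, map_smul, LinearMap.sum_apply, LinearMap.smul_apply, smul_eq_mul,
      Finset.mul_sum]
    rw [Finset.sum_comm]
    refine Finset.sum_congr rfl fun j _ => Finset.sum_congr rfl fun k _ => ?_
    rw [real_inner_comm (b i) (b' k)]
    ring
  simp only [h1]
  rw [Finset.sum_comm]
  refine Finset.sum_congr rfl fun j _ => ?_
  rw [Finset.sum_comm]
  simp only [← Finset.sum_mul, b.sum_inner_mul_inner]
  simp [orthonormal_iff_ite.1 b'.orthonormal]

variable {X : Type*} [TopologicalSpace X] [ChartedSpace R4 X]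
  [RiemannianBundle (fun x : X => Tan x)]
  {V : X → Type*} [∀ x, NormedAddCommGroup (V x)] [∀ x, InnerProductSpace ℝ (V x)]

/-- The inner product of `T*_x X ⊗ V_x` can be computed in any orthonormal basis of `T_x X`. -/
theorem hsInner_eq_sum {ι : Type*} [Fintype ι] {x : X} (b : OrthonormalBasis ι ℝ (Tan x))
    (α β : Tan x →L[ℝ] V x) : hsInner α β = ∑ i, inner ℝ (α (b i)) (β (b i)) :=
  sum_apply_orthonormalBasis_eq (frame x) b
    ((innerₗ (V x)).compl₁₂ (α : Tan x →ₗ[ℝ] V x) (β : Tan x →ₗ[ℝ] V x))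

variable {x : X}

theorem hsInner_comm (α β : Tan x →L[ℝ] V x) : hsInner α β = hsInner β α := by
  simp only [hsInner, real_inner_comm]

theorem hsInner_add_left (α β γ : Tan x →L[ℝ] V x) :
    hsInner (α + β) γ = hsInner α γ + hsInner β γ := by
  simp [hsInner, inner_add_left, Finset.sum_add_distrib]

theorem hsInner_add_right (α β γ : Tan x →L[ℝ] V x) :
    hsInner α (β + γ) = hsInner α β + hsInner α γ := by
  simp [hsInner, inner_add_right, Finset.sum_add_distrib]

theorem hsInner_sub_left (α β γ : Tan x →L[ℝ] V x) :
    hsInner (α - β) γ = hsInner α γ - hsInner β γ := by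
  simp [hsInner, inner_sub_left, Finset.sum_sub_distrib]

theorem hsInner_sub_right (α β γ : Tan x →L[ℝ] V x) :
    hsInner α (β - γ) = hsInner α β - hsInner α γ := by
  simp [hsInner, inner_sub_right, Finset.sum_sub_distrib]

theorem hsInner_smul_left (c : ℝ) (α β : Tan x →L[ℝ] V x) :
    hsInner (c • α) β = c * hsInner α β := by
  simp [hsInner, inner_smul_left, Finset.mul_sum]

theorem hsInner_smul_right (c : ℝ) (α β : Tan x →L[ℝ] V x) :
    hsInner α (c • β) = c * hsInner α β := by
  simp [hsInner, inner_smul_right, Finset.mul_sum]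

theorem hsInner_self_nonneg (α : Tan x →L[ℝ] V x) : 0 ≤ hsInner α α :=
  Finset.sum_nonneg fun _ _ => real_inner_self_nonneg

theorem abs_hsInner_le (α β : Tan x →L[ℝ] V x) :
    |hsInner α β| ≤ (hsInner α α + hsInner β β) / 2 := by
  have h1 := hsInner_self_nonneg (α - β)
  have h2 := hsInner_self_nonneg (α + β)
  simp only [hsInner_sub_left, hsInner_sub_right, hsInner_add_left, hsInner_add_right,
    hsInner_comm β α] at h1 h2
  rw [abs_le]
  constructor <;> linarith

theorem hsInner_add_self_le (α β : Tan x →L[ℝ] V x) :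
    hsInner (α + β) (α + β) ≤ 2 * hsInner α α + 2 * hsInner β β := by
  have h1 := hsInner_self_nonneg (α - β)
  simp only [hsInner_sub_left, hsInner_sub_right, hsInner_add_left, hsInner_add_right,
    hsInner_comm β α] at h1 ⊢
  linarith

/-- The operator norm is at most the Hilbert–Schmidt norm. -/
theorem norm_apply_sq_le_hsInner (α : Tan x →L[ℝ] V x) (v : Tan x) :
    ‖α v‖ ^ 2 ≤ hsInner α α * ‖v‖ ^ 2 := by
  have h1 : ‖α v‖ ≤ ∑ i, |inner ℝ (frame x i) v| * ‖α (frame x i)‖ := by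
    conv_lhs => rw [← (frame x).sum_repr' v]
    rw [map_sum]
    refine (norm_sum_le _ _).trans (le_of_eq ?_)
    simp [norm_smul]
  have h2 : ∑ i, |inner ℝ (frame x i) v| ^ 2 = ‖v‖ ^ 2 := by
    simpa using (frame x).sum_sq_norm_inner_right v
  calc ‖α v‖ ^ 2 ≤ (∑ i, |inner ℝ (frame x i) v| * ‖α (frame x i)‖) ^ 2 := by gcongr
    _ ≤ (∑ i, |inner ℝ (frame x i) v| ^ 2) * ∑ i, ‖α (frame x i)‖ ^ 2 :=
        Finset.sum_mul_sq_le_sq_mul_sq _ _ _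
    _ = hsInner α α * ‖v‖ ^ 2 := by
        rw [h2, mul_comm, hsInner]
        simp only [real_inner_self_eq_norm_sq]

end Contraction

/-! ### Curvature as a tensor -/

section Commutator

open VectorField

variable {X : Type*} [TopologicalSpace X] [ChartedSpace R4 X] [IsManifold (𝓡 4) ∞ X]

theorem isManifold_of_le {n : ℕ∞ω} (hn : n ≤ (∞ : ℕ∞ω)) : IsManifold (𝓡 4) n X :=
  IsManifold.of_le hn

theorem IsSmoothSection.mlieBracket {U W : Π x : X, Tan x} (hU : IsSmoothSection R4 U)
    (hW : IsSmoothSection R4 W) : IsSmoothSection R4 (mlieBracket (𝓡 4) U W) := by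
  intro x
  have : IsManifold (𝓡 4) (((⊤ : ℕ∞) : ℕ∞ω) + 1) X := isManifold_of_le (by simp)
  have : IsManifold (𝓡 4) (minSmoothness ℝ 2) X := isManifold_of_le (by
    rw [minSmoothness_of_isRCLikeNormedField]; exact ENat.LEInfty.out)
  exact ContMDiffAt.mlieBracket_vectorField (n := ⊤) (m := ⊤) (hU x) (hW x) (by simp)

variable [T2Space X] [RiemannianBundle (fun x : X => Tan x)]
  [IsContMDiffRiemannianBundle (𝓡 4) ∞ R4 (fun x : X => Tan x)]

/-- The derivative of a smooth function along a smooth vector field is differentiable: near a point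
it equals `⟪[W, f Z] - f [W, Z], Z⟫` for a unit vector field `Z`. -/
theorem mdifferentiableAt_mvfderiv_apply {f : X → ℝ} (hf : ContMDiff (𝓡 4) 𝓘(ℝ) ∞ f)
    {W : Π x : X, Tan x} (hW : IsSmoothSection R4 W) (x : X) :
    MDifferentiableAt (𝓡 4) 𝓘(ℝ) (fun y => mvfderiv (𝓡 4) f y (W y)) x := by
  obtain ⟨s, hs, hon⟩ := exists_orthonormal_sections R4 (fun x : X => Tan x) x 1 (by simp)
  have h1 : IsSmoothSection R4 (mlieBracket (𝓡 4) W (f • s 0) - f • mlieBracket (𝓡 4) W (s 0)) :=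
    (hW.mlieBracket (IsSmoothSection.smul hf (hs 0))).sub
      (IsSmoothSection.smul hf (hW.mlieBracket (hs 0)))
  have h2 := ((h1.inner (hs 0)) x).mdifferentiableAt (by simp)
  refine h2.congr_of_eventuallyEq ?_
  filter_upwards [hon] with y hy
  have h3 : inner ℝ (s 0 y) (s 0 y) = 1 := by
    rw [real_inner_self_eq_norm_sq, hy.1 0, one_pow]
  rw [Pi.sub_apply, mlieBracket_smul_right ((hf y).mdifferentiableAt (by simp))
    ((hs 0).mdifferentiableAt y), Pi.smul_apply', add_sub_cancel_right, inner_smul_left, h3]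
  simp

/-- `U (W f) - W (U f) = [U, W] f`: this is the Jacobi identity for `U`, `W` and `f Z`, read off
at a point where the vector field `Z` is not zero. -/
theorem mvfderiv_mlieBracket {f : X → ℝ} (hf : ContMDiff (𝓡 4) 𝓘(ℝ) ∞ f)
    {U W : Π x : X, Tan x} (hU : IsSmoothSection R4 U) (hW : IsSmoothSection R4 W) (x : X) :
    mvfderiv (𝓡 4) (fun y => mvfderiv (𝓡 4) f y (W y)) x (U x)
      - mvfderiv (𝓡 4) (fun y => mvfderiv (𝓡 4) f y (U y)) x (W x)
      = mvfderiv (𝓡 4) f x (mlieBracket (𝓡 4) U W x) := by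
  have : IsManifold (𝓡 4) (minSmoothness ℝ 3) X := isManifold_of_le (by
    rw [minSmoothness_of_isRCLikeNormedField]; exact ENat.LEInfty.out)
  have hfd : ∀ y, MDifferentiableAt (𝓡 4) 𝓘(ℝ) f y := fun y => (hf y).mdifferentiableAt (by simp)
  obtain ⟨s, hs, hon⟩ := exists_orthonormal_sections R4 (fun x : X => Tan x) x 1 (by simp)
  set Z := s 0 with hZ
  have hZs : IsSmoothSection R4 Z := hs 0
  have hZx : Z x ≠ 0 := by
    intro h0
    have := hon.self_of_nhds.1 0
    simp [← hZ, h0] at this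
  -- `[A, [B, f Z]]`, expanded by the Leibniz rule
  have key : ∀ {A B : Π x : X, Tan x}, IsSmoothSection R4 A → IsSmoothSection R4 B →
      mlieBracket (𝓡 4) A (mlieBracket (𝓡 4) B (f • Z)) x
        = mvfderiv (𝓡 4) (fun y => mvfderiv (𝓡 4) f y (B y)) x (A x) • Z x
          + mvfderiv (𝓡 4) f x (B x) • mlieBracket (𝓡 4) A Z x
          + (mvfderiv (𝓡 4) f x (A x) • mlieBracket (𝓡 4) B Z x
          + f x • mlieBracket (𝓡 4) A (mlieBracket (𝓡 4) B Z) x) := by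
    intro A B hA hB
    have h1 : mlieBracket (𝓡 4) B (f • Z)
        = (fun y => mvfderiv (𝓡 4) f y (B y)) • Z + f • mlieBracket (𝓡 4) B Z := by
      funext y
      rw [mlieBracket_smul_right (hfd y) (hZs.mdifferentiableAt y)]
      rfl
    have h2 := mdifferentiableAt_mvfderiv_apply hf hB x
    have h3 := (hB.mlieBracket hZs).mdifferentiableAt x
    rw [h1, mlieBracket_add_right (h2.smul_section (hZs.mdifferentiableAt x))
      ((hfd x).smul_section h3), mlieBracket_smul_right h2 (hZs.mdifferentiableAt x),
      mlieBracket_smul_right (hfd x) h3]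
  have hsm : ∀ {A : Π x : X, Tan x}, IsSmoothSection R4 A →
      ContMDiffAt (𝓡 4) ((𝓡 4).prod 𝓘(ℝ, R4)) (minSmoothness ℝ 2)
        (fun x => TotalSpace.mk' R4 x (A x)) x := fun hA =>
    (hA x).of_le (by rw [minSmoothness_of_isRCLikeNormedField]; exact ENat.LEInfty.out)
  have j1 := leibniz_identity_mlieBracket_apply (I := 𝓡 4) (hsm hU) (hsm hW)
    (hsm (IsSmoothSection.smul hf hZs))
  have j2 := leibniz_identity_mlieBracket_apply (I := 𝓡 4) (hsm hU) (hsm hW) (hsm hZs)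
  rw [key hU hW, key hW hU, mlieBracket_smul_right (hfd x) (hZs.mdifferentiableAt x), j2] at j1
  -- the Jacobi identity for `f Z`, minus `f` times that for `Z`, is a multiple of `Z`
  have j3 : (mvfderiv (𝓡 4) (fun y => mvfderiv (𝓡 4) f y (W y)) x (U x)
      - mvfderiv (𝓡 4) (fun y => mvfderiv (𝓡 4) f y (U y)) x (W x)
      - mvfderiv (𝓡 4) f x (mlieBracket (𝓡 4) U W x)) • Z x = 0 := by
    have := sub_eq_zero.2 j1
    rw [← this]
    module
  have j4 := (smul_eq_zero.1 j3).resolve_right hZx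
  linarith

end Commutator

section Curvature

open VectorField

variable {X : Type*} [TopologicalSpace X] [ChartedSpace R4 X] [IsManifold (𝓡 4) ∞ X]
  {F : Type*} [NormedAddCommGroup F] [NormedSpace ℝ F]
  {V : X → Type*} [TopologicalSpace (TotalSpace F V)]
  [∀ x, NormedAddCommGroup (V x)] [∀ x, InnerProductSpace ℝ (V x)]
  [FiberBundle F V] [VectorBundle ℝ F V]

theorem IsSmoothSection.covariantDerivative {nabla : CovariantDerivative (𝓡 4) F V}
    (hn : nabla.ContMDiffCovariantDerivative ∞) {σ : Π x, V x} {W : Π x : X, Tan x}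
    (hσ : IsSmoothSection F σ) (hW : IsSmoothSection R4 W) :
    IsSmoothSection F (fun x => nabla σ x (W x)) := by
  have h1 := hn.contMDiff.contMDiff (σ := σ) (ContMDiff.contMDiffOn (ContMDiff.of_le hσ (by simp)))
  exact ContMDiff.clm_bundle_apply (contMDiffOn_univ.1 h1) hW

/-- `∇_{W₁} ∇_{W₂} σ - ∇_{W₂} ∇_{W₁} σ - ∇_{[W₁, W₂]} σ` for vector fields `W₁`, `W₂`. -/
def curvatureField (nabla : CovariantDerivative (𝓡 4) F V) (W₁ W₂ : Π x : X, Tan x)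
    (σ : Π x, V x) (x : X) : V x :=
  nabla (fun y => nabla σ y (W₂ y)) x (W₁ x) - nabla (fun y => nabla σ y (W₁ y)) x (W₂ x)
    - nabla σ x (mlieBracket (𝓡 4) W₁ W₂ x)

theorem IsSmoothSection.curvatureField {nabla : CovariantDerivative (𝓡 4) F V}
    (hn : nabla.ContMDiffCovariantDerivative ∞) {W₁ W₂ : Π x : X, Tan x} {σ : Π x, V x}
    (h₁ : IsSmoothSection R4 W₁) (h₂ : IsSmoothSection R4 W₂) (hσ : IsSmoothSection F σ) :
    IsSmoothSection F (curvatureField nabla W₁ W₂ σ) :=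
  (((hσ.covariantDerivative hn h₂).covariantDerivative hn h₁).sub
    ((hσ.covariantDerivative hn h₁).covariantDerivative hn h₂)).sub
    (hσ.covariantDerivative hn (h₁.mlieBracket h₂))

theorem curvatureField_add {nabla : CovariantDerivative (𝓡 4) F V}
    (hn : nabla.ContMDiffCovariantDerivative ∞) {W₁ W₂ : Π x : X, Tan x} {σ τ : Π x, V x}
    (h₁ : IsSmoothSection R4 W₁) (h₂ : IsSmoothSection R4 W₂) (hσ : IsSmoothSection F σ)
    (hτ : IsSmoothSection F τ) (x : X) :
    curvatureField nabla W₁ W₂ (σ + τ) x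
      = curvatureField nabla W₁ W₂ σ x + curvatureField nabla W₁ W₂ τ x := by
  have hadd : ∀ {α β : Π x, V x}, IsSmoothSection F α → IsSmoothSection F β → ∀ y,
      nabla (α + β) y = nabla α y + nabla β y := fun hα hβ y =>
    nabla.isCovariantDerivativeOnUniv.add (hα.mdifferentiableAt y) (hβ.mdifferentiableAt y)
  have h3 : ∀ W : Π x : X, Tan x, (fun y => nabla (σ + τ) y (W y))
      = (fun y => nabla σ y (W y)) + fun y => nabla τ y (W y) := by
    intro W; funext y; simp [hadd hσ hτ]
  simp only [curvatureField]
  rw [h3, h3, hadd hσ hτ, hadd (hσ.covariantDerivative hn h₁) (hτ.covariantDerivative hn h₁),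
    hadd (hσ.covariantDerivative hn h₂) (hτ.covariantDerivative hn h₂)]
  simp only [add_apply]
  abel

theorem curvatureField_smul {nabla : CovariantDerivative (𝓡 4) F V}
    (hn : nabla.ContMDiffCovariantDerivative ∞) {W₁ W₂ : Π x : X, Tan x} {σ : Π x, V x}
    (h₁ : IsSmoothSection R4 W₁) (h₂ : IsSmoothSection R4 W₂) (hσ : IsSmoothSection F σ)
    (c : ℝ) (x : X) :
    curvatureField nabla W₁ W₂ (c • σ) x = c • curvatureField nabla W₁ W₂ σ x := by
  have hsm : ∀ {α : Π x, V x}, IsSmoothSection F α → ∀ y,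
      nabla (c • α) y = c • nabla α y := fun hα y =>
    nabla.isCovariantDerivativeOnUniv.smul_const c (hα.mdifferentiableAt y)
  have h3 : ∀ W : Π x : X, Tan x, (fun y => nabla (c • σ) y (W y))
      = c • fun y => nabla σ y (W y) := by
    intro W; funext y; simp [hsm hσ]
  simp only [curvatureField]
  rw [h3, h3, hsm hσ, hsm (hσ.covariantDerivative hn h₁), hsm (hσ.covariantDerivative hn h₂)]
  simp only [smul_apply]
  module

variable [ContMDiffVectorBundle ∞ F V (𝓡 4)] [FiniteDimensional ℝ F]
  [RiemannianBundle (fun x : X => Tan x)]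

/-- The curvature is tensorial in the vector fields. -/
theorem curvatureField_congr_left {nabla : CovariantDerivative (𝓡 4) F V}
    (hn : nabla.ContMDiffCovariantDerivative ∞) {W₁ W₂ W₁' W₂' : Π x : X, Tan x}
    {σ : Π x, V x} (h₁ : IsSmoothSection R4 W₁) (h₂ : IsSmoothSection R4 W₂)
    (h₁' : IsSmoothSection R4 W₁') (h₂' : IsSmoothSection R4 W₂') (hσ : IsSmoothSection F σ)
    {x : X} (e₁ : W₁ x = W₁' x) (e₂ : W₂ x = W₂' x) :
    curvatureField nabla W₁ W₂ σ x = curvatureField nabla W₁' W₂' σ x := by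
  have : IsManifold (𝓡 4) 2 X := isManifold_of_le (ENat.LEInfty.out)
  -- the derivative of `σ` along a differentiable vector field is differentiable
  have hd : ∀ {W : Π x : X, Tan x},
      MDifferentiableAt (𝓡 4) ((𝓡 4).prod 𝓘(ℝ, R4)) (fun x => TotalSpace.mk' R4 x (W x)) x →
      MDifferentiableAt (𝓡 4) ((𝓡 4).prod 𝓘(ℝ, F))
        (fun y => TotalSpace.mk' F y (nabla σ y (W y))) x := by
    intro W hW
    have h1 := hn.contMDiff.contMDiff (σ := σ)
      (ContMDiff.contMDiffOn (ContMDiff.of_le hσ (by simp)))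
    exact MDifferentiableAt.clm_bundle_apply
      ((contMDiffOn_univ.1 h1 x).mdifferentiableAt (by simp)) hW
  have hcov := nabla.isCovariantDerivativeOnUniv
  refine TensorialAt.pointwise₂ (I := 𝓡 4) (F := R4) (F' := R4)
    (Φ := fun A B => curvatureField nabla A B σ x) (fun B hB => ?_) (fun A hA => ?_)
    (h₁.mdifferentiableAt x) (h₁'.mdifferentiableAt x) (h₂.mdifferentiableAt x)
    (h₂'.mdifferentiableAt x) e₁ e₂
  · refine ⟨fun {f A} hf hA => ?_, fun {A A'} hA hA' => ?_⟩
    · have h3 : (fun y => nabla σ y ((f • A) y)) = f • fun y => nabla σ y (A y) := by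
        funext y; simp
      simp only [curvatureField, h3, hcov.leibniz (hd hA) hf, mlieBracket_smul_left hf hA]
      simp
      module
    · have h3 : (fun y => nabla σ y ((A + A') y))
          = (fun y => nabla σ y (A y)) + fun y => nabla σ y (A' y) := by
        funext y; simp
      simp only [curvatureField, h3, hcov.add (hd hA) (hd hA'), mlieBracket_add_left hA hA']
      simp
      module
  · refine ⟨fun {f B} hf hB => ?_, fun {B B'} hB hB' => ?_⟩
    · have h3 : (fun y => nabla σ y ((f • B) y)) = f • fun y => nabla σ y (B y) := by
        funext y; simp
      simp only [curvatureField, h3, hcov.leibniz (hd hB) hf, mlieBracket_smul_right hf hB]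
      simp
      module
    · have h3 : (fun y => nabla σ y ((B + B') y))
          = (fun y => nabla σ y (B y)) + fun y => nabla σ y (B' y) := by
        funext y; simp
      simp only [curvatureField, h3, hcov.add (hd hB) (hd hB'), mlieBracket_add_right hB hB']
      simp
      module

variable [IsContMDiffRiemannianBundle (𝓡 4) ∞ F V]

theorem mvfderiv_inner_apply {nabla : CovariantDerivative (𝓡 4) F V}
    (hm : nabla.IsMetricCompatible) {σ τ : Π x, V x} (hσ : IsSmoothSection F σ)
    (hτ : IsSmoothSection F τ) (W : Π x : X, Tan x) (x : X) :
    mvfderiv (𝓡 4) (fun y => inner ℝ (σ y) (τ y)) x (W x)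
      = inner ℝ (nabla σ x (W x)) (τ x) + inner ℝ (σ x) (nabla τ x (W x)) :=
  hm.mvfderiv_inner_eq W (hσ.mdifferentiableAt x) (hτ.mdifferentiableAt x)

variable [T2Space X] [IsContMDiffRiemannianBundle (𝓡 4) ∞ R4 (fun x : X => Tan x)]

/-- The curvature of a metric connection is skew-symmetric. -/
theorem inner_curvatureField {nabla : CovariantDerivative (𝓡 4) F V}
    (hn : nabla.ContMDiffCovariantDerivative ∞) (hm : nabla.IsMetricCompatible)
    {W₁ W₂ : Π x : X, Tan x} {σ τ : Π x, V x} (h₁ : IsSmoothSection R4 W₁)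
    (h₂ : IsSmoothSection R4 W₂) (hσ : IsSmoothSection F σ) (hτ : IsSmoothSection F τ) (x : X) :
    inner ℝ (curvatureField nabla W₁ W₂ σ x) (τ x)
      = - inner ℝ (σ x) (curvatureField nabla W₁ W₂ τ x) := by
  -- the second derivative of `⟪σ, τ⟫` along `B` and `A`
  have hd : ∀ {A : Π x : X, Tan x}, IsSmoothSection R4 A → ∀ B : Π x : X, Tan x,
      mvfderiv (𝓡 4) (fun y => mvfderiv (𝓡 4) (fun y => inner ℝ (σ y) (τ y)) y (A y)) x (B x)
      = inner ℝ (nabla (fun y => nabla σ y (A y)) x (B x)) (τ x)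
        + inner ℝ (nabla σ x (A x)) (nabla τ x (B x))
        + (inner ℝ (nabla σ x (B x)) (nabla τ x (A x))
        + inner ℝ (σ x) (nabla (fun y => nabla τ y (A y)) x (B x))) := by
    intro A hA B
    have hσA := hσ.covariantDerivative hn hA
    have hτA := hτ.covariantDerivative hn hA
    simp only [mvfderiv_inner_apply hm hσ hτ]
    have h3 := mvfderiv_add (I := 𝓡 4) (((hσA.inner hτ) x).mdifferentiableAt (by simp))
      (((hσ.inner hτA) x).mdifferentiableAt (by simp))
    have h4 := congrArg (fun T => T (B x)) h3
    rw [← mvfderiv_inner_apply hm hσA hτ B,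
      ← mvfderiv_inner_apply hm hσ hτA B]
    exact h4
  have h5 := mvfderiv_mlieBracket (hσ.inner hτ) h₁ h₂ x
  rw [hd h₂, hd h₁, mvfderiv_inner_apply hm hσ hτ] at h5
  simp only [curvatureField, inner_sub_left, inner_sub_right]
  linarith

/-- The curvature depends on the values of the vector fields and of the section at `x` only, so
that it can be computed with any smooth extensions. -/
theorem curvature_apply {nabla : CovariantDerivative (𝓡 4) F V}
    (hn : nabla.ContMDiffCovariantDerivative ∞) (hm : nabla.IsMetricCompatible)
    {W₁ W₂ : Π x : X, Tan x} {σ : Π x, V x} (h₁ : IsSmoothSection R4 W₁)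
    (h₂ : IsSmoothSection R4 W₂) (hσ : IsSmoothSection F σ) (x : X) :
    curvature nabla x (W₁ x) (W₂ x) (σ x) = curvatureField nabla W₁ W₂ σ x := by
  have hcov := nabla.isCovariantDerivativeOnUniv
  obtain ⟨A, hA, eA⟩ := exists_isSmoothSection_extend (V := fun x : X => Tan x) R4 (W₁ x)
  obtain ⟨B, hB, eB⟩ := exists_isSmoothSection_extend (V := fun x : X => Tan x) R4 (W₂ x)
  obtain ⟨τ, hτ, eτ⟩ := exists_isSmoothSection_extend F (σ x)
  have eAx : A x = W₁ x := by simpa using eA.self_of_nhds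
  have eBx : B x = W₂ x := by simpa using eB.self_of_nhds
  have eτx : τ x = σ x := by simpa using eτ.self_of_nhds
  -- covariant derivatives of eventually equal sections
  have hloc : ∀ {α β : Π x, V x} {y : X}, IsSmoothSection F α → (∀ᶠ z in 𝓝 y, α z = β z) →
      nabla β y = nabla α y := by
    intro α β y hα h
    have h1 := hα.mdifferentiableAt y
    have h2 : MDifferentiableAt (𝓡 4) ((𝓡 4).prod 𝓘(ℝ, F)) (fun x => TotalSpace.mk' F x (β x)) y :=
      h1.congr_of_eventuallyEq (h.mono fun z hz => by simp [hz])
    exact hcov.congr_of_eventuallyEq h2 h1 univ_mem (h.mono fun z hz => hz.symm)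
  have hnab : ∀ᶠ y in 𝓝 x, nabla τ y = nabla (FiberBundle.extend F (σ x)) y := by
    filter_upwards [eventually_eventually_nhds.2 eτ] with y hy
    exact (hloc hτ hy).symm
  have hlocAB : ∀ {C D : Π x : X, Tan x}, IsSmoothSection R4 C → (∀ᶠ z in 𝓝 x, C z = D z) →
      nabla (fun y => nabla (FiberBundle.extend F (σ x)) y (D y)) x
        = nabla (fun y => nabla τ y (C y)) x := by
    intro C D hC h
    refine hloc (hτ.covariantDerivative hn hC) ?_
    filter_upwards [hnab, h] with y hy1 hy2
    rw [hy1, hy2]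
  have e1 : curvature nabla x (W₁ x) (W₂ x) (σ x) = curvatureField nabla A B τ x := by
    simp only [curvature, curvatureField]
    rw [hlocAB hA eA, hlocAB hB eB, hloc hτ eτ,
      Filter.EventuallyEq.mlieBracket_vectorField_eq eA eB, eAx, eBx]
  rw [e1, curvatureField_congr_left hn hA hB h₁ h₂ hτ eAx eBx]
  -- tensoriality in the section, by skew-symmetry
  refine ext_inner_right ℝ fun v => ?_
  obtain ⟨υ, hυ, eυ⟩ := exists_isSmoothSection_apply_eq F v
  rw [← eυ, inner_curvatureField hn hm h₁ h₂ hτ hυ, inner_curvatureField hn hm h₁ h₂ hσ hυ, eτx]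

variable {nabla : CovariantDerivative (𝓡 4) F V} (hn : nabla.ContMDiffCovariantDerivative ∞)
  (hm : nabla.IsMetricCompatible)

include hn hm

theorem curvature_add (x : X) (v w : Tan x) (s t : V x) :
    curvature nabla x v w (s + t) = curvature nabla x v w s + curvature nabla x v w t := by
  obtain ⟨A, hA, rfl⟩ := exists_isSmoothSection_apply_eq (V := fun x : X => Tan x) R4 v
  obtain ⟨B, hB, rfl⟩ := exists_isSmoothSection_apply_eq (V := fun x : X => Tan x) R4 w
  obtain ⟨σ, hσ, rfl⟩ := exists_isSmoothSection_apply_eq F s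
  obtain ⟨τ, hτ, rfl⟩ := exists_isSmoothSection_apply_eq F t
  rw [curvature_apply hn hm hA hB hσ, curvature_apply hn hm hA hB hτ,
    ← curvatureField_add hn hA hB hσ hτ, ← curvature_apply hn hm hA hB (hσ.add hτ)]
  rfl

theorem curvature_smul (x : X) (v w : Tan x) (c : ℝ) (s : V x) :
    curvature nabla x v w (c • s) = c • curvature nabla x v w s := by
  obtain ⟨A, hA, rfl⟩ := exists_isSmoothSection_apply_eq (V := fun x : X => Tan x) R4 v
  obtain ⟨B, hB, rfl⟩ := exists_isSmoothSection_apply_eq (V := fun x : X => Tan x) R4 w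
  obtain ⟨σ, hσ, rfl⟩ := exists_isSmoothSection_apply_eq F s
  rw [curvature_apply hn hm hA hB hσ,
    ← curvatureField_smul hn hA hB hσ, ← curvature_apply hn hm hA hB (hσ.const_smul c)]
  rfl

theorem curvature_swap (x : X) (v w : Tan x) (s : V x) :
    curvature nabla x v w s = - curvature nabla x w v s := by
  obtain ⟨A, hA, rfl⟩ := exists_isSmoothSection_apply_eq (V := fun x : X => Tan x) R4 v
  obtain ⟨B, hB, rfl⟩ := exists_isSmoothSection_apply_eq (V := fun x : X => Tan x) R4 w
  obtain ⟨σ, hσ, rfl⟩ := exists_isSmoothSection_apply_eq F s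
  rw [curvature_apply hn hm hA hB hσ, curvature_apply hn hm hB hA hσ]
  simp only [curvatureField]
  rw [mlieBracket_swap_apply, map_neg]
  abel

theorem curvature_add_left (x : X) (v v' w : Tan x) (s : V x) :
    curvature nabla x (v + v') w s = curvature nabla x v w s + curvature nabla x v' w s := by
  obtain ⟨A, hA, rfl⟩ := exists_isSmoothSection_apply_eq (V := fun x : X => Tan x) R4 v
  obtain ⟨A', hA', rfl⟩ := exists_isSmoothSection_apply_eq (V := fun x : X => Tan x) R4 v'
  obtain ⟨B, hB, rfl⟩ := exists_isSmoothSection_apply_eq (V := fun x : X => Tan x) R4 w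
  obtain ⟨σ, hσ, rfl⟩ := exists_isSmoothSection_apply_eq F s
  have h1 := curvature_apply hn hm (hA.add hA') hB hσ x
  rw [Pi.add_apply] at h1
  have h2 : (fun y => nabla σ y ((A + A') y))
      = (fun y => nabla σ y (A y)) + fun y => nabla σ y (A' y) := by
    funext y; simp
  rw [h1, curvature_apply hn hm hA hB hσ, curvature_apply hn hm hA' hB hσ]
  simp only [curvatureField]
  rw [h2, nabla.isCovariantDerivativeOnUniv.add
    ((hσ.covariantDerivative hn hA).mdifferentiableAt x)
    ((hσ.covariantDerivative hn hA').mdifferentiableAt x),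
    mlieBracket_add_left (hA.mdifferentiableAt x) (hA'.mdifferentiableAt x)]
  simp only [Pi.add_apply, map_add, add_apply]
  abel

theorem curvature_smul_left (x : X) (c : ℝ) (v w : Tan x) (s : V x) :
    curvature nabla x (c • v) w s = c • curvature nabla x v w s := by
  obtain ⟨A, hA, rfl⟩ := exists_isSmoothSection_apply_eq (V := fun x : X => Tan x) R4 v
  obtain ⟨B, hB, rfl⟩ := exists_isSmoothSection_apply_eq (V := fun x : X => Tan x) R4 w
  obtain ⟨σ, hσ, rfl⟩ := exists_isSmoothSection_apply_eq F s
  have h1 := curvature_apply hn hm (hA.const_smul c) hB hσ x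
  rw [Pi.smul_apply] at h1
  have h2 : (fun y => nabla σ y ((c • A) y)) = c • fun y => nabla σ y (A y) := by
    funext y; simp
  rw [h1, curvature_apply hn hm hA hB hσ]
  simp only [curvatureField]
  rw [h2, nabla.isCovariantDerivativeOnUniv.smul_const c
    ((hσ.covariantDerivative hn hA).mdifferentiableAt x),
    mlieBracket_const_smul_left (hA.mdifferentiableAt x)]
  simp only [Pi.smul_apply, map_smul, smul_apply]
  module

/-- The curvature at `x`, as a trilinear map. -/
theorem exists_curvature_trilinear (x : X) :
    ∃ R : Tan x →ₗ[ℝ] Tan x →ₗ[ℝ] V x →ₗ[ℝ] V x,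
      ∀ v w s, R v w s = curvature nabla x v w s := by
  have hadd₂ : ∀ (v w w' : Tan x) (s : V x), curvature nabla x v (w + w') s
      = curvature nabla x v w s + curvature nabla x v w' s := by
    intro v w w' s
    rw [curvature_swap hn hm, curvature_add_left hn hm, curvature_swap hn hm x v w,
      curvature_swap hn hm x v w']
    abel
  have hsmul₂ : ∀ (c : ℝ) (v w : Tan x) (s : V x), curvature nabla x v (c • w) s
      = c • curvature nabla x v w s := by
    intro c v w s
    rw [curvature_swap hn hm, curvature_smul_left hn hm, curvature_swap hn hm x v w, smul_neg]
  refine ⟨LinearMap.mk₂ ℝ (fun v w =>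
    { toFun := fun s => curvature nabla x v w s
      map_add' := curvature_add hn hm x v w
      map_smul' := curvature_smul hn hm x v w }) ?_ ?_ ?_ ?_, fun v w s => rfl⟩
  · intro v v' w; ext s; exact curvature_add_left hn hm x v v' w s
  · intro c v w; ext s; exact curvature_smul_left hn hm x c v w s
  · intro v w w'; ext s; exact hadd₂ v w w' s
  · intro c v w; ext s; exact hsmul₂ c v w s

end Curvature

/-! ### The Riemannian measure in charts -/

section GramMatrix

variable {X : Type*} [TopologicalSpace X] [ChartedSpace R4 X]
  [RiemannianBundle (fun x : X => Tan x)]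

/-- The Gram matrix of the images in `T_x X` of the standard basis vectors under a linear map. -/
def gramOf {x : X} (T : R4 →L[ℝ] Tan x) : Matrix (Fin 4) (Fin 4) ℝ :=
  Matrix.of fun i j =>
    inner ℝ (T (EuclideanSpace.basisFun (Fin 4) ℝ i)) (T (EuclideanSpace.basisFun (Fin 4) ℝ j))

theorem det_gramOf_comp {x : X} (T : R4 →L[ℝ] Tan x) (D : R4 →L[ℝ] R4) :
    (gramOf (T ∘L D)).det = D.det ^ 2 * (gramOf T).det := by
  set b := (EuclideanSpace.basisFun (Fin 4) ℝ).toBasis with hb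
  let M : Matrix (Fin 4) (Fin 4) ℝ := LinearMap.toMatrix b b (D : R4 →ₗ[ℝ] R4)
  have hD : ∀ j, D (EuclideanSpace.basisFun (Fin 4) ℝ j)
      = ∑ i, M i j • EuclideanSpace.basisFun (Fin 4) ℝ i := by
    intro j
    conv_lhs => rw [← b.sum_repr (D (EuclideanSpace.basisFun (Fin 4) ℝ j))]
    simp [M, LinearMap.toMatrix_apply, hb]
  have hG : gramOf (T ∘L D) = M.transpose * gramOf T * M := by
    ext i j
    have h1 : ∀ j, (T ∘L D) (EuclideanSpace.basisFun (Fin 4) ℝ j)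
        = ∑ k, M k j • T (EuclideanSpace.basisFun (Fin 4) ℝ k) := by
      intro j
      rw [ContinuousLinearMap.comp_apply, hD j, map_sum]
      exact Finset.sum_congr rfl fun k _ => map_smul _ _ _
    simp only [gramOf, Matrix.of_apply, h1, Matrix.mul_apply, Matrix.transpose_apply, sum_inner,
      inner_sum, inner_smul_left, inner_smul_right, Finset.sum_mul, Finset.mul_sum]
    refine Finset.sum_congr rfl fun k _ => Finset.sum_congr rfl fun l _ => ?_
    simp
    ring
  rw [hG, Matrix.det_mul, Matrix.det_mul, Matrix.det_transpose]
  have : M.det = D.det := LinearMap.det_toMatrix b _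
  rw [this]
  ring

/-- The Gram determinant changes by the square of the determinant of a change of coordinates. The
two tangent spaces are propositionally equal only, so that the hypothesis is an equation in their
common model `R4`. -/
theorem det_gramOf_eq {x x' : X} (hx : x' = x) (T : R4 →L[ℝ] Tan x) (T' : R4 →L[ℝ] Tan x')
    (D : R4 →L[ℝ] R4) (h : ∀ v, @Eq R4 (T v) (T' (D v))) :
    (gramOf T).det = D.det ^ 2 * (gramOf T').det := by
  subst hx
  rw [← det_gramOf_comp]
  congr 2
  ext1 v
  exact h v

/-- The Gram matrix is `NᵀN` for the matrix `N` of the map in an orthonormal basis of `T_x X`. -/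
theorem exists_det_gramOf_eq {x : X} (T : R4 →L[ℝ] Tan x) :
    ∃ f : OrthonormalBasis (Fin 4) ℝ (Tan x), (gramOf T).det
      = (Matrix.of fun k j => inner ℝ (f k) (T (EuclideanSpace.basisFun (Fin 4) ℝ j))).det ^ 2 := by
  have hdim : Module.finrank ℝ (Tan x) = 4 := by
    have : Module.finrank ℝ R4 = 4 := by simp
    exact this
  let f : OrthonormalBasis (Fin 4) ℝ (Tan x) := (frame x).reindex (finCongr hdim)
  refine ⟨f, ?_⟩
  set N : Matrix (Fin 4) (Fin 4) ℝ := Matrix.of fun k j =>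
    inner ℝ (f k) (T (EuclideanSpace.basisFun (Fin 4) ℝ j)) with hN
  have : gramOf T = N.transpose * N := by
    ext i j
    rw [Matrix.mul_apply]
    simp only [gramOf, hN, Matrix.transpose_apply, Matrix.of_apply]
    rw [← f.sum_inner_mul_inner]
    refine Finset.sum_congr rfl fun k _ => ?_
    rw [real_inner_comm]
  rw [this, Matrix.det_mul, Matrix.det_transpose, sq]

theorem abs_det_le_of_entries {A : Matrix (Fin 4) (Fin 4) ℝ} {C : ℝ} (h : ∀ i j, |A i j| ≤ C) :
    |A.det| ≤ 24 * C ^ 4 := by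
  have h1 := Matrix.det_le (abv := AbsoluteValue.abs) (A := A) (x := C) h
  have h2 : (Nat.factorial 4) = 24 := rfl
  simpa [h2] using h1

theorem sqrt_det_gramOf_le {x : X} (T : R4 →L[ℝ] Tan x) {C : ℝ}
    (hT : ∀ v, ‖T v‖ ≤ C * ‖v‖) : √(gramOf T).det ≤ 24 * C ^ 4 := by
  obtain ⟨f, hf⟩ := exists_det_gramOf_eq T
  rw [hf, Real.sqrt_sq_eq_abs]
  refine abs_det_le_of_entries fun i j => ?_
  rw [Matrix.of_apply]
  refine (abs_real_inner_le_norm _ _).trans ?_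
  rw [f.orthonormal.1 i, one_mul]
  simpa using hT (EuclideanSpace.basisFun (Fin 4) ℝ j)

/-- A lower bound for the Gram determinant, from a bounded left inverse `S` of `T`. -/
theorem one_le_sqrt_det_gramOf {x : X} (T : R4 →L[ℝ] Tan x) (S : Tan x →L[ℝ] R4) {C : ℝ}
    (hST : ∀ v, S (T v) = v) (hS : ∀ v : Tan x, ‖S v‖ ≤ C * ‖v‖) :
    1 ≤ 24 * C ^ 4 * √(gramOf T).det := by
  obtain ⟨f, hf⟩ := exists_det_gramOf_eq T
  rw [hf, Real.sqrt_sq_eq_abs]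
  set N : Matrix (Fin 4) (Fin 4) ℝ := Matrix.of fun k j =>
    inner ℝ (f k) (T (EuclideanSpace.basisFun (Fin 4) ℝ j)) with hN
  let P : Matrix (Fin 4) (Fin 4) ℝ := Matrix.of fun i k =>
    inner ℝ (EuclideanSpace.basisFun (Fin 4) ℝ i) (S (f k))
  have hPN : P * N = 1 := by
    ext i j
    rw [Matrix.mul_apply]
    have h1 : S (T (EuclideanSpace.basisFun (Fin 4) ℝ j))
        = ∑ k, N k j • S (f k) := by
      conv_lhs => rw [← f.sum_repr' (T (EuclideanSpace.basisFun (Fin 4) ℝ j))]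
      rw [map_sum]
      exact Finset.sum_congr rfl fun k _ => map_smul S _ _
    have h3 : inner ℝ (EuclideanSpace.basisFun (Fin 4) ℝ i)
        (S (T (EuclideanSpace.basisFun (Fin 4) ℝ j))) = (1 : Matrix (Fin 4) (Fin 4) ℝ) i j := by
      rw [hST, orthonormal_iff_ite.1 (EuclideanSpace.basisFun (Fin 4) ℝ).orthonormal i j,
        Matrix.one_apply]
    rw [← h3, h1, inner_sum]
    refine Finset.sum_congr rfl fun k _ => ?_
    rw [inner_smul_right, mul_comm]
    rfl
  have hdet : P.det * N.det = 1 := by rw [← Matrix.det_mul, hPN, Matrix.det_one]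
  have hP : |P.det| ≤ 24 * C ^ 4 := by
    refine abs_det_le_of_entries fun i k => ?_
    simp only [P, Matrix.of_apply]
    refine (abs_real_inner_le_norm _ _).trans ?_
    rw [(EuclideanSpace.basisFun (Fin 4) ℝ).orthonormal.1 i, one_mul]
    simpa [f.orthonormal.1 k] using hS (f k)
  calc (1 : ℝ) = |P.det| * |N.det| := by rw [← abs_mul, hdet, abs_one]
    _ ≤ _ := by gcongr

end GramMatrix

section Charts

variable {X : Type*} [TopologicalSpace X] [ChartedSpace R4 X] [IsManifold (𝓡 4) ∞ X]

/-- The derivative of the inverse of the chart around `p`, at the point with coordinates `z`. -/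
def dsymm (p : X) (z : R4) : R4 →L[ℝ] Tan ((extChartAt (𝓡 4) p).symm z) :=
  mfderiv 𝓘(ℝ, R4) (𝓡 4) (extChartAt (𝓡 4) p).symm z

/-- The derivative of the chart around `p`. -/
def dchart (p x : X) : Tan x →L[ℝ] R4 :=
  mfderiv (𝓡 4) 𝓘(ℝ, R4) (extChartAt (𝓡 4) p) x

theorem mdifferentiableAt_chart_symm {p : X} {z : R4} (hz : z ∈ (extChartAt (𝓡 4) p).target) :
    MDifferentiableAt 𝓘(ℝ, R4) (𝓡 4) (extChartAt (𝓡 4) p).symm z :=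
  ((contMDiffOn_extChartAt_symm (n := ∞) p).contMDiffAt
    ((isOpen_extChartAt_target p).mem_nhds hz)).mdifferentiableAt (by simp)

theorem mdifferentiableAt_chart {p x : X} (hx : x ∈ (extChartAt (𝓡 4) p).source) :
    MDifferentiableAt (𝓡 4) 𝓘(ℝ, R4) (extChartAt (𝓡 4) p) x :=
  mdifferentiableAt_extChartAt (by simpa using hx)

theorem dchart_dsymm {p : X} {z : R4} (hz : z ∈ (extChartAt (𝓡 4) p).target) (v : R4) :
    dchart p ((extChartAt (𝓡 4) p).symm z) (dsymm p z v) = v := by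
  have h := mfderiv_extChartAt_comp_mfderivWithin_extChartAt_symm (I := 𝓡 4) hz
  rw [ModelWithCorners.Boundaryless.range_eq_univ, mfderivWithin_univ] at h
  exact congrArg (fun T => T v) h

/-- The change of coordinates from the chart around `q` to the chart around `p`. -/
def transition (q p : X) (z : R4) : R4 := extChartAt (𝓡 4) p ((extChartAt (𝓡 4) q).symm z)

theorem transition_mem {q p : X} {z : R4}
    (hp : (extChartAt (𝓡 4) q).symm z ∈ (extChartAt (𝓡 4) p).source) :
    transition q p z ∈ (extChartAt (𝓡 4) p).target :=
  (extChartAt (𝓡 4) p).map_source hp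

theorem hasFDerivAt_transition {q p : X} {z : R4} (hz : z ∈ (extChartAt (𝓡 4) q).target)
    (hp : (extChartAt (𝓡 4) q).symm z ∈ (extChartAt (𝓡 4) p).source) :
    HasFDerivAt (transition q p) (fderiv ℝ (transition q p) z) z := by
  have h1 : MDifferentiableAt 𝓘(ℝ, R4) 𝓘(ℝ, R4) (transition q p) z :=
    (mdifferentiableAt_chart hp).comp z (mdifferentiableAt_chart_symm hz)
  exact h1.differentiableAt.hasFDerivAt

/-- The chain rule for the inverse of one chart, as the composition of the inverse of another chart
with the change of coordinates. The two tangent spaces are propositionally equal only, and the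
equation is one in their common model `R4`. -/
theorem dsymm_eq_comp {q p : X} {z : R4} (hz : z ∈ (extChartAt (𝓡 4) q).target)
    (hp : (extChartAt (𝓡 4) q).symm z ∈ (extChartAt (𝓡 4) p).source)
    (v : R4) : @Eq R4 (dsymm q z v)
      (dsymm p (transition q p z) (fderiv ℝ (transition q p) z v)) := by
  have hev : (extChartAt (𝓡 4) q).symm =ᶠ[𝓝 z] (extChartAt (𝓡 4) p).symm ∘ transition q p := by
    have hc : ContinuousAt (extChartAt (𝓡 4) q).symm z :=
      (continuousOn_extChartAt_symm q).continuousAt ((isOpen_extChartAt_target q).mem_nhds hz)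
    filter_upwards [hc.preimage_mem_nhds ((isOpen_extChartAt_source p).mem_nhds hp)] with w hw
    exact ((extChartAt (𝓡 4) p).left_inv hw).symm
  have h1 : MDifferentiableAt 𝓘(ℝ, R4) 𝓘(ℝ, R4) (transition q p) z :=
    (mdifferentiableAt_chart hp).comp z (mdifferentiableAt_chart_symm hz)
  have h2 := mfderiv_comp z (mdifferentiableAt_chart_symm (transition_mem hp)) h1
  have h3 := hev.mfderiv_eq (I := 𝓘(ℝ, R4)) (I' := 𝓡 4)
  rw [mfderiv_eq_fderiv] at h2
  exact congrArg (fun T : R4 →L[ℝ] R4 => T v) (h3.trans h2)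

variable [RiemannianBundle (fun x : X => Tan x)]

/-- The Riemannian density transforms by the Jacobian of the change of coordinates. -/
theorem sqrt_det_gram_transition {q p : X} {z : R4} (hz : z ∈ (extChartAt (𝓡 4) q).target)
    (hp : (extChartAt (𝓡 4) q).symm z ∈ (extChartAt (𝓡 4) p).source) :
    √(gram q z).det = |(fderiv ℝ (transition q p) z).det| * √(gram p (transition q p z)).det := by
  have hx : (extChartAt (𝓡 4) p).symm (transition q p z) = (extChartAt (𝓡 4) q).symm z :=
    (extChartAt (𝓡 4) p).left_inv hp
  have h1 : (gram q z).det
      = (fderiv ℝ (transition q p) z).det ^ 2 * (gram p (transition q p z)).det :=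
    det_gramOf_eq hx (dsymm q z) (dsymm p (transition q p z)) _ (dsymm_eq_comp hz hp)
  rw [h1, Real.sqrt_mul (sq_nonneg _), Real.sqrt_sq_eq_abs]

variable [MeasurableSpace X] [BorelSpace X]

theorem aemeasurable_chart_symm (p : X) :
    AEMeasurable (extChartAt (𝓡 4) p).symm
      ((volume : Measure R4).restrict (extChartAt (𝓡 4) p).target) :=
  (continuousOn_extChartAt_symm p).aemeasurable (isOpen_extChartAt_target p).measurableSet

theorem measurableSet_chart_preimage (p : X) {E : Set X} (hE : MeasurableSet E) :
    MeasurableSet ((extChartAt (𝓡 4) p).target ∩ (extChartAt (𝓡 4) p).symm ⁻¹' E) := by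
  have h := (continuousOn_iff_continuous_domRestrict.1
    (continuousOn_extChartAt_symm (I := 𝓡 4) p)).measurable hE
  convert MeasurableSet.subtype_image (isOpen_extChartAt_target p).measurableSet h using 1
  ext z
  simp [and_comm]

theorem chartVol_apply (p : X) {E : Set X} (hE : MeasurableSet E) :
    chartVol p E = ∫⁻ z in (extChartAt (𝓡 4) p).target ∩ (extChartAt (𝓡 4) p).symm ⁻¹' E,
      ENNReal.ofReal √(gram p z).det := by
  have h1 := aemeasurable_chart_symm p
  have h2 : NullMeasurableSet ((extChartAt (𝓡 4) p).symm ⁻¹' E)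
      ((volume : Measure R4).restrict (extChartAt (𝓡 4) p).target) := h1.nullMeasurable hE
  rw [chartVol, Measure.map_apply_of_aemeasurable
    (h1.mono_ac (withDensity_absolutelyContinuous _ _)) hE, withDensity_apply₀ _ h2,
    Measure.restrict_restrict₀ h2, Set.inter_comm]

/-- On the domain of the chart around `p`, every chart measure is at most `chartVol p`, by the
change of variables formula. -/
theorem chartVol_le_chartVol (q p : X) {E : Set X} (hE : MeasurableSet E)
    (hp : E ⊆ (extChartAt (𝓡 4) p).source) : chartVol q E ≤ chartVol p E := by
  rw [chartVol_apply q hE, chartVol_apply p hE]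
  set A := (extChartAt (𝓡 4) q).target ∩ (extChartAt (𝓡 4) q).symm ⁻¹' E with hA
  have hAm : MeasurableSet A := measurableSet_chart_preimage q hE
  have hinj : Set.InjOn (transition q p) A := by
    intro z hz w hw h
    have h1 := (extChartAt (𝓡 4) p).injOn (hp hz.2) (hp hw.2) h
    exact (extChartAt (𝓡 4) q).symm.injOn hz.1 hw.1 h1
  have hcv := lintegral_image_eq_lintegral_abs_det_fderiv_mul volume hAm
    (fun z hz => (hasFDerivAt_transition hz.1 (hp hz.2)).hasFDerivWithinAt) hinj
    (fun z => ENNReal.ofReal √(gram p z).det)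
  calc ∫⁻ z in A, ENNReal.ofReal √(gram q z).det
      = ∫⁻ z in A, ENNReal.ofReal |(fderiv ℝ (transition q p) z).det|
          * ENNReal.ofReal √(gram p (transition q p z)).det := by
        refine setLIntegral_congr_fun hAm fun z hz => ?_
        rw [sqrt_det_gram_transition hz.1 (hp hz.2), ENNReal.ofReal_mul (abs_nonneg _)]
    _ = ∫⁻ z in transition q p '' A, ENNReal.ofReal √(gram p z).det := hcv.symm
    _ ≤ _ := by
        refine lintegral_mono_set ?_
        rintro _ ⟨z, hz, rfl⟩
        refine ⟨transition_mem (hp hz.2), ?_⟩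
        change (extChartAt (𝓡 4) p).symm (extChartAt (𝓡 4) p ((extChartAt (𝓡 4) q).symm z)) ∈ E
        rw [(extChartAt (𝓡 4) p).left_inv (hp hz.2)]
        exact hz.2

/-- With `chartVol_le_vol`, the Riemannian measure is `chartVol p` on the domain of the chart. -/
theorem vol_apply_le_chartVol (p : X) {E : Set X} (hE : MeasurableSet E)
    (hp : E ⊆ (extChartAt (𝓡 4) p).source) : (vol : Measure X) E ≤ chartVol p E := by
  have hs : MeasurableSet (extChartAt (𝓡 4) p).source := (isOpen_extChartAt_source p).measurableSet
  -- a measure above all chart measures that is `chartVol p` on the domain of the chart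
  let m : Measure X := (chartVol p).restrict (extChartAt (𝓡 4) p).source
    + (⊤ : Measure X).restrict (extChartAt (𝓡 4) p).sourceᶜ
  have hm : (vol : Measure X) ≤ m := by
    refine iSup_le fun q => ?_
    rw [← Measure.restrict_add_restrict_compl (μ := chartVol q) hs]
    refine add_le_add (Measure.le_iff.2 fun B hB => ?_) (Measure.restrict_mono le_rfl le_top)
    rw [Measure.restrict_apply hB, Measure.restrict_apply hB]
    exact chartVol_le_chartVol q p (hB.inter hs) Set.inter_subset_right
  refine (Measure.le_iff.1 hm E hE).trans ?_
  rw [Measure.add_apply, Measure.restrict_apply hE, Measure.restrict_apply hE,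
    Set.inter_eq_left.2 hp]
  have : E ∩ (extChartAt (𝓡 4) p).sourceᶜ = ∅ := by
    rw [← Set.sdiff_eq, Set.sdiff_eq_empty.2 hp]
  rw [this, measure_empty, add_zero]

theorem chartVol_le_vol (p : X) : chartVol p ≤ (vol : Measure X) :=
  le_iSup (fun q : X => chartVol q) p

variable [IsContMDiffRiemannianBundle (𝓡 4) ∞ R4 (fun x : X => Tan x)]

theorem isContinuousRiemannianBundle_tan :
    IsContinuousRiemannianBundle R4 (fun x : X => Tan x) := by
  obtain ⟨g, hg, h⟩ := IsContMDiffRiemannianBundle.exists_contMDiff (IB := 𝓡 4) (n := ∞)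
    (F := R4) (E := fun x : X => Tan x)
  exact ⟨g, hg.continuous, h⟩

/-- The derivative of the chart is bounded near `p`: it is a local trivialization of the tangent
bundle, and the metric is continuous. -/
theorem eventually_norm_mfderiv_chart_le (p : X) :
    ∃ C : ℝ, 0 < C ∧ ∀ᶠ y in 𝓝 p, ∀ v : Tan y,
      ‖dchart p y v‖ ≤ C * ‖v‖ := by
  have := isContinuousRiemannianBundle_tan (X := X)
  obtain ⟨C, hC, h⟩ := eventually_norm_trivializationAt_lt R4 (fun x : X => Tan x) p
  refine ⟨C, hC, ?_⟩
  filter_upwards [h, chart_source_mem_nhds R4 p] with y hy hys v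
  have h1 := ContinuousLinearMap.le_of_opNorm_le _ hy.le v
  have h2 := TangentBundle.continuousLinearMapAt_trivializationAt (𝕜 := ℝ) (I := 𝓡 4) hys
  have h3 : (trivializationAt R4 (fun x : X => Tan x) p).continuousLinearMapAt ℝ y v
    = dchart p y v := congrArg (fun T => T v) h2
  rw [← h3]
  exact h1

theorem eventually_norm_dsymm_le (p : X) :
    ∃ C : ℝ, 0 < C ∧ ∀ᶠ z in 𝓝 (extChartAt (𝓡 4) p p), ∀ v : R4,
      ‖dsymm p z v‖ ≤ C * ‖v‖ := by
  have := isContinuousRiemannianBundle_tan (X := X)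
  obtain ⟨C, hC, h⟩ := eventually_norm_symmL_trivializationAt_lt R4 (fun x : X => Tan x) p
  refine ⟨C, hC, ?_⟩
  have hc : Tendsto (extChartAt (𝓡 4) p).symm (𝓝 (extChartAt (𝓡 4) p p)) (𝓝 p) := by
    have := continuousAt_extChartAt_symm (I := 𝓡 4) p
    rwa [ContinuousAt, extChartAt_to_inv] at this
  filter_upwards [hc.eventually h, hc.eventually (chart_source_mem_nhds R4 p),
    (isOpen_extChartAt_target p).mem_nhds (mem_extChartAt_target p)] with z hz hzs hzt v
  have h1 := ContinuousLinearMap.le_of_opNorm_le _ hz.le v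
  have h2 := TangentBundle.symmL_trivializationAt (𝕜 := ℝ) (I := 𝓡 4) hzs
  rw [ModelWithCorners.Boundaryless.range_eq_univ, mfderivWithin_univ,
    (extChartAt (𝓡 4) p).right_inv hzt] at h2
  have h3 : (trivializationAt R4 (fun x : X => Tan x) p).symmL ℝ ((extChartAt (𝓡 4) p).symm z) v
    = dsymm p z v := congrArg (fun T : R4 →L[ℝ] R4 => T v) h2
  rw [← h3]
  exact h1

/-- Near `p`, the Riemannian measure is comparable to the Lebesgue measure of the chart, and the
inverse of the chart has bounded derivative. -/
theorem exists_chart_comparison (p : X) :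
    ∃ N : Set X, IsOpen N ∧ p ∈ N ∧ N ⊆ (extChartAt (𝓡 4) p).source ∧ ∃ C : ℝ, 0 < C ∧
      (vol : Measure X).restrict N ≤ ENNReal.ofReal C •
        Measure.map (extChartAt (𝓡 4) p).symm ((volume : Measure R4).restrict
          ((extChartAt (𝓡 4) p).target ∩ (extChartAt (𝓡 4) p).symm ⁻¹' N)) ∧
      Measure.map (extChartAt (𝓡 4) p).symm ((volume : Measure R4).restrict
          ((extChartAt (𝓡 4) p).target ∩ (extChartAt (𝓡 4) p).symm ⁻¹' N)) ≤
        ENNReal.ofReal C • (vol : Measure X).restrict N ∧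
      ∀ z ∈ (extChartAt (𝓡 4) p).target ∩ (extChartAt (𝓡 4) p).symm ⁻¹' N, ∀ v : R4,
        ‖dsymm p z v‖ ≤ C * ‖v‖ := by
  obtain ⟨C₁, hC₁, h₁⟩ := eventually_norm_mfderiv_chart_le p
  obtain ⟨C₂, hC₂, h₂⟩ := eventually_norm_dsymm_le p
  obtain ⟨N, hN, hNo, hpN⟩ := eventually_nhds_iff.1
    (h₁.and (((continuousAt_extChartAt p).eventually h₂).and
      ((isOpen_extChartAt_source (I := 𝓡 4) p).mem_nhds (mem_extChartAt_source p))))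
  have hNs : N ⊆ (extChartAt (𝓡 4) p).source := fun y hy => (hN y hy).2.2
  set B := (extChartAt (𝓡 4) p).target ∩ (extChartAt (𝓡 4) p).symm ⁻¹' N with hB
  have hBm : MeasurableSet B := measurableSet_chart_preimage p hNo.measurableSet
  have hd : ∀ z ∈ B, ∀ v : R4, ‖dsymm p z v‖ ≤ C₂ * ‖v‖ := by
    intro z hz
    have h := (hN _ hz.2).2.1
    rwa [(extChartAt (𝓡 4) p).right_inv hz.1] at h
  have hup : ∀ z ∈ B, √(gram p z).det ≤ 24 * C₂ ^ 4 := fun z hz =>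
    sqrt_det_gramOf_le (dsymm p z) (hd z hz)
  have hlow : ∀ z ∈ B, 1 ≤ 24 * C₁ ^ 4 * √(gram p z).det := fun z hz =>
    one_le_sqrt_det_gramOf (dsymm p z) _ (dchart_dsymm hz.1) (hN _ hz.2).1
  have haem : AEMeasurable (extChartAt (𝓡 4) p).symm ((volume : Measure R4).restrict B) :=
    (aemeasurable_chart_symm p).mono_measure (Measure.restrict_mono Set.inter_subset_left le_rfl)
  have hBE : ∀ E : Set X, (extChartAt (𝓡 4) p).symm ⁻¹' E ∩ B
      = (extChartAt (𝓡 4) p).target ∩ (extChartAt (𝓡 4) p).symm ⁻¹' (E ∩ N) := by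
    intro E; ext z; simp only [hB, Set.mem_inter_iff, Set.mem_preimage]; tauto
  have hmap : ∀ E : Set X, MeasurableSet E →
      Measure.map (extChartAt (𝓡 4) p).symm ((volume : Measure R4).restrict B) E
        = volume ((extChartAt (𝓡 4) p).target ∩ (extChartAt (𝓡 4) p).symm ⁻¹' (E ∩ N)) := by
    intro E hE
    rw [Measure.map_apply_of_aemeasurable haem hE, Measure.restrict_apply' hBm, hBE]
  refine ⟨N, hNo, hpN, hNs, 24 * C₂ ^ 4 + 24 * C₁ ^ 4 + C₂, by positivity, ?_, ?_, ?_⟩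
  · refine Measure.le_iff.2 fun E hE => ?_
    rw [Measure.restrict_apply hE, Measure.smul_apply, hmap E hE, smul_eq_mul]
    refine (vol_apply_le_chartVol p (hE.inter hNo.measurableSet)
      (Set.inter_subset_right.trans hNs)).trans ?_
    rw [chartVol_apply p (hE.inter hNo.measurableSet), ← setLIntegral_const]
    refine setLIntegral_mono' (measurableSet_chart_preimage p (hE.inter hNo.measurableSet))
      fun z hz => ENNReal.ofReal_le_ofReal ?_
    have := hup z ⟨hz.1, hz.2.2⟩
    have : 0 ≤ 24 * C₁ ^ 4 := by positivity
    linarith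
  · refine Measure.le_iff.2 fun E hE => ?_
    rw [Measure.smul_apply, Measure.restrict_apply hE, hmap E hE, smul_eq_mul]
    refine le_trans ?_ (mul_le_mul_right (Measure.le_iff.1 (chartVol_le_vol p) _
      (hE.inter hNo.measurableSet)) _)
    rw [chartVol_apply p (hE.inter hNo.measurableSet), ← lintegral_const_mul' _ _ (by simp),
      ← setLIntegral_one]
    refine setLIntegral_mono' (measurableSet_chart_preimage p (hE.inter hNo.measurableSet))
      fun z hz => ?_
    rw [← ENNReal.ofReal_mul (by positivity), ← ENNReal.ofReal_one]
    refine ENNReal.ofReal_le_ofReal ((hlow z ⟨hz.1, hz.2.2⟩).trans ?_)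
    gcongr
    have : 0 ≤ 24 * C₂ ^ 4 := by positivity
    linarith
  · intro z hz v
    refine (hd z hz v).trans ?_
    gcongr
    have : 0 ≤ 24 * C₂ ^ 4 + 24 * C₁ ^ 4 := by positivity
    linarith

theorem isFiniteMeasure_vol [CompactSpace X] : IsFiniteMeasure (vol : Measure X) := by
  have hloc : IsLocallyFiniteMeasure (vol : Measure X) := by
    refine ⟨fun p => ?_⟩
    obtain ⟨N, hNo, hpN, hNs, C, -, h1, -⟩ := exists_chart_comparison p
    -- shrink `N` to a neighbourhood with bounded image in the chart
    let N' := N ∩ ((extChartAt (𝓡 4) p).source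
      ∩ extChartAt (𝓡 4) p ⁻¹' Metric.ball (extChartAt (𝓡 4) p p) 1)
    have hN'o : IsOpen N' := hNo.inter
      ((continuousOn_extChartAt p).isOpen_inter_preimage (isOpen_extChartAt_source p)
        Metric.isOpen_ball)
    refine ⟨N', hN'o.mem_nhds ⟨hpN, mem_extChartAt_source p,
      Metric.mem_ball_self one_pos⟩, ?_⟩
    have h2 := Measure.le_iff.1 h1 N' hN'o.measurableSet
    rw [Measure.restrict_apply hN'o.measurableSet, Set.inter_eq_left.2 Set.inter_subset_left] at h2
    refine h2.trans_lt ?_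
    rw [Measure.smul_apply, smul_eq_mul]
    refine ENNReal.mul_lt_top ENNReal.ofReal_lt_top ?_
    rw [Measure.map_apply_of_aemeasurable ((aemeasurable_chart_symm p).mono_measure
      (Measure.restrict_mono Set.inter_subset_left le_rfl)) hN'o.measurableSet,
      Measure.restrict_apply' (measurableSet_chart_preimage p hNo.measurableSet)]
    refine (measure_mono (t := Metric.ball (extChartAt (𝓡 4) p p) 1) ?_).trans_lt
      measure_ball_lt_top
    rintro z ⟨hz1, hz2⟩
    have h3 := hz1.2.2
    rwa [Set.mem_preimage, (extChartAt (𝓡 4) p).right_inv hz2.1] at h3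
  exact ⟨isCompact_univ.measure_lt_top⟩

end Charts

/-! ### The Sobolev inequality -/

section ScalarSobolev

variable {X : Type*} [TopologicalSpace X] [ChartedSpace R4 X] [IsManifold (𝓡 4) ∞ X]
  [RiemannianBundle (fun x : X => Tan x)]
  [IsContMDiffRiemannianBundle (𝓡 4) ∞ R4 (fun x : X => Tan x)]
  [MeasurableSpace X] [BorelSpace X]

theorem eLpNorm_eq_eLpNorm_restrict_of_support_subset {α E : Type*} [MeasurableSpace α]
    [NormedAddCommGroup E] {μ : Measure α} {f : α → E} {p : ℝ≥0∞} {B : Set α}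
    (hB : MeasurableSet B) (hf : Function.support f ⊆ B) :
    eLpNorm f p μ = eLpNorm f p (μ.restrict B) := by
  rw [← eLpNorm_indicator_eq_eLpNorm_restrict hB, Set.indicator_eq_self.2 hf]

theorem fderiv_comp_chart_symm {s : X → ℝ} (hs : ContMDiff (𝓡 4) 𝓘(ℝ) ∞ s) {p : X} {z : R4}
    (hz : z ∈ (extChartAt (𝓡 4) p).target) (v : R4) :
    fderiv ℝ (s ∘ (extChartAt (𝓡 4) p).symm) z v
      = mvfderiv (𝓡 4) s ((extChartAt (𝓡 4) p).symm z) (dsymm p z v) := by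
  have h1 : MDifferentiableAt (𝓡 4) 𝓘(ℝ) s ((extChartAt (𝓡 4) p).symm z) :=
    (hs _).mdifferentiableAt (by simp)
  have h := mfderiv_comp_apply z h1 (mdifferentiableAt_chart_symm hz) v
  rw [mfderiv_eq_fderiv] at h
  exact h

theorem contDiffOn_comp_chart_symm {s : X → ℝ} (hs : ContMDiff (𝓡 4) 𝓘(ℝ) ∞ s) (p : X) :
    ContDiffOn ℝ 1 (s ∘ (extChartAt (𝓡 4) p).symm) (extChartAt (𝓡 4) p).target := by
  have h1 := hs.comp_contMDiffOn (contMDiffOn_extChartAt_symm (I := 𝓡 4) (n := ∞) p)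
  exact (contMDiffOn_iff_contDiffOn.1 h1).of_le (by simp)

set_option maxHeartbeats 1000000 in
/-- The local Sobolev inequality: the Gagliardo–Nirenberg–Sobolev inequality in `ℝ⁴`, applied to
the function in a chart, multiplied by a cutoff function. -/
theorem exists_eLpNorm_four_restrict_le (p : X) :
    ∃ M ∈ 𝓝 p, ∃ C : ℝ≥0∞, C ≠ ⊤ ∧ ∀ (s D : X → ℝ), ContMDiff (𝓡 4) 𝓘(ℝ) ∞ s → Continuous D →
      (∀ x (v : Tan x), |mvfderiv (𝓡 4) s x v| ≤ D x * ‖v‖) →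
      eLpNorm s 4 ((vol : Measure X).restrict M) ≤ C * (eLpNorm s 2 (vol : Measure X)
        + eLpNorm D 2 (vol : Measure X)) := by
  obtain ⟨N, hNo, hpN, hNs, C, hC, h1, h2, h3⟩ := exists_chart_comparison p
  set e := extChartAt (𝓡 4) p with he
  set B := e.target ∩ e.symm ⁻¹' N with hB
  have hBo : IsOpen B := (continuousOn_extChartAt_symm p).isOpen_inter_preimage
    (isOpen_extChartAt_target p) hNo
  have hpB : e p ∈ B := ⟨mem_extChartAt_target p, by
    rw [Set.mem_preimage, he, extChartAt_to_inv]; exact hpN⟩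
  obtain ⟨r, hr, hrB⟩ := Metric.nhds_basis_closedBall.mem_iff.1 (hBo.mem_nhds hpB)
  let ψ : ContDiffBump (e p) := ⟨r / 2, r, by positivity, by linarith⟩
  obtain ⟨K, hK⟩ : ∃ K, ∀ z, ‖fderiv ℝ ψ z‖ ≤ K :=
    ((ψ.hasCompactSupport.fderiv ℝ).exists_bound_of_continuous
      ((ψ.contDiff (n := 1)).continuous_fderiv one_ne_zero))
  have hK0 : 0 ≤ K := (norm_nonneg _).trans (hK 0)
  have hBm : MeasurableSet B := hBo.measurableSet
  have haem : AEMeasurable e.symm ((volume : Measure R4).restrict B) :=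
    (aemeasurable_chart_symm p).mono_measure (Measure.restrict_mono Set.inter_subset_left le_rfl)
  set M := N ∩ (e.source ∩ e ⁻¹' Metric.ball (e p) (r / 2)) with hM
  have hMo : IsOpen M := hNo.inter ((continuousOn_extChartAt p).isOpen_inter_preimage
    (isOpen_extChartAt_source p) Metric.isOpen_ball)
  have hMm : MeasurableSet M := hMo.measurableSet
  let G : ℝ≥0∞ := (eLpNormLESNormFDerivOfEqInnerConst (volume : Measure R4) ((2 : NNReal) : ℝ) : _)
  let c₄ : ℝ≥0∞ := ENNReal.ofReal C ^ (1 / (4 : ℝ≥0∞)).toReal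
  let c₂ : ℝ≥0∞ := ENNReal.ofReal C ^ (1 / (2 : ℝ≥0∞)).toReal
  refine ⟨M, hMo.mem_nhds ⟨hpN, mem_extChartAt_source p, Metric.mem_ball_self (by positivity)⟩,
    c₄ * (G * (c₂ * ENNReal.ofReal (K + C))), by finiteness, ?_⟩
  intro s D hs hD hsD
  -- the function in the chart, cut off
  let u : R4 → ℝ := fun z => ψ z * s (e.symm z)
  have hts : tsupport ψ ⊆ B := by rw [ψ.tsupport_eq]; exact hrB
  have hsd : ∀ z ∈ B, ContDiffAt ℝ 1 (s ∘ e.symm) z := fun z hz =>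
    (contDiffOn_comp_chart_symm hs p).contDiffAt ((isOpen_extChartAt_target p).mem_nhds hz.1)
  have htu : tsupport u ⊆ tsupport ψ := closure_mono (Function.support_mul_subset_left _ _)
  have hu : ContDiff ℝ 1 u := by
    refine contMDiff_iff_contDiff.1 (contMDiff_of_tsupport fun z hz => ?_)
    exact (ψ.contDiffAt.mul (hsd z (hts (htu hz)))).contMDiffAt
  have huc : HasCompactSupport u := ψ.hasCompactSupport.mul_right
  have hgns : eLpNorm u 4 volume ≤ G * eLpNorm (fderiv ℝ u) 2 volume := by
    have := eLpNorm_le_eLpNorm_fderiv_of_eq_inner (volume : Measure R4) hu huc (p := 2) (p' := 4)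
      (by norm_num) (by simp) (by simp; norm_num)
    exact_mod_cast this
  have hDu : ∀ z ∈ B, ‖fderiv ℝ u z‖ ≤ (K + C) * (|s (e.symm z)| + D (e.symm z)) := by
    intro z hz
    have hf : fderiv ℝ u z = ψ z • fderiv ℝ (s ∘ e.symm) z + s (e.symm z) • fderiv ℝ ψ z :=
      fderiv_mul (ψ.contDiffAt (n := 1)|>.differentiableAt one_ne_zero)
        ((hsd z hz).differentiableAt one_ne_zero)
    have hD0 : 0 ≤ D (e.symm z) := by
      have : Nontrivial (Tan (e.symm z)) := inferInstanceAs (Nontrivial R4)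
      obtain ⟨v, hv⟩ := exists_ne (0 : Tan (e.symm z))
      have := (abs_nonneg _).trans (hsD (e.symm z) v)
      exact nonneg_of_mul_nonneg_left this (norm_pos_iff.2 hv)
    have h5 : ‖fderiv ℝ (s ∘ e.symm) z‖ ≤ D (e.symm z) * C := by
      refine ContinuousLinearMap.opNorm_le_bound _ (by positivity) fun v => ?_
      rw [fderiv_comp_chart_symm hs hz.1 v, Real.norm_eq_abs]
      refine (hsD _ _).trans ?_
      rw [mul_assoc]
      exact mul_le_mul_of_nonneg_left (h3 z hz v) hD0
    rw [hf]
    refine (norm_add_le _ _).trans ?_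
    rw [norm_smul, norm_smul, Real.norm_eq_abs, Real.norm_eq_abs, abs_of_nonneg ψ.nonneg]
    have h6 : ψ z * ‖fderiv ℝ (s ∘ e.symm) z‖ ≤ 1 * (D (e.symm z) * C) :=
      mul_le_mul ψ.le_one h5 (norm_nonneg _) zero_le_one
    have h7 : |s (e.symm z)| * ‖fderiv ℝ ψ z‖ ≤ |s (e.symm z)| * K :=
      mul_le_mul_of_nonneg_left (hK z) (abs_nonneg _)
    nlinarith [mul_nonneg hC.le (abs_nonneg (s (e.symm z))), mul_nonneg hK0 hD0]
  let H : X → ℝ := fun x => (K + C) * (|s x| + D x)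
  have hH : Continuous H := continuous_const.mul (hs.continuous.abs.add hD)
  have hHm : eLpNorm H 2 vol ≤ ENNReal.ofReal (K + C) * (eLpNorm s 2 vol + eLpNorm D 2 vol) := by
    have e1 : H = (K + C) • ((fun x => |s x|) + D) := by
      ext x; simp [H]
    rw [e1, eLpNorm_const_smul, Real.enorm_eq_ofReal (by positivity)]
    gcongr
    refine (eLpNorm_add_le hs.continuous.abs.measurable.aestronglyMeasurable
      hD.measurable.aestronglyMeasurable (by norm_num)).trans ?_
    gcongr
    exact le_of_eq (eLpNorm_norm s)
  have hfd : eLpNorm (fderiv ℝ u) 2 volume ≤ c₂ * eLpNorm H 2 vol := by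
    calc eLpNorm (fderiv ℝ u) 2 volume = eLpNorm (fderiv ℝ u) 2 (volume.restrict B) := 
          eLpNorm_eq_eLpNorm_restrict_of_support_subset hBm
            ((support_fderiv_subset ℝ).trans (htu.trans hts))
      _ ≤ eLpNorm (H ∘ e.symm) 2 (volume.restrict B) := by
          refine eLpNorm_mono_ae ?_
          filter_upwards [ae_restrict_mem hBm] with z hz
          exact (hDu z hz).trans (le_abs_self _)
      _ = eLpNorm H 2 (Measure.map e.symm (volume.restrict B)) :=
          (eLpNorm_map_measure hH.measurable.aestronglyMeasurable haem).symm
      _ ≤ eLpNorm H 2 (ENNReal.ofReal C • (vol : Measure X).restrict N) :=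
          eLpNorm_mono_measure _ h2
      _ ≤ c₂ * eLpNorm H 2 ((vol : Measure X).restrict N) := eLpNorm_smul_measure_le _ _ _ _
      _ ≤ _ := by gcongr; exact Measure.restrict_le_self
  have hsu : eLpNorm s 4 ((vol : Measure X).restrict M) ≤ c₄ * eLpNorm u 4 volume := by
    rw [← eLpNorm_indicator_eq_eLpNorm_restrict hMm]
    have e1 : eLpNorm (M.indicator s) 4 vol
        = eLpNorm (M.indicator s) 4 ((vol : Measure X).restrict N) := by
      rw [← eLpNorm_indicator_eq_eLpNorm_restrict hNo.measurableSet, Set.indicator_indicator,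
        Set.inter_eq_right.2 (Set.inter_subset_left : M ⊆ N)]
    rw [e1]
    calc eLpNorm (M.indicator s) 4 ((vol : Measure X).restrict N)
        ≤ eLpNorm (M.indicator s) 4 (ENNReal.ofReal C • Measure.map e.symm (volume.restrict B)) :=
          eLpNorm_mono_measure _ h1
      _ ≤ c₄ * eLpNorm (M.indicator s) 4 (Measure.map e.symm (volume.restrict B)) :=
          eLpNorm_smul_measure_le _ _ _ _
      _ = c₄ * eLpNorm (M.indicator s ∘ e.symm) 4 (volume.restrict B) := by
          rw [eLpNorm_map_measure (hs.continuous.measurable.indicator hMm).aestronglyMeasurable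
            haem]
      _ ≤ c₄ * eLpNorm u 4 (volume.restrict B) := by
          gcongr
          refine eLpNorm_mono_ae ?_
          filter_upwards [ae_restrict_mem hBm] with z hz
          by_cases hzM : e.symm z ∈ M
          · have h8 : z ∈ Metric.closedBall (e p) (r / 2) := by
              have := hzM.2.2
              rw [Set.mem_preimage, e.right_inv hz.1] at this
              exact Metric.ball_subset_closedBall this
            have h9 : ψ z = 1 := ψ.one_of_mem_closedBall h8
            simp [u, hzM, h9]
          · simp [hzM]
      _ ≤ _ := by gcongr; exact Measure.restrict_le_self
  calc eLpNorm s 4 ((vol : Measure X).restrict M) ≤ c₄ * eLpNorm u 4 volume := hsu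
    _ ≤ c₄ * (G * (c₂ * (ENNReal.ofReal (K + C) * (eLpNorm s 2 vol + eLpNorm D 2 vol)))) := by
        gcongr
        exact hgns.trans (by gcongr; exact hfd.trans (by gcongr))
    _ = _ := by ring

/-- The Sobolev inequality `L^{1,2} ⊆ L⁴` for functions on a compact Riemannian 4-manifold. -/
theorem exists_eLpNorm_four_le [CompactSpace X] :
    ∃ C : ℝ≥0∞, C ≠ ⊤ ∧ ∀ (s D : X → ℝ), ContMDiff (𝓡 4) 𝓘(ℝ) ∞ s → Continuous D →
      (∀ x (v : Tan x), |mvfderiv (𝓡 4) s x v| ≤ D x * ‖v‖) →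
      eLpNorm s 4 (vol : Measure X) ≤ C * (eLpNorm s 2 (vol : Measure X)
        + eLpNorm D 2 (vol : Measure X)) := by
  choose M hM C hC h using exists_eLpNorm_four_restrict_le (X := X)
  obtain ⟨t, -, ht⟩ := isCompact_univ.elim_nhds_subcover M (fun x _ => hM x)
  refine ⟨∑ x ∈ t, C x, ?_, fun s D hs hD hsD => ?_⟩
  · exact ENNReal.sum_ne_top.2 fun x _ => hC x
  have hle : (vol : Measure X) ≤ ∑ x ∈ t, (vol : Measure X).restrict (M x) := by
    refine Measure.le_iff.2 fun E hE => ?_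
    rw [Measure.finsetSum_apply]
    simp only [Measure.restrict_apply hE]
    refine le_trans (measure_mono fun y hy => ?_) (measure_biUnion_finset_le t fun x => E ∩ M x)
    obtain ⟨x, hx, hyx⟩ := Set.mem_iUnion₂.1 (ht (Set.mem_univ y))
    exact Set.mem_iUnion₂.2 ⟨x, hx, hy, hyx⟩
  have hsum : ∀ t : Finset X, eLpNorm s 4 (∑ x ∈ t, (vol : Measure X).restrict (M x))
      ≤ ∑ x ∈ t, eLpNorm s 4 ((vol : Measure X).restrict (M x)) := by
    classical
    intro t
    induction t using Finset.induction_on with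
    | empty => simp
    | insert x t hx ih =>
      rw [Finset.sum_insert hx, Finset.sum_insert hx]
      refine le_trans ?_ (add_le_add le_rfl ih)
      simp only [eLpNorm_eq_lintegral_rpow_enorm_toReal (by norm_num : (4 : ℝ≥0∞) ≠ 0)
        (by norm_num : (4 : ℝ≥0∞) ≠ ⊤), lintegral_add_measure]
      exact ENNReal.rpow_add_le_add_rpow _ _ (by norm_num) (by norm_num)
  refine (eLpNorm_mono_measure _ hle).trans ((hsum t).trans ?_)
  rw [Finset.sum_mul]
  exact Finset.sum_le_sum fun x _ => h x s D hs hD hsD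

end ScalarSobolev

section BundleSobolev

variable {X : Type*} [TopologicalSpace X] [T2Space X] [ChartedSpace R4 X] [IsManifold (𝓡 4) ∞ X]
  [RiemannianBundle (fun x : X => Tan x)]
  [IsContMDiffRiemannianBundle (𝓡 4) ∞ R4 (fun x : X => Tan x)]
  {F : Type*} [NormedAddCommGroup F] [NormedSpace ℝ F] [FiniteDimensional ℝ F]
  {V : X → Type*} [TopologicalSpace (TotalSpace F V)]
  [∀ x, NormedAddCommGroup (V x)] [∀ x, InnerProductSpace ℝ (V x)]
  [FiberBundle F V] [VectorBundle ℝ F V]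
  [IsContMDiffRiemannianBundle (𝓡 4) ∞ F V] [ContMDiffVectorBundle ∞ F V (𝓡 4)]
  {nabla : CovariantDerivative (𝓡 4) F V}

theorem continuous_hsInner_covariantDerivative (hn : nabla.ContMDiffCovariantDerivative ∞)
    {σ τ : Π x, V x} (hσ : IsSmoothSection F σ) (hτ : IsSmoothSection F τ) :
    Continuous fun x => hsInner (nabla σ x) (nabla τ x) := by
  refine continuous_iff_continuousAt.2 fun p => ?_
  obtain ⟨W, hW, hb⟩ := exists_orthonormalBasis_sections R4 (fun x : X => Tan x) p
  have h1 : Continuous fun x => ∑ i, inner ℝ (nabla σ x (W i x)) (nabla τ x (W i x)) :=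
    continuous_finsetSum _ fun i _ => ((hσ.covariantDerivative hn (hW i)).inner
      (hτ.covariantDerivative hn (hW i))).continuous
  refine h1.continuousAt.congr ?_
  filter_upwards [hb] with x ⟨b, hb⟩
  rw [hsInner_eq_sum b]
  simp only [hb]

variable [MeasurableSpace X] [BorelSpace X]

variable (nabla) in
/-- The Sobolev inequality for smooth sections. By Kato's inequality, `√(ε² + |σ|²)` is a smooth
function with derivative bounded by `|∇σ|`; let `ε` tend to `0`. -/
theorem exists_eLpNorm_four_section_le [CompactSpace X]
    (hn : nabla.ContMDiffCovariantDerivative ∞) (hm : nabla.IsMetricCompatible) :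
    ∃ C : ℝ≥0∞, C ≠ ⊤ ∧ ∀ σ : Π x, V x, IsSmoothSection F σ →
      eLpNorm (fun x => ‖σ x‖) 4 (vol : Measure X)
        ≤ C * (eLpNorm (fun x => ‖σ x‖) 2 (vol : Measure X)
        + eLpNorm (fun x => √(hsInner (nabla σ x) (nabla σ x))) 2 (vol : Measure X)) := by
  obtain ⟨C, hC, h⟩ := exists_eLpNorm_four_le (X := X)
  have := isFiniteMeasure_vol (X := X)
  refine ⟨C, hC, fun σ hσ => ?_⟩
  set D : X → ℝ := fun x => √(hsInner (nabla σ x) (nabla σ x)) with hDdef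
  have hD : Continuous D := (continuous_hsInner_covariantDerivative hn hσ hσ).sqrt
  have hcont : Continuous fun x => ‖σ x‖ := by
    have := (hσ.inner hσ).continuous.sqrt
    refine this.congr fun x => ?_
    rw [real_inner_self_eq_norm_sq, Real.sqrt_sq (norm_nonneg _)]
  set m := (vol : Measure X) Set.univ ^ (1 / (2 : ℝ≥0∞).toReal) with hm'
  have key : ∀ ε : NNReal, 0 < ε → eLpNorm (fun x => ‖σ x‖) 4 (vol : Measure X)
      ≤ C * (eLpNorm (fun x => ‖σ x‖) 2 (vol : Measure X) + ε * m
        + eLpNorm D 2 (vol : Measure X)) := by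
    intro ε hε
    have hε' : (0 : ℝ) < ε := hε
    let s : X → ℝ := fun x => √(ε ^ 2 + inner ℝ (σ x) (σ x))
    have hpos : ∀ x, 0 < (ε : ℝ) ^ 2 + inner ℝ (σ x) (σ x) := fun x =>
      add_pos_of_pos_of_nonneg (by positivity) real_inner_self_nonneg
    have hs : ContMDiff (𝓡 4) 𝓘(ℝ) ∞ s := fun x =>
      ContMDiffAt.comp x ((Real.contDiffAt_sqrt (hpos x).ne').contMDiffAt)
        ((contMDiff_const.add (hσ.inner hσ)) x)
    have hs2 : s * s = (fun _ => (ε : ℝ) ^ 2) + fun x => inner ℝ (σ x) (σ x) := by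
      ext x
      exact Real.mul_self_sqrt (hpos x).le
    have hsσ : ∀ x, ‖σ x‖ ≤ s x := fun x => by
      refine Real.le_sqrt_of_sq_le ?_
      rw [real_inner_self_eq_norm_sq]
      nlinarith
    have hsε : ∀ x, |s x| ≤ ‖σ x‖ + ε := fun x => by
      rw [abs_of_nonneg (Real.sqrt_nonneg _)]
      refine Real.sqrt_le_iff.2 ⟨by positivity, ?_⟩
      rw [real_inner_self_eq_norm_sq]
      nlinarith [mul_nonneg hε'.le (norm_nonneg (σ x))]
    have hder : ∀ x (v : Tan x), |mvfderiv (𝓡 4) s x v| ≤ D x * ‖v‖ := by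
      intro x v
      obtain ⟨W, hW, hWx⟩ := exists_isSmoothSection_apply_eq (V := fun x : X => Tan x) R4 v
      have hsx := (hs x).mdifferentiableAt (by simp)
      have e1 := mvfderiv_inner_apply hm hσ hσ W x
      have e2 : mvfderiv (𝓡 4) (s * s) x v
          = mvfderiv (𝓡 4) (fun y => inner ℝ (σ y) (σ y)) x v := by
        rw [hs2, mvfderiv_add mdifferentiableAt_const (((hσ.inner hσ) x).mdifferentiableAt
          (by simp)), mvfderiv_const]
        simp
      rw [hWx, ← e2, mvfderiv_mul hsx hsx, real_inner_comm (nabla σ x v) (σ x)] at e1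
      have e3 : s x * mvfderiv (𝓡 4) s x v = inner ℝ (nabla σ x v) (σ x) := by
        simp only [add_apply, smul_apply, smul_eq_mul] at e1
        linarith
      have e4 : ‖nabla σ x v‖ ≤ D x * ‖v‖ := by
        refine le_of_sq_le_sq ?_ (by positivity)
        rw [mul_pow, Real.sq_sqrt (hsInner_self_nonneg _)]
        exact norm_apply_sq_le_hsInner _ _
      have hsx0 : 0 < s x := Real.sqrt_pos.2 (hpos x)
      have e5 : s x * |mvfderiv (𝓡 4) s x v| ≤ s x * (D x * ‖v‖) := by
        rw [← abs_of_pos hsx0, ← abs_mul, abs_of_pos hsx0, e3]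
        refine (abs_real_inner_le_norm _ _).trans ?_
        rw [mul_comm]
        exact mul_le_mul (hsσ x) e4 (norm_nonneg _) hsx0.le
      exact le_of_mul_le_mul_left e5 hsx0
    calc eLpNorm (fun x => ‖σ x‖) 4 (vol : Measure X) ≤ eLpNorm s 4 vol := by
          refine eLpNorm_mono fun x => ?_
          rw [norm_norm]
          exact (hsσ x).trans (le_abs_self _)
      _ ≤ C * (eLpNorm s 2 vol + eLpNorm D 2 vol) := h s D hs hD hder
      _ ≤ _ := by
          gcongr
          calc eLpNorm s 2 vol ≤ eLpNorm ((fun x => ‖σ x‖) + fun _ => (ε : ℝ)) 2 vol := by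
                refine eLpNorm_mono fun x => ?_
                exact (hsε x).trans (le_abs_self _)
            _ ≤ eLpNorm (fun x => ‖σ x‖) 2 vol + eLpNorm (fun _ => (ε : ℝ)) 2 vol :=
                eLpNorm_add_le hcont.measurable.aestronglyMeasurable
                  aestronglyMeasurable_const (by norm_num)
            _ = _ := by
                rw [eLpNorm_const' _ (by norm_num) (by norm_num)]
                congr 2
                simp
  have hm_top : m ≠ ⊤ := by
    refine ENNReal.rpow_ne_top_of_nonneg (by positivity) (measure_ne_top _ _)
  have hlim : Tendsto (fun ε : NNReal => C * (eLpNorm (fun x => ‖σ x‖) 2 (vol : Measure X)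
      + ε * m + eLpNorm D 2 (vol : Measure X))) (𝓝[>] 0)
      (𝓝 (C * (eLpNorm (fun x => ‖σ x‖) 2 (vol : Measure X)
      + ((0 : NNReal) : ℝ≥0∞) * m + eLpNorm D 2 (vol : Measure X)))) := by
    refine ENNReal.Tendsto.const_mul (Tendsto.add (Tendsto.add tendsto_const_nhds
      (ENNReal.Tendsto.mul_const ?_ (Or.inr hm_top))) tendsto_const_nhds) (Or.inr hC)
    exact (ENNReal.continuous_coe.tendsto 0).mono_left nhdsWithin_le_nhds
  have := ge_of_tendsto hlim (by filter_upwards [self_mem_nhdsWithin] with ε hε using key ε hε)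
  simpa using this

end BundleSobolev

/-! ### Continuity of the curvatures -/

section CurvatureContinuity

variable {X : Type*} [TopologicalSpace X] [T2Space X] [ChartedSpace R4 X] [IsManifold (𝓡 4) ∞ X]
  [RiemannianBundle (fun x : X => Tan x)]
  [IsContMDiffRiemannianBundle (𝓡 4) ∞ R4 (fun x : X => Tan x)]

theorem continuous_scalarCurvature
    {nabla : CovariantDerivative (𝓡 4) R4 (fun x : X => Tan x)}
    (hn : nabla.ContMDiffCovariantDerivative ∞) (hm : nabla.IsMetricCompatible) :
    Continuous (scalarCurvature nabla) := by
  refine continuous_iff_continuousAt.2 fun p => ?_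
  obtain ⟨W, hW, hb⟩ := exists_orthonormalBasis_sections R4 (fun x : X => Tan x) p
  have h1 : Continuous fun x => ∑ i, ∑ j,
      inner ℝ (curvatureField nabla (W i) (W j) (W j) x) (W i x) :=
    continuous_finsetSum _ fun i _ => continuous_finsetSum _ fun j _ =>
      ((IsSmoothSection.curvatureField hn (hW i) (hW j) (hW j)).inner (hW i)).continuous
  refine h1.continuousAt.congr ?_
  filter_upwards [hb] with x ⟨b, hb⟩
  obtain ⟨R, hR⟩ := exists_curvature_trilinear hn hm x
  have e1 : ∀ v : Tan x, ∑ j, inner ℝ (R v (frame x j) (frame x j)) v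
      = ∑ j, inner ℝ (R v (b j) (b j)) v := fun v =>
    sum_apply_orthonormalBasis_eq (frame x) b
      (LinearMap.mk₂ ℝ (fun w w' => inner ℝ (R v w w') v)
        (by simp [inner_add_left]) (by simp [inner_smul_left])
        (by simp [inner_add_left]) (by simp [inner_smul_left]))
  have e2 : ∀ j, ∑ i, inner ℝ (R (frame x i) (b j) (b j)) (frame x i)
      = ∑ i, inner ℝ (R (b i) (b j) (b j)) (b i) := fun j =>
    sum_apply_orthonormalBasis_eq (frame x) b
      (LinearMap.mk₂ ℝ (fun v v' => inner ℝ (R v (b j) (b j)) v')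
        (by simp [inner_add_left]) (by simp [inner_smul_left])
        (by simp [inner_add_right]) (by simp [inner_smul_right]))
  have e3 : ∀ i j, curvatureField nabla (W i) (W j) (W j) x = R (b i) (b j) (b j) := by
    intro i j
    rw [hR, hb, hb, curvature_apply hn hm (hW i) (hW j) (hW j)]
  simp only [scalarCurvature, ← hR, e1, e3, ← hb]
  rw [Finset.sum_comm, Finset.sum_comm (f := fun i j => inner ℝ (R (frame x i) (b j) (b j))
    (frame x i))]
  exact Finset.sum_congr rfl fun j _ => (e2 j).symm

variable {L : X → Type*} [TopologicalSpace (TotalSpace R2 L)]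
  [∀ x, NormedAddCommGroup (L x)] [∀ x, InnerProductSpace ℝ (L x)]
  [FiberBundle R2 L] [VectorBundle ℝ R2 L]
  [ContMDiffVectorBundle ∞ R2 L (𝓡 4)] [IsContMDiffRiemannianBundle (𝓡 4) ∞ R2 L]
  {nablaL : CovariantDerivative (𝓡 4) R2 L}

/-- The curvature form at `x`, as a bilinear form. -/
theorem exists_lineCurvature_bilinear (hL : HermitianStructure R2 L)
    (hn : nablaL.ContMDiffCovariantDerivative ∞) (hm : nablaL.IsMetricCompatible) (x : X) :
    ∃ B : Tan x →ₗ[ℝ] Tan x →ₗ[ℝ] ℝ, ∀ v w, B v w = lineCurvature hL nablaL x v w := by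
  obtain ⟨R, hR⟩ := exists_curvature_trilinear hn hm x
  refine ⟨LinearMap.mk₂ ℝ (lineCurvature hL nablaL x) ?_ ?_ ?_ ?_, fun v w => rfl⟩ <;>
    intros <;>
    simp only [lineCurvature, ← hR, map_add, map_smul, LinearMap.add_apply, LinearMap.smul_apply,
      inner_add_left, real_inner_smul_left, Finset.sum_add_distrib, ← Finset.mul_sum, smul_eq_mul]
    <;> ring

theorem continuous_lineCurvature_apply (hL : HermitianStructure R2 L)
    (hn : nablaL.ContMDiffCovariantDerivative ∞) (hm : nablaL.IsMetricCompatible)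
    {W₁ W₂ : Π x : X, Tan x} (h₁ : IsSmoothSection R4 W₁) (h₂ : IsSmoothSection R4 W₂) :
    Continuous fun x => lineCurvature hL nablaL x (W₁ x) (W₂ x) := by
  refine continuous_iff_continuousAt.2 fun p => ?_
  obtain ⟨s, hs, hb⟩ := exists_orthonormalBasis_sections R2 L p
  have h1 : Continuous fun x => (1 / 2) * ∑ k,
      inner ℝ (curvatureField nablaL W₁ W₂ (s k) x) (hL.J x (s k x)) :=
    continuous_const.mul (continuous_finsetSum _ fun k _ =>
      ((IsSmoothSection.curvatureField hn h₁ h₂ (hs k)).inner (hL.smooth _ (hs k))).continuous)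
  refine h1.continuousAt.congr ?_
  filter_upwards [hb] with x ⟨b, hb⟩
  obtain ⟨R, hR⟩ := exists_curvature_trilinear hn hm x
  simp only [lineCurvature, ← hR]
  congr 1
  have e3 : ∀ k, curvatureField nablaL W₁ W₂ (s k) x = R (W₁ x) (W₂ x) (s k x) := by
    intro k
    rw [hR, curvature_apply hn hm h₁ h₂ (hs k)]
  simp only [e3, ← hb]
  refine sum_apply_orthonormalBasis_eq b _
    (LinearMap.mk₂ ℝ (fun u u' => inner ℝ (R (W₁ x) (W₂ x) u) (hL.J x u'))
      (by simp [inner_add_left]) (by simp [inner_smul_left])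
      (by simp [inner_add_right]) (by simp [inner_smul_right]))

end CurvatureContinuity

/-! ### Measurable sections -/

section Measurable

variable {X : Type*} [TopologicalSpace X] [T2Space X] [CompactSpace X] [ChartedSpace R4 X]
  [IsManifold (𝓡 4) ∞ X]
  [RiemannianBundle (fun x : X => Tan x)]
  [IsContMDiffRiemannianBundle (𝓡 4) ∞ R4 (fun x : X => Tan x)]
  [MeasurableSpace X] [BorelSpace X]

/-- On a compact manifold, measurability is a local property. -/
theorem aemeasurable_of_eventuallyEq {f : X → ℝ}
    (hf : ∀ p, ∃ g : X → ℝ, AEMeasurable g (vol : Measure X) ∧ ∀ᶠ x in 𝓝 p, g x = f x) :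
    AEMeasurable f (vol : Measure X) := by
  choose g hg h using hf
  choose N hN hNo hpN using fun p => eventually_nhds_iff.1 (h p)
  obtain ⟨t, ht⟩ := isCompact_univ.elim_finite_subcover N hNo
    (fun x _ => Set.mem_iUnion.2 ⟨x, hpN x⟩)
  have h1 : AEMeasurable f ((vol : Measure X).restrict (⋃ p : t, N p)) := by
    refine aemeasurable_iUnion_iff.2 fun p => ?_
    refine (hg p).restrict.congr ?_
    filter_upwards [ae_restrict_mem (hNo p).measurableSet] with x hx
    exact hN p x hx
  have h2 : (⋃ p : t, N p) = Set.univ := by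
    refine Set.eq_univ_of_univ_subset (ht.trans ?_)
    simp [Set.iUnion_subtype]
  rwa [h2, Measure.restrict_univ] at h1

variable (F : Type*) [NormedAddCommGroup F] [NormedSpace ℝ F] [FiniteDimensional ℝ F]
  {V : X → Type*} [TopologicalSpace (TotalSpace F V)]
  [∀ x, NormedAddCommGroup (V x)] [∀ x, InnerProductSpace ℝ (V x)]
  [FiberBundle F V] [VectorBundle ℝ F V]

/-- A section is measurable if its inner products with all smooth sections are. -/
def IsMeasurableSection (σ : Π x, V x) : Prop :=
  ∀ τ : Π x, V x, IsSmoothSection F τ →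
    AEMeasurable (fun x => inner ℝ (σ x) (τ x)) (vol : Measure X)

/-- A section of `T*X ⊗ V` is measurable if its values on smooth vector fields are measurable
sections. -/
def IsMeasurableHom (ψ : Π x, Tan x →L[ℝ] V x) : Prop :=
  ∀ W : Π x : X, Tan x, IsSmoothSection R4 W → IsMeasurableSection F (fun x => ψ x (W x))

variable {F}

theorem IsMeasurableSection.add {σ τ : Π x, V x} (hσ : IsMeasurableSection F σ)
    (hτ : IsMeasurableSection F τ) : IsMeasurableSection F (fun x => σ x + τ x) := fun ρ hρ => by
  simpa only [inner_add_left] using (hσ ρ hρ).fun_add (hτ ρ hρ)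

theorem IsMeasurableSection.const_smul (c : ℝ) {σ : Π x, V x} (hσ : IsMeasurableSection F σ) :
    IsMeasurableSection F (fun x => c • σ x) := fun ρ hρ => by
  simpa only [real_inner_smul_left] using (hσ ρ hρ).const_mul c

theorem IsMeasurableHom.add {ψ χ : Π x, Tan x →L[ℝ] V x} (hψ : IsMeasurableHom F ψ)
    (hχ : IsMeasurableHom F χ) : IsMeasurableHom F (fun x => ψ x + χ x) := fun W hW =>
  (hψ W hW).add (hχ W hW)

theorem IsMeasurableHom.const_smul (c : ℝ) {ψ : Π x, Tan x →L[ℝ] V x}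
    (hψ : IsMeasurableHom F ψ) : IsMeasurableHom F (fun x => c • ψ x) := fun W hW =>
  (hψ W hW).const_smul c

variable [IsContMDiffRiemannianBundle (𝓡 4) ∞ F V]

theorem IsSmoothSection.isMeasurableSection {σ : Π x, V x} (hσ : IsSmoothSection F σ) :
    IsMeasurableSection F σ := fun _ hτ => (hσ.inner hτ).continuous.measurable.aemeasurable

variable [ContMDiffVectorBundle ∞ F V (𝓡 4)]

theorem IsMeasurableSection.aemeasurable_inner {σ τ : Π x, V x} (hσ : IsMeasurableSection F σ)
    (hτ : IsMeasurableSection F τ) :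
    AEMeasurable (fun x => inner ℝ (σ x) (τ x)) (vol : Measure X) := by
  refine aemeasurable_of_eventuallyEq fun p => ?_
  obtain ⟨s, hs, hb⟩ := exists_orthonormalBasis_sections F V p
  refine ⟨fun x => ∑ k, inner ℝ (σ x) (s k x) * inner ℝ (τ x) (s k x),
    Finset.aemeasurable_fun_sum _ fun k _ => (hσ _ (hs k)).mul (hτ _ (hs k)), ?_⟩
  filter_upwards [hb] with x ⟨b, hb⟩
  rw [← b.sum_inner_mul_inner]
  refine Finset.sum_congr rfl fun k _ => ?_
  rw [hb, real_inner_comm (τ x) (s k x)]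

theorem IsMeasurableSection.aemeasurable_norm {σ : Π x, V x} (hσ : IsMeasurableSection F σ) :
    AEMeasurable (fun x => ‖σ x‖) (vol : Measure X) := by
  refine (hσ.aemeasurable_inner hσ).sqrt.congr (Eventually.of_forall fun x => ?_)
  simp only [real_inner_self_eq_norm_sq, Real.sqrt_sq (norm_nonneg _)]

theorem IsMeasurableHom.aemeasurable_hsInner {ψ χ : Π x, Tan x →L[ℝ] V x} (hψ : IsMeasurableHom F ψ)
    (hχ : IsMeasurableHom F χ) :
    AEMeasurable (fun x => hsInner (ψ x) (χ x)) (vol : Measure X) := by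
  refine aemeasurable_of_eventuallyEq fun p => ?_
  obtain ⟨W, hW, hb⟩ := exists_orthonormalBasis_sections R4 (fun x : X => Tan x) p
  refine ⟨fun x => ∑ i, inner ℝ (ψ x (W i x)) (χ x (W i x)),
    Finset.aemeasurable_fun_sum _ fun i _ => (hψ _ (hW i)).aemeasurable_inner (hχ _ (hW i)), ?_⟩
  filter_upwards [hb] with x ⟨b, hb⟩
  rw [hsInner_eq_sum b]
  simp only [hb]

theorem isMeasurableHom_covariantDerivative {nabla : CovariantDerivative (𝓡 4) F V}
    (hn : nabla.ContMDiffCovariantDerivative ∞) {σ : Π x, V x} (hσ : IsSmoothSection F σ) :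
    IsMeasurableHom F (fun x => nabla σ x) := fun _ hW =>
  (hσ.covariantDerivative hn hW).isMeasurableSection

theorem IsL12.isMeasurable {nabla : CovariantDerivative (𝓡 4) F V}
    (hn : nabla.ContMDiffCovariantDerivative ∞) {u : Jet V} (hu : IsL12 nabla u) :
    IsMeasurableSection F (fun x => (u x).1) ∧ IsMeasurableHom F (fun x => (u x).2) := by
  obtain ⟨σ, hσ, hlim, -⟩ := hu
  constructor
  · intro τ hτ
    refine aemeasurable_of_tendsto_metrizable_ae atTop
      (fun n => (hσ n).isMeasurableSection τ hτ) ?_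
    filter_upwards [hlim] with x hx
    exact ((continuous_fst.tendsto _).comp hx).inner tendsto_const_nhds
  · intro W hW τ hτ
    refine aemeasurable_of_tendsto_metrizable_ae atTop
      (fun n => isMeasurableHom_covariantDerivative hn (hσ n) W hW τ hτ) ?_
    filter_upwards [hlim] with x hx
    refine Tendsto.inner ?_ tendsto_const_nhds
    have h1 : Continuous fun q : V x × (Tan x →L[ℝ] V x) => q.2 (W x) := by fun_prop
    exact (h1.tendsto _).comp hx

end Measurable

/-! ### Integrable sections -/

section Integrability

variable {X : Type*} [TopologicalSpace X] [T2Space X] [CompactSpace X] [ChartedSpace R4 X]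
  [IsManifold (𝓡 4) ∞ X]
  [RiemannianBundle (fun x : X => Tan x)]
  [IsContMDiffRiemannianBundle (𝓡 4) ∞ R4 (fun x : X => Tan x)]
  [MeasurableSpace X] [BorelSpace X]

theorem integrable_of_continuous {f : X → ℝ} (hf : Continuous f) :
    Integrable f (vol : Measure X) := by
  have := isFiniteMeasure_vol (X := X)
  exact hf.integrable_of_hasCompactSupport (HasCompactSupport.of_compactSpace f)

variable (F : Type*) [NormedAddCommGroup F] [NormedSpace ℝ F] [FiniteDimensional ℝ F]
  {V : X → Type*} [TopologicalSpace (TotalSpace F V)]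
  [∀ x, NormedAddCommGroup (V x)] [∀ x, InnerProductSpace ℝ (V x)]
  [FiberBundle F V] [VectorBundle ℝ F V]

/-- `σ` is a section of class `L⁴`. -/
structure IsL4Section (σ : Π x, V x) : Prop where
  measurable : IsMeasurableSection F σ
  integrable : Integrable (fun x => ‖σ x‖ ^ 4) (vol : Measure X)

/-- `ψ` is a section of `T*X ⊗ V` of class `L²`. -/
structure IsL2Hom (ψ : Π x, Tan x →L[ℝ] V x) : Prop where
  measurable : IsMeasurableHom F ψ
  integrable : Integrable (fun x => hsInner (ψ x) (ψ x)) (vol : Measure X)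

variable {F}
variable [IsContMDiffRiemannianBundle (𝓡 4) ∞ F V] [ContMDiffVectorBundle ∞ F V (𝓡 4)]

theorem norm_add_pow_four_le {E : Type*} [SeminormedAddCommGroup E] (v w : E) :
    ‖v + w‖ ^ 4 ≤ 8 * ‖v‖ ^ 4 + 8 * ‖w‖ ^ 4 := by
  have h1 : ‖v + w‖ ^ 4 ≤ (‖v‖ + ‖w‖) ^ 4 := by gcongr; exact norm_add_le v w
  have h2 : (‖v‖ + ‖w‖) ^ 2 ≤ 2 * (‖v‖ ^ 2 + ‖w‖ ^ 2) := add_sq_le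
  have h3 : (‖v‖ ^ 2 + ‖w‖ ^ 2) ^ 2 ≤ 2 * ((‖v‖ ^ 2) ^ 2 + (‖w‖ ^ 2) ^ 2) := add_sq_le
  nlinarith [sq_nonneg (‖v‖ + ‖w‖), mul_self_le_mul_self (sq_nonneg (‖v‖ + ‖w‖)) h2]

theorem IsL4Section.add {σ τ : Π x, V x} (hσ : IsL4Section F σ) (hτ : IsL4Section F τ) :
    IsL4Section F (fun x => σ x + τ x) where
  measurable := hσ.measurable.add hτ.measurable
  integrable := by
    refine ((hσ.integrable.const_mul 8).add (hτ.integrable.const_mul 8)).mono'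
      ((hσ.measurable.add hτ.measurable).aemeasurable_norm.pow_const 4).aestronglyMeasurable
      (Eventually.of_forall fun x => ?_)
    rw [Real.norm_of_nonneg (by positivity)]
    exact norm_add_pow_four_le _ _

theorem IsL4Section.const_smul (c : ℝ) {σ : Π x, V x} (hσ : IsL4Section F σ) :
    IsL4Section F (fun x => c • σ x) where
  measurable := hσ.measurable.const_smul c
  integrable := by
    simpa only [norm_smul, mul_pow] using hσ.integrable.const_mul (‖c‖ ^ 4)

theorem IsL4Section.sub {σ τ : Π x, V x} (hσ : IsL4Section F σ) (hτ : IsL4Section F τ) :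
    IsL4Section F (fun x => σ x - τ x) := by
  simpa [sub_eq_add_neg] using hσ.add (hτ.const_smul (-1))

theorem mul_mul_mul_le_add_pow_four {a b c d : ℝ} :
    (a * b) * (c * d) ≤ a ^ 4 + b ^ 4 + (c ^ 4 + d ^ 4) := by
  nlinarith [sq_nonneg (a * b - c * d), sq_nonneg (a ^ 2 - b ^ 2), sq_nonneg (c ^ 2 - d ^ 2),
    sq_nonneg (a ^ 2), sq_nonneg (b ^ 2), sq_nonneg (c ^ 2), sq_nonneg (d ^ 2)]

theorem IsL4Section.integrable_inner_mul_inner {σ₁ σ₂ σ₃ σ₄ : Π x, V x} (h₁ : IsL4Section F σ₁)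
    (h₂ : IsL4Section F σ₂) (h₃ : IsL4Section F σ₃) (h₄ : IsL4Section F σ₄) :
    Integrable (fun x => inner ℝ (σ₁ x) (σ₂ x) * inner ℝ (σ₃ x) (σ₄ x)) (vol : Measure X) := by
  refine ((h₁.integrable.add h₂.integrable).add (h₃.integrable.add h₄.integrable)).mono'
    ((h₁.measurable.aemeasurable_inner h₂.measurable).mul
      (h₃.measurable.aemeasurable_inner h₄.measurable)).aestronglyMeasurable
    (Eventually.of_forall fun x => ?_)
  rw [norm_mul]
  refine (mul_le_mul (norm_inner_le_norm _ _) (norm_inner_le_norm _ _) (norm_nonneg _)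
    (by positivity)).trans mul_mul_mul_le_add_pow_four

theorem abs_inner_le_one_add {E : Type*} [NormedAddCommGroup E] [InnerProductSpace ℝ E]
    (v w : E) : |inner ℝ v w| ≤ 1 + (‖v‖ ^ 4 + ‖w‖ ^ 4) := by
  refine (abs_real_inner_le_norm v w).trans ?_
  nlinarith [sq_nonneg (‖v‖ - ‖w‖), sq_nonneg (‖v‖ ^ 2 - 1), sq_nonneg (‖w‖ ^ 2 - 1),
    sq_nonneg (‖v‖ ^ 2), sq_nonneg (‖w‖ ^ 2)]

theorem IsL4Section.integrable_inner {σ τ : Π x, V x} (hσ : IsL4Section F σ)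
    (hτ : IsL4Section F τ) :
    Integrable (fun x => inner ℝ (σ x) (τ x)) (vol : Measure X) := by
  have := isFiniteMeasure_vol (X := X)
  exact ((integrable_const 1).add (hσ.integrable.add hτ.integrable)).mono'
    (hσ.measurable.aemeasurable_inner hτ.measurable).aestronglyMeasurable
    (Eventually.of_forall fun x => abs_inner_le_one_add _ _)

theorem exists_abs_le_of_continuous {k : X → ℝ} (hk : Continuous k) :
    ∃ C, 0 ≤ C ∧ ∀ x, |k x| ≤ C := by
  obtain ⟨C, hC⟩ := isCompact_univ.exists_bound_of_continuousOn hk.continuousOn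
  exact ⟨|C|, abs_nonneg C, fun x => (hC x (Set.mem_univ x)).trans (le_abs_self C)⟩

theorem IsL4Section.integrable_mul_inner {k : X → ℝ} (hk : Continuous k) {σ τ : Π x, V x}
    (hσ : IsL4Section F σ) (hτ : IsL4Section F τ) :
    Integrable (fun x => k x * inner ℝ (σ x) (τ x)) (vol : Measure X) := by
  obtain ⟨C, -, hC⟩ := exists_abs_le_of_continuous hk
  exact (hσ.integrable_inner hτ).bdd_mul hk.measurable.aestronglyMeasurable
    (Eventually.of_forall hC)

theorem IsL2Hom.integrable_hsInner {ψ χ : Π x, Tan x →L[ℝ] V x} (hψ : IsL2Hom F ψ)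
    (hχ : IsL2Hom F χ) :
    Integrable (fun x => hsInner (ψ x) (χ x)) (vol : Measure X) :=
  ((hψ.integrable.add hχ.integrable).div_const 2).mono'
    (hψ.measurable.aemeasurable_hsInner hχ.measurable).aestronglyMeasurable
    (Eventually.of_forall fun _ => abs_hsInner_le _ _)

theorem IsL2Hom.add {ψ χ : Π x, Tan x →L[ℝ] V x} (hψ : IsL2Hom F ψ) (hχ : IsL2Hom F χ) :
    IsL2Hom F (fun x => ψ x + χ x) where
  measurable := hψ.measurable.add hχ.measurable
  integrable := by
    refine ((hψ.integrable.const_mul 2).add (hχ.integrable.const_mul 2)).mono'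
      ((hψ.measurable.add hχ.measurable).aemeasurable_hsInner
        (hψ.measurable.add hχ.measurable)).aestronglyMeasurable
      (Eventually.of_forall fun x => ?_)
    rw [Real.norm_of_nonneg (hsInner_self_nonneg _)]
    exact hsInner_add_self_le _ _

theorem IsL2Hom.const_smul (c : ℝ) {ψ : Π x, Tan x →L[ℝ] V x} (hψ : IsL2Hom F ψ) :
    IsL2Hom F (fun x => c • ψ x) where
  measurable := hψ.measurable.const_smul c
  integrable := by
    simpa only [hsInner_smul_left, hsInner_smul_right] using
      (hψ.integrable.const_mul c).const_mul c

theorem IsL2Hom.sub {ψ χ : Π x, Tan x →L[ℝ] V x} (hψ : IsL2Hom F ψ) (hχ : IsL2Hom F χ) :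
    IsL2Hom F (fun x => ψ x - χ x) := by
  simpa [sub_eq_add_neg] using hψ.add (hχ.const_smul (-1))

theorem IsSmoothSection.isL4Section {σ : Π x, V x} (hσ : IsSmoothSection F σ) :
    IsL4Section F σ where
  measurable := hσ.isMeasurableSection
  integrable := by
    refine (integrable_of_continuous ((hσ.inner hσ).continuous.pow 2)).congr
      (Eventually.of_forall fun x => ?_)
    simp only [Pi.pow_apply, real_inner_self_eq_norm_sq]
    ring

variable {nabla : CovariantDerivative (𝓡 4) F V}

theorem IsSmoothSection.isL2Hom (hn : nabla.ContMDiffCovariantDerivative ∞) {σ : Π x, V x}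
    (hσ : IsSmoothSection F σ) : IsL2Hom F (fun x => nabla σ x) where
  measurable := isMeasurableHom_covariantDerivative hn hσ
  integrable := integrable_of_continuous (continuous_hsInner_covariantDerivative hn hσ hσ)

/-! ### Sobolev sections and approximation by smooth sections -/

variable (nabla) in
/-- The Sobolev inequality for smooth sections, in terms of the integral that defines the
`L^{1,2}` norm. -/
theorem exists_lintegral_pow_four_le (hn : nabla.ContMDiffCovariantDerivative ∞)
    (hm : nabla.IsMetricCompatible) :
    ∃ C : ℝ≥0∞, C ≠ ⊤ ∧ ∀ σ : Π x, V x, IsSmoothSection F σ →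
      ∫⁻ x, ENNReal.ofReal (‖σ x‖ ^ 4) ∂(vol : Measure X)
        ≤ C * (∫⁻ x, ENNReal.ofReal (‖σ x‖ ^ 2 + hsInner (nabla σ x) (nabla σ x))
          ∂(vol : Measure X)) ^ 2 := by
  obtain ⟨C, hC, h⟩ := exists_eLpNorm_four_section_le nabla hn hm
  refine ⟨C ^ 4 * 16, by finiteness, fun σ hσ => ?_⟩
  set e := ∫⁻ x, ENNReal.ofReal (‖σ x‖ ^ 2 + hsInner (nabla σ x) (nabla σ x)) ∂(vol : Measure X)
  have hpow : ∀ (f : X → ℝ) (k : ℕ), k ≠ 0 → (∀ x, 0 ≤ f x) →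
      eLpNorm f (k : NNReal) vol ^ k = ∫⁻ x, ENNReal.ofReal (f x ^ k) ∂(vol : Measure X) := by
    intro f k hk hf
    have := eLpNorm_nnreal_pow_eq_lintegral (f := f) (μ := (vol : Measure X)) (p := (k : NNReal))
      (by exact_mod_cast hk)
    simp only [NNReal.coe_natCast, ENNReal.rpow_natCast] at this
    rw [this]
    refine lintegral_congr fun x => ?_
    rw [Real.enorm_of_nonneg (hf x), ENNReal.ofReal_pow (hf x)]
  have h4 := hpow (fun x => ‖σ x‖) 4 (by norm_num) (fun x => norm_nonneg _)
  have h2 := hpow (fun x => ‖σ x‖) 2 (by norm_num) (fun x => norm_nonneg _)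
  have h2' := hpow (fun x => √(hsInner (nabla σ x) (nabla σ x))) 2 (by norm_num)
    (fun x => Real.sqrt_nonneg _)
  push_cast at h4 h2 h2'
  set A := eLpNorm (fun x => ‖σ x‖) 2 (vol : Measure X)
  set B := eLpNorm (fun x => √(hsInner (nabla σ x) (nabla σ x))) 2 (vol : Measure X)
  have hA : A ^ 2 ≤ e := by
    rw [h2]
    exact lintegral_mono fun x => ENNReal.ofReal_le_ofReal
      (le_add_of_nonneg_right (hsInner_self_nonneg _))
  have hB : B ^ 2 ≤ e := by
    rw [h2']
    refine lintegral_mono fun x => ENNReal.ofReal_le_ofReal ?_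
    rw [Real.sq_sqrt (hsInner_self_nonneg _)]
    exact le_add_of_nonneg_left (by positivity)
  have hAB : A + B ≤ 2 * max A B := by
    rw [two_mul]
    exact add_le_add (le_max_left _ _) (le_max_right _ _)
  have hmax : max A B ^ 2 ≤ e := by
    rcases max_choice A B with h' | h' <;> rw [h'] <;> assumption
  rw [← h4]
  calc eLpNorm (fun x => ‖σ x‖) 4 (vol : Measure X) ^ 4 ≤ (C * (2 * max A B)) ^ 4 := by
        gcongr
        exact (h σ hσ).trans (by gcongr)
    _ = C ^ 4 * 16 * (max A B ^ 2) ^ 2 := by ring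
    _ ≤ _ := by gcongr

/-- A Sobolev section is the limit of smooth sections in `L⁴`, and its derivative is the limit of
their derivatives in `L²`. -/
theorem IsL12.exists_tendsto (hn : nabla.ContMDiffCovariantDerivative ∞)
    (hm : nabla.IsMetricCompatible) {u : Jet V} (hu : IsL12 nabla u) :
    ∃ σ : ℕ → Π x, V x, (∀ n, IsSmoothSection F (σ n)) ∧
      Tendsto (fun n => ∫⁻ x, ENNReal.ofReal (‖σ n x - (u x).1‖ ^ 4) ∂(vol : Measure X))
        atTop (𝓝 0) ∧
      Tendsto (fun n => ∫⁻ x, ENNReal.ofReal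
        (hsInner (nabla (σ n) x - (u x).2) (nabla (σ n) x - (u x).2)) ∂(vol : Measure X))
        atTop (𝓝 0) := by
  have hmeas := hu.isMeasurable hn
  obtain ⟨σ, hσ, hlim, he⟩ := hu
  refine ⟨σ, hσ, ?_, ?_⟩
  swap
  · refine tendsto_of_tendsto_of_tendsto_of_le_of_le tendsto_const_nhds he (fun n => zero_le) ?_
    exact fun n => lintegral_mono fun x => ENNReal.ofReal_le_ofReal
      (le_add_of_nonneg_left (by positivity))
  obtain ⟨C, hC, hsob⟩ := exists_lintegral_pow_four_le nabla hn hm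
  let f : ℕ → X → ℝ := fun n x => ‖σ n x - (u x).1‖ ^ 2
    + hsInner (nabla (σ n) x - (u x).2) (nabla (σ n) x - (u x).2)
  set e : ℕ → ℝ≥0∞ := fun n => ∫⁻ x, ENNReal.ofReal (f n x) ∂(vol : Measure X) with hedef
  have hf0 : ∀ n x, 0 ≤ f n x := fun n x => add_nonneg (by positivity) (hsInner_self_nonneg _)
  have hfm : ∀ n, AEMeasurable (f n) (vol : Measure X) := by
    intro n
    have h1 : IsMeasurableSection F (fun x => σ n x - (u x).1) := by
      simpa [sub_eq_add_neg] using (hσ n).isMeasurableSection.add (hmeas.1.const_smul (-1))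
    have h2 : IsMeasurableHom F (fun x => nabla (σ n) x - (u x).2) := by
      simpa [sub_eq_add_neg] using
        (isMeasurableHom_covariantDerivative hn (hσ n)).add (hmeas.2.const_smul (-1))
    exact (h1.aemeasurable_norm.pow_const 2).add (h2.aemeasurable_hsInner h2)
  -- the Sobolev inequality for the differences of the approximating sections
  have hdiff : ∀ n m, ∫⁻ x, ENNReal.ofReal (‖(σ n - σ m) x‖ ^ 4) ∂(vol : Measure X)
      ≤ C * (2 * e n + 2 * e m) ^ 2 := by
    intro n m
    refine (hsob _ ((hσ n).sub (hσ m))).trans ?_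
    gcongr
    have h1 : ∀ x, ‖(σ n - σ m) x‖ ^ 2
        + hsInner (nabla (σ n - σ m) x) (nabla (σ n - σ m) x) ≤ 2 * f n x + 2 * f m x := by
      intro x
      have h2 : nabla (σ n - σ m) x
          = (nabla (σ n) x - (u x).2) + (-1 : ℝ) • (nabla (σ m) x - (u x).2) := by
        have h6 : σ n - σ m = σ n + (-1 : ℝ) • σ m := by module
        rw [h6, nabla.isCovariantDerivativeOnUniv.add ((hσ n).mdifferentiableAt x)
          (((hσ m).const_smul (-1)).mdifferentiableAt x),
          nabla.isCovariantDerivativeOnUniv.smul_const _ ((hσ m).mdifferentiableAt x)]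
        module
      have h3 : (σ n - σ m) x = (σ n x - (u x).1) - (σ m x - (u x).1) := by
        rw [Pi.sub_apply]; abel
      have h4 := hsInner_add_self_le (nabla (σ n) x - (u x).2)
        ((-1 : ℝ) • (nabla (σ m) x - (u x).2))
      simp only [hsInner_smul_left, hsInner_smul_right] at h4
      have h5 := parallelogram_law_with_norm ℝ (σ n x - (u x).1) (σ m x - (u x).1)
      rw [h2, h3]
      simp only [f]
      nlinarith [sq_nonneg ‖σ n x - (u x).1 + (σ m x - (u x).1)‖]
    calc ∫⁻ x, ENNReal.ofReal (‖(σ n - σ m) x‖ ^ 2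
          + hsInner (nabla (σ n - σ m) x) (nabla (σ n - σ m) x)) ∂(vol : Measure X)
        ≤ ∫⁻ x, (2 * ENNReal.ofReal (f n x) + 2 * ENNReal.ofReal (f m x)) ∂(vol : Measure X) := by
          refine lintegral_mono fun x => ?_
          refine (ENNReal.ofReal_le_ofReal (h1 x)).trans (le_of_eq ?_)
          rw [ENNReal.ofReal_add (mul_nonneg zero_le_two (hf0 n x))
            (mul_nonneg zero_le_two (hf0 m x)), ENNReal.ofReal_mul zero_le_two,
            ENNReal.ofReal_mul zero_le_two]
          simp
      _ = 2 * e n + 2 * e m := by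
          rw [lintegral_add_left' ((hfm n).ennreal_ofReal.const_mul 2),
            lintegral_const_mul' _ _ (by simp), lintegral_const_mul' _ _ (by simp)]
  -- Fatou's lemma, for the limit `m → ∞`
  have hfatou : ∀ n, ∫⁻ x, ENNReal.ofReal (‖σ n x - (u x).1‖ ^ 4) ∂(vol : Measure X)
      ≤ C * (2 * e n) ^ 2 := by
    intro n
    have h1 : ∀ᵐ x ∂(vol : Measure X), ENNReal.ofReal (‖σ n x - (u x).1‖ ^ 4)
        = liminf (fun m => ENNReal.ofReal (‖(σ n - σ m) x‖ ^ 4)) atTop := by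
      filter_upwards [hlim] with x hx
      have h2 : Tendsto (fun m => σ m x) atTop (𝓝 (u x).1) := (continuous_fst.tendsto _).comp hx
      exact (ENNReal.tendsto_ofReal ((tendsto_const_nhds.sub h2).norm.pow 4)).liminf_eq.symm
    rw [lintegral_congr_ae h1]
    refine (lintegral_liminf_le' fun m => ?_).trans ?_
    · exact (((hσ n).sub (hσ m)).isMeasurableSection.aemeasurable_norm.pow_const 4).ennreal_ofReal
    · have h3 : Tendsto (fun m => C * (2 * e n + 2 * e m) ^ 2) atTop
          (𝓝 (C * (2 * e n + 2 * 0) ^ 2)) := by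
        refine ENNReal.Tendsto.const_mul ?_ (Or.inr hC)
        exact ENNReal.Tendsto.pow
          (tendsto_const_nhds.add (ENNReal.Tendsto.const_mul he (Or.inr (by simp))))
      rw [mul_zero, add_zero] at h3
      exact (liminf_le_liminf (Eventually.of_forall fun m => hdiff n m)).trans h3.liminf_eq.le
  have h6 : Tendsto (fun n => C * (2 * e n) ^ 2) atTop (𝓝 (C * (2 * 0) ^ 2)) := by
    refine ENNReal.Tendsto.const_mul ?_ (Or.inr hC)
    exact ENNReal.Tendsto.pow (ENNReal.Tendsto.const_mul he (Or.inr (by simp)))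
  simp only [mul_zero, ne_eq, OfNat.ofNat_ne_zero, not_false_eq_true, zero_pow] at h6
  exact tendsto_of_tendsto_of_tendsto_of_le_of_le tendsto_const_nhds h6 (fun n => zero_le) hfatou

/-- The jet `u = (σ, ψ)` has `σ` of class `L⁴` and `ψ` of class `L²`. -/
structure IsIntegrableJet (u : Jet V) : Prop where
  fst : IsL4Section F (fun x => (u x).1)
  snd : IsL2Hom F (fun x => (u x).2)

theorem IsIntegrableJet.sub {u v : Jet V} (hu : IsIntegrableJet (F := F) u)
    (hv : IsIntegrableJet (F := F) v) : IsIntegrableJet (F := F) (u - v) :=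
  ⟨hu.fst.sub hv.fst, hu.snd.sub hv.snd⟩

theorem IsIntegrableJet.const_smul (c : ℝ) {u : Jet V} (hu : IsIntegrableJet (F := F) u) :
    IsIntegrableJet (F := F) (c • u) :=
  ⟨hu.fst.const_smul c, hu.snd.const_smul c⟩

theorem IsSmoothSection.isIntegrableJet (hn : nabla.ContMDiffCovariantDerivative ∞)
    {σ : Π x, V x} (hσ : IsSmoothSection F σ) : IsIntegrableJet (F := F) (jet nabla σ) :=
  ⟨hσ.isL4Section, hσ.isL2Hom hn⟩

theorem IsL12.isL4Section (hn : nabla.ContMDiffCovariantDerivative ∞)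
    (hm : nabla.IsMetricCompatible) {u : Jet V} (hu : IsL12 nabla u) :
    IsL4Section F (fun x => (u x).1) := by
  have hmeas := hu.isMeasurable hn
  obtain ⟨σ, hσ, h4, -⟩ := hu.exists_tendsto hn hm
  obtain ⟨n, h⟩ := (h4.eventually (gt_mem_nhds zero_lt_one)).exists
  have h1 : IsL4Section F (fun x => σ n x - (u x).1) := by
    have h2 : IsMeasurableSection F (fun x => σ n x - (u x).1) := by
      simpa [sub_eq_add_neg] using (hσ n).isMeasurableSection.add (hmeas.1.const_smul (-1))
    exact ⟨h2, (lintegral_ofReal_ne_top_iff_integrable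
      (h2.aemeasurable_norm.pow_const 4).aestronglyMeasurable
      (Eventually.of_forall fun x => by positivity)).1 (h.trans ENNReal.one_lt_top).ne⟩
  simpa using (hσ n).isL4Section.sub h1

theorem IsL12.isL2Hom (hn : nabla.ContMDiffCovariantDerivative ∞)
    (hm : nabla.IsMetricCompatible) {u : Jet V} (hu : IsL12 nabla u) :
    IsL2Hom F (fun x => (u x).2) := by
  have hmeas := hu.isMeasurable hn
  obtain ⟨σ, hσ, -, h4⟩ := hu.exists_tendsto hn hm
  obtain ⟨n, h⟩ := (h4.eventually (gt_mem_nhds zero_lt_one)).exists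
  have h1 : IsL2Hom F (fun x => nabla (σ n) x - (u x).2) := by
    have h2 : IsMeasurableHom F (fun x => nabla (σ n) x - (u x).2) := by
      simpa [sub_eq_add_neg] using
        (isMeasurableHom_covariantDerivative hn (hσ n)).add (hmeas.2.const_smul (-1))
    exact ⟨h2, (lintegral_ofReal_ne_top_iff_integrable
      (h2.aemeasurable_hsInner h2).aestronglyMeasurable
      (Eventually.of_forall fun x => hsInner_self_nonneg _)).1 (h.trans ENNReal.one_lt_top).ne⟩
  simpa using ((hσ n).isL2Hom hn).sub h1

theorem IsSmoothSection.isL12 {σ : Π x, V x} (hσ : IsSmoothSection F σ) :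
    IsL12 nabla (jet nabla σ) := by
  refine ⟨fun _ => σ, fun _ => hσ, Eventually.of_forall fun x => tendsto_const_nhds, ?_⟩
  simp [jet, hsInner]

theorem isL12_zero : IsL12 nabla (0 : Jet V) := by
  have h1 : jet nabla (0 : Π x, V x) = 0 := by
    funext x
    simp only [jet, Pi.zero_apply]
    rw [nabla.isCovariantDerivativeOnUniv.zero]
    rfl
  exact h1 ▸ isSmoothSection_zero.isL12

theorem IsL12.isIntegrableJet (hn : nabla.ContMDiffCovariantDerivative ∞)
    (hm : nabla.IsMetricCompatible) {u : Jet V} (hu : IsL12 nabla u) :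
    IsIntegrableJet (F := F) u :=
  ⟨hu.isL4Section hn hm, hu.isL2Hom hn hm⟩

/-- A linear functional of Sobolev sections that is bounded in `L⁴`, and in `L²` for the
derivatives, vanishes if it vanishes on smooth sections. The bound is assumed in an inhomogeneous
form, which is applied to large multiples. -/
theorem IsL12.integral_eq_zero_of_smooth (hn : nabla.ContMDiffCovariantDerivative ∞)
    (hm : nabla.IsMetricCompatible) (T : Π x, V x × (Tan x →L[ℝ] V x) → ℝ)
    (hsub : ∀ x p q, T x (p - q) = T x p - T x q)
    (hsmul : ∀ x (s : ℝ) p, T x (s • p) = s * T x p)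
    (hint : ∀ u : Jet V, IsIntegrableJet (F := F) u →
      Integrable (fun x => T x (u x)) (vol : Measure X))
    {G : X → ℝ} (hG : Integrable G (vol : Measure X)) {C : ℝ}
    (hbound : ∀ x p, |T x p| ≤ G x + C * (‖p.1‖ ^ 4 + hsInner p.2 p.2))
    (hsmooth : ∀ σ : Π x, V x, IsSmoothSection F σ →
      ∫ x, T x (jet nabla σ x) ∂(vol : Measure X) = 0)
    {u : Jet V} (hu : IsL12 nabla u) : ∫ x, T x (u x) ∂(vol : Measure X) = 0 := by
  have hu' := hu.isIntegrableJet hn hm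
  obtain ⟨σ, hσ, h4, h2⟩ := hu.exists_tendsto hn hm
  set w : ℕ → Jet V := fun n => jet nabla (σ n) - u with hw
  have hw' : ∀ n, IsIntegrableJet (F := F) (w n) := fun n =>
    ((hσ n).isIntegrableJet hn).sub hu'
  have hw4 : ∀ n, IsL4Section F (fun x => (w n x).1) := fun n => (hw' n).fst
  have hw2 : ∀ n, IsL2Hom F (fun x => (w n x).2) := fun n => (hw' n).snd
  have hTw : ∀ n, ∫ x, T x (w n x) ∂(vol : Measure X) = - ∫ x, T x (u x) ∂(vol : Measure X) := by
    intro n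
    simp only [hw, Pi.sub_apply, hsub]
    rw [integral_sub (hint _ ((hσ n).isIntegrableJet hn)) (hint _ hu'), hsmooth _ (hσ n), zero_sub]
  have h4' : Tendsto (fun n => ∫ x, ‖(w n x).1‖ ^ 4 ∂(vol : Measure X)) atTop (𝓝 0) := by
    have h1 := (ENNReal.tendsto_toReal ENNReal.zero_ne_top).comp h4
    refine h1.congr fun n => ?_
    exact (integral_eq_lintegral_of_nonneg_ae (Eventually.of_forall fun x => by positivity)
      (hw4 n).integrable.aestronglyMeasurable).symm
  have h2' : Tendsto (fun n => ∫ x, hsInner (w n x).2 (w n x).2 ∂(vol : Measure X))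
      atTop (𝓝 0) := by
    have h1 := (ENNReal.tendsto_toReal ENNReal.zero_ne_top).comp h2
    refine h1.congr fun n => ?_
    exact (integral_eq_lintegral_of_nonneg_ae
      (Eventually.of_forall fun x => hsInner_self_nonneg _)
      (hw2 n).integrable.aestronglyMeasurable).symm
  set I := ∫ x, T x (u x) ∂(vol : Measure X) with hI
  -- the bound for `s • (σ n - u)`, in the limit `n → ∞`
  have hs : ∀ s : ℝ, 0 < s → s * |I| ≤ ∫ x, G x ∂(vol : Measure X) := by
    intro s hs
    have h1 : ∀ n, s * |I| ≤ ∫ x, G x ∂(vol : Measure X)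
        + C * (s ^ 4 * ∫ x, ‖(w n x).1‖ ^ 4 ∂(vol : Measure X)
          + s ^ 2 * ∫ x, hsInner (w n x).2 (w n x).2 ∂(vol : Measure X)) := by
      intro n
      have e1 : s * |I| = |∫ x, T x ((s • w n) x) ∂(vol : Measure X)| := by
        simp only [Pi.smul_apply, hsmul]
        rw [integral_const_mul, hTw, abs_mul, abs_neg, abs_of_pos hs]
      have e2 := (hw4 n).integrable.const_mul (s ^ 4)
      have e3 := (hw2 n).integrable.const_mul (s ^ 2)
      have e4 : Integrable (fun x => C * (s ^ 4 * ‖(w n x).1‖ ^ 4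
          + s ^ 2 * hsInner (w n x).2 (w n x).2)) (vol : Measure X) := (e2.add e3).const_mul C
      rw [e1, ← integral_const_mul, ← integral_const_mul, ← integral_add e2 e3,
        ← integral_const_mul, ← integral_add hG e4]
      refine abs_integral_le_integral_abs.trans (integral_mono
        (hint _ ((hw' n).const_smul s)).abs (hG.add e4) fun x => ?_)
      refine (hbound x _).trans (le_of_eq ?_)
      simp only [Pi.smul_apply, Prod.smul_fst, Prod.smul_snd, norm_smul,
        Real.norm_of_nonneg hs.le, mul_pow, hsInner_smul_left, hsInner_smul_right]
      ring
    have h5 := ((((h4'.const_mul (s ^ 4)).add (h2'.const_mul (s ^ 2))).const_mul C).const_add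
      (∫ x, G x ∂(vol : Measure X)))
    exact (ge_of_tendsto' h5 h1).trans (le_of_eq (by ring))
  by_contra hne
  have hpos : 0 < |I| := abs_pos.2 hne
  set g := ∫ x, G x ∂(vol : Measure X)
  have hg : 0 < g := by
    have := hs 1 one_pos
    linarith
  have := hs (2 * g / |I|) (by positivity)
  rw [div_mul_cancel₀ _ hpos.ne'] at this
  linarith

end Integrability

/-! ### Two-forms and the action of one-forms on spinors -/

section Forms

variable {X : Type*} [TopologicalSpace X] [ChartedSpace R4 X] [IsManifold (𝓡 4) ∞ X]
  [RiemannianBundle (fun x : X => Tan x)]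

/-- The endomorphism `A - Aᵀ`, which represents the two-form `dθ` if `A = ∇θ`. -/
def skew {x : X} (A : Tan x →L[ℝ] Tan x) : Tan x →L[ℝ] Tan x :=
  A - LinearMap.toContinuousLinearMap (LinearMap.adjoint (A : Tan x →ₗ[ℝ] Tan x))

theorem inner_skew {x : X} (A : Tan x →L[ℝ] Tan x) (v w : Tan x) :
    inner ℝ (skew A v) w = extD A v w := by
  have h1 : inner ℝ (LinearMap.adjoint (A : Tan x →ₗ[ℝ] Tan x) v) w = inner ℝ v (A w) :=
    LinearMap.adjoint_inner_left _ _ _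
  simp only [skew, extD, sub_apply, inner_sub_left]
  rw [real_inner_comm v (A w), ← h1]
  rfl

theorem skew_add {x : X} (A B : Tan x →L[ℝ] Tan x) : skew (A + B) = skew A + skew B := by
  refine ContinuousLinearMap.ext fun v => ext_inner_right ℝ fun w => ?_
  rw [add_apply, inner_add_left]
  simp only [inner_skew, extD, add_apply, inner_add_left]
  ring

theorem skew_smul {x : X} (c : ℝ) (A : Tan x →L[ℝ] Tan x) : skew (c • A) = c • skew A := by
  refine ContinuousLinearMap.ext fun v => ext_inner_right ℝ fun w => ?_
  rw [smul_apply, real_inner_smul_left]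
  simp only [inner_skew, extD, smul_apply, real_inner_smul_left]
  ring

theorem skew_sub {x : X} (A B : Tan x →L[ℝ] Tan x) : skew (A - B) = skew A - skew B := by
  have h1 : A - B = A + (-1 : ℝ) • B := by module
  rw [h1, skew_add, skew_smul]
  module

/-- The norm of a two-form and the Hilbert–Schmidt norm of the endomorphism that represents it
differ by the factor `1/2`. -/
theorem formInner_inner {x : X} (A B : Tan x →L[ℝ] Tan x) :
    formInner (fun v w => inner ℝ (A v) w) (fun v w => inner ℝ (B v) w)
      = (1 / 2) * hsInner A B := by
  unfold formInner hsInner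
  congr 1
  refine Finset.sum_congr rfl fun i _ => ?_
  rw [← (frame x).sum_inner_mul_inner (A (frame x i)) (B (frame x i))]
  refine Finset.sum_congr rfl fun j _ => ?_
  rw [real_inner_comm (B (frame x i)) (frame x j)]

theorem hsInner_skew_le {x : X} (A : Tan x →L[ℝ] Tan x) :
    hsInner (skew A) (skew A) ≤ 4 * hsInner A A := by
  have h1 := formInner_inner A A
  have h2 := formInner_inner (skew A) (skew A)
  simp only [formInner, inner_skew, extD] at h1 h2
  have h3 : ∑ i, ∑ j, inner ℝ (A (frame x j)) (frame x i) * inner ℝ (A (frame x j)) (frame x i)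
      = ∑ i, ∑ j, inner ℝ (A (frame x i)) (frame x j) * inner ℝ (A (frame x i)) (frame x j) :=
    Finset.sum_comm
  have h4 : ∑ i, ∑ j, (inner ℝ (A (frame x i)) (frame x j) - inner ℝ (A (frame x j)) (frame x i))
        * (inner ℝ (A (frame x i)) (frame x j) - inner ℝ (A (frame x j)) (frame x i))
      ≤ ∑ i, ∑ j, (2 * (inner ℝ (A (frame x i)) (frame x j) * inner ℝ (A (frame x i)) (frame x j))
        + 2 * (inner ℝ (A (frame x j)) (frame x i) * inner ℝ (A (frame x j)) (frame x i))) := by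
    refine Finset.sum_le_sum fun i _ => Finset.sum_le_sum fun j _ => ?_
    nlinarith [sq_nonneg (inner ℝ (A (frame x i)) (frame x j)
      + inner ℝ (A (frame x j)) (frame x i))]
  simp only [Finset.sum_add_distrib, ← Finset.mul_sum, h3] at h4
  linarith

variable {Sp : X → Type*} [TopologicalSpace (TotalSpace R4 Sp)]
  [∀ x, NormedAddCommGroup (Sp x)] [∀ x, InnerProductSpace ℝ (Sp x)]
  [FiberBundle R4 Sp] [VectorBundle ℝ R4 Sp] (hp : HermitianStructure R4 Sp) (c : ℝ)

theorem HermitianStructure.inner_J_left {x : X} (s t : Sp x) :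
    inner ℝ (hp.J x s) t = - inner ℝ s (hp.J x t) := by
  rw [← hp.inner_J_J x (hp.J x s) t, hp.J_J, inner_neg_left]

theorem HermitianStructure.norm_J {x : X} (s : Sp x) : ‖hp.J x s‖ = ‖s‖ := by
  have h := hp.inner_J_J x s s
  rw [real_inner_self_eq_norm_sq, real_inner_self_eq_norm_sq] at h
  exact (sq_eq_sq₀ (norm_nonneg _) (norm_nonneg _)).1 h

theorem Phi_apply {x : X} (s : Sp x) (θ v : Tan x) :
    Phi hp c s θ v = (c * inner ℝ θ v) • hp.J x s := by
  simp [Phi, smul_smul]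

theorem Phi_add_left {x : X} (s s' : Sp x) (θ : Tan x) :
    Phi hp c (s + s') θ = Phi hp c s θ + Phi hp c s' θ := by
  ext v; simp [Phi_apply]

theorem Phi_add_right {x : X} (s : Sp x) (θ θ' : Tan x) :
    Phi hp c s (θ + θ') = Phi hp c s θ + Phi hp c s θ' := by
  ext v; simp [Phi_apply, inner_add_left, mul_add, add_smul]

theorem Phi_smul_left {x : X} (t : ℝ) (s : Sp x) (θ : Tan x) :
    Phi hp c (t • s) θ = t • Phi hp c s θ := by
  ext v; simp only [Phi_apply, map_smul, smul_apply]; module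

theorem Phi_smul_right {x : X} (t : ℝ) (s : Sp x) (θ : Tan x) :
    Phi hp c s (t • θ) = t • Phi hp c s θ := by
  ext v; simp only [Phi_apply, real_inner_smul_left, smul_apply]; module

theorem Phi_sub_left {x : X} (s s' : Sp x) (θ : Tan x) :
    Phi hp c (s - s') θ = Phi hp c s θ - Phi hp c s' θ := by
  ext v; simp [Phi_apply, smul_sub]

theorem Phi_sub_right {x : X} (s : Sp x) (θ θ' : Tan x) :
    Phi hp c s (θ - θ') = Phi hp c s θ - Phi hp c s θ' := by
  ext v; simp [Phi_apply, inner_sub_left, mul_sub, sub_smul]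

theorem hsInner_Phi_self {x : X} (s : Sp x) (θ : Tan x) :
    hsInner (Phi hp c s θ) (Phi hp c s θ) = c ^ 2 * (‖θ‖ ^ 2 * ‖s‖ ^ 2) := by
  have h1 := (frame x).sum_sq_norm_inner_left θ
  simp only [Real.norm_eq_abs, sq_abs] at h1
  simp only [hsInner, Phi_apply, real_inner_self_eq_norm_sq, norm_smul, hp.norm_J,
    Real.norm_eq_abs, mul_pow, sq_abs]
  rw [← h1, Finset.sum_mul, Finset.mul_sum]
  exact Finset.sum_congr rfl fun i _ => by ring

theorem hsInner_Phi_self_le {x : X} (s : Sp x) (θ : Tan x) :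
    hsInner (Phi hp c s θ) (Phi hp c s θ) ≤ c ^ 2 * (‖s‖ ^ 4 + ‖θ‖ ^ 4) := by
  rw [hsInner_Phi_self]
  refine mul_le_mul_of_nonneg_left ?_ (sq_nonneg c)
  nlinarith [sq_nonneg (‖s‖ ^ 2 - ‖θ‖ ^ 2), sq_nonneg (‖s‖ ^ 2), sq_nonneg (‖θ‖ ^ 2)]

end Forms

section IntegrableForms

variable {X : Type*} [TopologicalSpace X] [T2Space X] [CompactSpace X] [ChartedSpace R4 X]
  [IsManifold (𝓡 4) ∞ X]
  [RiemannianBundle (fun x : X => Tan x)]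
  [IsContMDiffRiemannianBundle (𝓡 4) ∞ R4 (fun x : X => Tan x)]
  [MeasurableSpace X] [BorelSpace X]

theorem IsL2Hom.skew {A : Π x : X, Tan x →L[ℝ] Tan x}
    (hA : IsL2Hom (V := fun x : X => Tan x) R4 A) :
    IsL2Hom (V := fun x : X => Tan x) R4 (fun x => skew (A x)) := by
  have h1 : IsMeasurableHom (V := fun x : X => Tan x) R4 (fun x => SeibergWitten.skew (A x)) := by
    intro W hW τ hτ
    simp only [inner_skew, extD]
    exact (hA.measurable W hW τ hτ).fun_sub (hA.measurable τ hτ W hW)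
  refine ⟨h1, (hA.integrable.const_mul 4).mono'
    (h1.aemeasurable_hsInner h1).aestronglyMeasurable (Eventually.of_forall fun x => ?_)⟩
  rw [Real.norm_of_nonneg (hsInner_self_nonneg _)]
  exact hsInner_skew_le _

variable {L : X → Type*} [TopologicalSpace (TotalSpace R2 L)]
  [∀ x, NormedAddCommGroup (L x)] [∀ x, InnerProductSpace ℝ (L x)]
  [FiberBundle R2 L] [VectorBundle ℝ R2 L]
  [ContMDiffVectorBundle ∞ R2 L (𝓡 4)] [IsContMDiffRiemannianBundle (𝓡 4) ∞ R2 L]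
  {nablaL : CovariantDerivative (𝓡 4) R2 L}

/-- The curvature form of a unitary connection, as an endomorphism of the tangent bundle. -/
theorem exists_lineCurvature_hom (hL : HermitianStructure R2 L)
    (hn : nablaL.ContMDiffCovariantDerivative ∞) (hm : nablaL.IsMetricCompatible) :
    ∃ K : Π x : X, Tan x →L[ℝ] Tan x, IsL2Hom (V := fun x : X => Tan x) R4 K ∧
      ∀ x v w, lineCurvature hL nablaL x v w = inner ℝ (K x v) w := by
  choose B hB using exists_lineCurvature_bilinear hL hn hm
  let K : Π x : X, Tan x →L[ℝ] Tan x := fun x =>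
    ∑ i, (LinearMap.toContinuousLinearMap ((B x).flip (frame x i))).smulRight (frame x i)
  have hK : ∀ x v w, lineCurvature hL nablaL x v w = inner ℝ (K x v) w := by
    intro x v w
    rw [← hB]
    conv_lhs => rw [← (frame x).sum_repr' w]
    simp only [K, sum_apply, ContinuousLinearMap.smulRight_apply, sum_inner,
      real_inner_smul_left, map_sum, map_smul, smul_eq_mul]
    exact Finset.sum_congr rfl fun i _ => mul_comm _ _
  refine ⟨K, ⟨?_, ?_⟩, hK⟩
  · intro W hW τ hτ
    simp only [← hK]
    exact (continuous_lineCurvature_apply hL hn hm hW hτ).measurable.aemeasurable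
  · refine integrable_of_continuous (continuous_iff_continuousAt.2 fun p => ?_)
    obtain ⟨W, hW, hb⟩ := exists_orthonormalBasis_sections R4 (fun x : X => Tan x) p
    have h1 : Continuous fun x => ∑ i, ∑ j, lineCurvature hL nablaL x (W i x) (W j x)
        * lineCurvature hL nablaL x (W i x) (W j x) :=
      continuous_finsetSum _ fun i _ => continuous_finsetSum _ fun j _ =>
        (continuous_lineCurvature_apply hL hn hm (hW i) (hW j)).mul
          (continuous_lineCurvature_apply hL hn hm (hW i) (hW j))
    refine h1.continuousAt.congr ?_
    filter_upwards [hb] with x ⟨b, hb⟩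
    rw [hsInner_eq_sum b]
    refine Finset.sum_congr rfl fun i _ => ?_
    rw [← b.sum_inner_mul_inner]
    refine Finset.sum_congr rfl fun j _ => ?_
    rw [hK, real_inner_comm (K x (b i)) (b j), hb, hb]

variable {Sp : X → Type*} [TopologicalSpace (TotalSpace R4 Sp)]
  [∀ x, NormedAddCommGroup (Sp x)] [∀ x, InnerProductSpace ℝ (Sp x)]
  [FiberBundle R4 Sp] [VectorBundle ℝ R4 Sp]
  [ContMDiffVectorBundle ∞ R4 Sp (𝓡 4)] [IsContMDiffRiemannianBundle (𝓡 4) ∞ R4 Sp]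
  (hp : HermitianStructure R4 Sp) (c : ℝ)

/-- Hölder's inequality `L⁴ · L⁴ ⊆ L²` for the action of one-forms on spinors. -/
theorem IsL4Section.isL2Hom_Phi {s : Π x, Sp x} {θ : Π x : X, Tan x} (hs : IsL4Section R4 s)
    (hθ : IsL4Section (V := fun x : X => Tan x) R4 θ) :
    IsL2Hom R4 (fun x => Phi hp c (s x) (θ x)) := by
  have h1 : IsMeasurableHom R4 (fun x => Phi hp c (s x) (θ x)) := by
    intro W hW τ hτ
    simp only [Phi_apply, real_inner_smul_left, hp.inner_J_left]
    exact ((hθ.measurable W hW).const_mul c).mul (hs.measurable _ (hp.smooth τ hτ)).neg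
  refine ⟨h1, ((hs.integrable.add hθ.integrable).const_mul (c ^ 2)).mono'
    (h1.aemeasurable_hsInner h1).aestronglyMeasurable (Eventually.of_forall fun x => ?_)⟩
  rw [Real.norm_of_nonneg (hsInner_self_nonneg _)]
  exact hsInner_Phi_self_le hp c _ _

theorem IsIntegrableJet.isL2Hom_covA {a : Jet (fun x : X => Tan x)} {φ : Jet Sp}
    (ha : IsIntegrableJet (F := R4) a) (hφ : IsIntegrableJet (F := R4) φ) :
    IsL2Hom R4 (covA hp c a φ) :=
  hφ.snd.add (hφ.fst.isL2Hom_Phi hp c ha.fst)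

end IntegrableForms

/-! ### The first variation -/

section Variation

variable {X : Type*} [TopologicalSpace X] [T2Space X] [CompactSpace X] [ChartedSpace R4 X]
  [IsManifold (𝓡 4) ∞ X]
  [RiemannianBundle (fun x : X => Tan x)]
  [IsContMDiffRiemannianBundle (𝓡 4) ∞ R4 (fun x : X => Tan x)]
  {Sp Sm L : X → Type*}
  [TopologicalSpace (TotalSpace R4 Sp)]
  [∀ x, NormedAddCommGroup (Sp x)] [∀ x, InnerProductSpace ℝ (Sp x)]
  [FiberBundle R4 Sp] [VectorBundle ℝ R4 Sp]
  [ContMDiffVectorBundle ∞ R4 Sp (𝓡 4)] [IsContMDiffRiemannianBundle (𝓡 4) ∞ R4 Sp]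
  [TopologicalSpace (TotalSpace R4 Sm)]
  [∀ x, NormedAddCommGroup (Sm x)] [∀ x, InnerProductSpace ℝ (Sm x)]
  [FiberBundle R4 Sm] [VectorBundle ℝ R4 Sm]
  [ContMDiffVectorBundle ∞ R4 Sm (𝓡 4)] [IsContMDiffRiemannianBundle (𝓡 4) ∞ R4 Sm]
  [TopologicalSpace (TotalSpace R2 L)]
  [∀ x, NormedAddCommGroup (L x)] [∀ x, InnerProductSpace ℝ (L x)]
  [FiberBundle R2 L] [VectorBundle ℝ R2 L]
  [ContMDiffVectorBundle ∞ R2 L (𝓡 4)] [IsContMDiffRiemannianBundle (𝓡 4) ∞ R2 L]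
  (S : SpincStructure Sp Sm L)
  (nabla : CovariantDerivative (𝓡 4) R4 (fun x : X => Tan x))
  (nablap : CovariantDerivative (𝓡 4) R4 Sp)
  (nablaL : CovariantDerivative (𝓡 4) R2 L) (c : ℝ)
  (a : Jet (fun x : X => Tan x)) (φ : Jet Sp)

/-- The derivative of the integrand in the direction of the spinor with jet `p` at `x`. -/
def spinorVariation (x : X) (p : Sp x × (Tan x →L[ℝ] Sp x)) : ℝ :=
  2 * hsInner (covA S.hp c a φ x) (p.2 + Phi S.hp c p.1 (a x).1)
    + (1 / 2) * (inner ℝ (φ x).1 (φ x).1 * inner ℝ (φ x).1 p.1)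
    + (1 / 2) * (scalarCurvature nabla x * inner ℝ (φ x).1 p.1)

/-- The derivative of the integrand in the direction of the one-form with jet `p` at `x`, if the
endomorphism `P` represents the curvature of `A₀ + a`. -/
def formVariation (P : Π x : X, Tan x →L[ℝ] Tan x) (x : X) (p : Tan x × (Tan x →L[ℝ] Tan x)) : ℝ :=
  (1 / 4) * hsInner (P x) (skew p.2) + 2 * hsInner (covA S.hp c a φ x) (Phi S.hp c (φ x).1 p.1)

theorem spinorVariation_sub (x : X) (p q : Sp x × (Tan x →L[ℝ] Sp x)) :
    spinorVariation S nabla c a φ x (p - q)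
      = spinorVariation S nabla c a φ x p - spinorVariation S nabla c a φ x q := by
  simp only [spinorVariation, Prod.fst_sub, Prod.snd_sub, Phi_sub_left, inner_sub_right,
    hsInner_add_right, hsInner_sub_right]
  ring

theorem spinorVariation_smul (x : X) (s : ℝ) (p : Sp x × (Tan x →L[ℝ] Sp x)) :
    spinorVariation S nabla c a φ x (s • p) = s * spinorVariation S nabla c a φ x p := by
  simp only [spinorVariation, Prod.smul_fst, Prod.smul_snd, Phi_smul_left, inner_smul_right,
    hsInner_add_right, hsInner_smul_right]
  ring

theorem formVariation_sub (P : Π x : X, Tan x →L[ℝ] Tan x) (x : X)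
    (p q : Tan x × (Tan x →L[ℝ] Tan x)) :
    formVariation S c a φ P x (p - q)
      = formVariation S c a φ P x p - formVariation S c a φ P x q := by
  simp only [formVariation, Prod.fst_sub, Prod.snd_sub, Phi_sub_right, skew_sub,
    hsInner_sub_right]
  ring

theorem formVariation_smul (P : Π x : X, Tan x →L[ℝ] Tan x) (x : X) (s : ℝ)
    (p : Tan x × (Tan x →L[ℝ] Tan x)) :
    formVariation S c a φ P x (s • p) = s * formVariation S c a φ P x p := by
  simp only [formVariation, Prod.smul_fst, Prod.smul_snd, Phi_smul_right, skew_smul,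
    hsInner_smul_right]
  ring

variable {nabla a φ}

theorem abs_spinorVariation_le {k : ℝ} (hk : ∀ x, |scalarCurvature nabla x| ≤ k) (x : X)
    (p : Sp x × (Tan x →L[ℝ] Sp x)) :
    |spinorVariation S nabla c a φ x p|
      ≤ (hsInner (covA S.hp c a φ x) (covA S.hp c a φ x) + 2 * c ^ 2 * ‖(a x).1‖ ^ 4
          + 3 * ‖(φ x).1‖ ^ 4 + k * (1 + ‖(φ x).1‖ ^ 4))
        + (3 + 2 * c ^ 2 + k) * (‖p.1‖ ^ 4 + hsInner p.2 p.2) := by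
  have hk0 : 0 ≤ k := (abs_nonneg _).trans (hk x)
  have h1 := abs_hsInner_le (covA S.hp c a φ x) (p.2 + Phi S.hp c p.1 (a x).1)
  have h2 := hsInner_add_self_le p.2 (Phi S.hp c p.1 (a x).1)
  have h3 := hsInner_Phi_self_le S.hp c p.1 (a x).1
  have h4 := abs_real_inner_le_norm (φ x).1 p.1
  have h5 : |inner ℝ (φ x).1 (φ x).1 * inner ℝ (φ x).1 p.1|
      ≤ ‖(φ x).1‖ ^ 4 + ‖(φ x).1‖ ^ 4 + (‖(φ x).1‖ ^ 4 + ‖p.1‖ ^ 4) := by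
    rw [abs_mul]
    exact (mul_le_mul (abs_real_inner_le_norm _ _) h4 (abs_nonneg _)
      (by positivity)).trans mul_mul_mul_le_add_pow_four
  have h6 : |scalarCurvature nabla x * inner ℝ (φ x).1 p.1|
      ≤ k * (1 + (‖(φ x).1‖ ^ 4 + ‖p.1‖ ^ 4)) := by
    rw [abs_mul]
    exact mul_le_mul (hk x) (abs_inner_le_one_add _ _) (abs_nonneg _) hk0
  have h7 := hsInner_self_nonneg p.2
  have h8 : 0 ≤ ‖p.1‖ ^ 4 := by positivity
  have h9 : 0 ≤ ‖(φ x).1‖ ^ 4 := by positivity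
  have h10 : |spinorVariation S nabla c a φ x p|
      ≤ 2 * |hsInner (covA S.hp c a φ x) (p.2 + Phi S.hp c p.1 (a x).1)|
        + (1 / 2) * |inner ℝ (φ x).1 (φ x).1 * inner ℝ (φ x).1 p.1|
        + (1 / 2) * |scalarCurvature nabla x * inner ℝ (φ x).1 p.1| := by
    refine (abs_add_three _ _ _).trans (le_of_eq ?_)
    rw [abs_mul, abs_mul (1 / 2 : ℝ), abs_mul (1 / 2 : ℝ)]
    norm_num
  nlinarith [mul_nonneg hk0 h7, mul_nonneg hk0 h8, mul_nonneg hk0 h9,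
    mul_nonneg (sq_nonneg c) h7, mul_nonneg (sq_nonneg c) h8]

theorem abs_formVariation_le (P : Π x : X, Tan x →L[ℝ] Tan x) (x : X)
    (p : Tan x × (Tan x →L[ℝ] Tan x)) :
    |formVariation S c a φ P x p|
      ≤ (hsInner (P x) (P x) + hsInner (covA S.hp c a φ x) (covA S.hp c a φ x)
          + c ^ 2 * ‖(φ x).1‖ ^ 4)
        + (1 + c ^ 2) * (‖p.1‖ ^ 4 + hsInner p.2 p.2) := by
  have h1 := abs_hsInner_le (P x) (skew p.2)
  have h2 := hsInner_skew_le p.2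
  have h3 := abs_hsInner_le (covA S.hp c a φ x) (Phi S.hp c (φ x).1 p.1)
  have h4 := hsInner_Phi_self_le S.hp c (φ x).1 p.1
  have h5 := hsInner_self_nonneg p.2
  have h6 := hsInner_self_nonneg (P x)
  have h8 : 0 ≤ ‖p.1‖ ^ 4 := by positivity
  have h10 : |formVariation S c a φ P x p|
      ≤ (1 / 4) * |hsInner (P x) (skew p.2)|
        + 2 * |hsInner (covA S.hp c a φ x) (Phi S.hp c (φ x).1 p.1)| := by
    refine (abs_add_le _ _).trans (le_of_eq ?_)
    rw [abs_mul, abs_mul (2 : ℝ)]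
    norm_num
  nlinarith [mul_nonneg (sq_nonneg c) h5]

variable [MeasurableSpace X] [BorelSpace X]

theorem IsIntegrableJet.integrable_spinorVariation (hk : Continuous (scalarCurvature nabla))
    (ha : IsIntegrableJet (F := R4) a) (hφ : IsIntegrableJet (F := R4) φ) {Λ : Jet Sp}
    (hΛ : IsIntegrableJet (F := R4) Λ) :
    Integrable (fun x => spinorVariation S nabla c a φ x (Λ x)) (vol : Measure X) :=
  ((((ha.isL2Hom_covA S.hp c hφ).integrable_hsInner (ha.isL2Hom_covA S.hp c hΛ)).const_mul 2).add
    ((hφ.fst.integrable_inner_mul_inner hφ.fst hφ.fst hΛ.fst).const_mul (1 / 2))).add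
    ((hφ.fst.integrable_mul_inner hk hΛ.fst).const_mul (1 / 2))

theorem IsIntegrableJet.integrable_formVariation {P : Π x : X, Tan x →L[ℝ] Tan x}
    (hP : IsL2Hom (V := fun x : X => Tan x) R4 P)
    (ha : IsIntegrableJet (F := R4) a) (hφ : IsIntegrableJet (F := R4) φ)
    {Θ : Jet (fun x : X => Tan x)} (hΘ : IsIntegrableJet (F := R4) Θ) :
    Integrable (fun x => formVariation S c a φ P x (Θ x)) (vol : Measure X) :=
  ((hP.integrable_hsInner hΘ.snd.skew).const_mul (1 / 4)).add
    (((ha.isL2Hom_covA S.hp c hφ).integrable_hsInner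
      (hφ.fst.isL2Hom_Phi S.hp c hΘ.fst)).const_mul 2)

variable {nablaL}

/-- The integrand in terms of pointwise inner products, the endomorphism `K` representing the
curvature of `A₀`. -/
theorem density_eq {K : Π x : X, Tan x →L[ℝ] Tan x}
    (hK : ∀ x v w, lineCurvature S.hL nablaL x v w = inner ℝ (K x v) w) (x : X) :
    density S nabla nablaL c a φ x
      = (1 / 8) * hsInner (K x + skew (a x).2) (K x + skew (a x).2)
        + hsInner (covA S.hp c a φ x) (covA S.hp c a φ x)
        + (1 / 8) * (inner ℝ (φ x).1 (φ x).1 * inner ℝ (φ x).1 (φ x).1)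
        + (1 / 4) * (scalarCurvature nabla x * inner ℝ (φ x).1 (φ x).1) := by
  have h1 : curvA S.hL nablaL a x = fun v w => inner ℝ ((K x + skew (a x).2) v) w := by
    funext v w
    rw [curvA, hK, add_apply, inner_add_left, inner_skew]
  rw [density, h1, formInner_inner, real_inner_self_eq_norm_sq]
  ring

variable {Θ : Jet (fun x : X => Tan x)} {Λ : Jet Sp}

theorem covA_add_smul (t : ℝ) (x : X) :
    covA S.hp c (a + t • Θ) (φ + t • Λ) x = covA S.hp c a φ x
      + (t • (((Λ x).2 + Phi S.hp c (Λ x).1 (a x).1) + Phi S.hp c (φ x).1 (Θ x).1)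
        + t ^ 2 • Phi S.hp c (Λ x).1 (Θ x).1) := by
  simp only [covA, Pi.add_apply, Pi.smul_apply, Prod.fst_add, Prod.snd_add, Prod.smul_fst,
    Prod.smul_snd, Phi_add_left, Phi_add_right, Phi_smul_left, Phi_smul_right]
  module

/-- Along a line, the integrand is a polynomial of degree four with integrable coefficients, and
its linear coefficient is the first variation. -/
theorem exists_density_expansion {K : Π x : X, Tan x →L[ℝ] Tan x}
    (hK : ∀ x v w, lineCurvature S.hL nablaL x v w = inner ℝ (K x v) w)
    (hK2 : IsL2Hom (V := fun x : X => Tan x) R4 K) (hk : Continuous (scalarCurvature nabla))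
    (ha : IsIntegrableJet (F := R4) a) (hφ : IsIntegrableJet (F := R4) φ)
    (hΘ : IsIntegrableJet (F := R4) Θ) (hΛ : IsIntegrableJet (F := R4) Λ) :
    ∃ d₂ d₃ d₄ : X → ℝ, Integrable (density S nabla nablaL c a φ) (vol : Measure X) ∧
      Integrable d₂ (vol : Measure X) ∧ Integrable d₃ (vol : Measure X) ∧
      Integrable d₄ (vol : Measure X) ∧
      ∀ t x, density S nabla nablaL c (a + t • Θ) (φ + t • Λ) x
        = density S nabla nablaL c a φ x
          + t * (formVariation S c a φ (fun x => K x + skew (a x).2) x (Θ x)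
            + spinorVariation S nabla c a φ x (Λ x))
          + t ^ 2 * d₂ x + t ^ 3 * d₃ x + t ^ 4 * d₄ x := by
  have hP : IsL2Hom (V := fun x : X => Tan x) R4 (fun x => K x + skew (a x).2) :=
    hK2.add ha.snd.skew
  have hP' : IsL2Hom (V := fun x : X => Tan x) R4 (fun x => skew (Θ x).2) := hΘ.snd.skew
  have hQ := ha.isL2Hom_covA S.hp c hφ
  have hQ₁ : IsL2Hom R4 (fun x => ((Λ x).2 + Phi S.hp c (Λ x).1 (a x).1)
      + Phi S.hp c (φ x).1 (Θ x).1) :=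
    (ha.isL2Hom_covA S.hp c hΛ).add (hφ.fst.isL2Hom_Phi S.hp c hΘ.fst)
  have hQ₂ : IsL2Hom R4 (fun x => Phi S.hp c (Λ x).1 (Θ x).1) :=
    hΛ.fst.isL2Hom_Phi S.hp c hΘ.fst
  have h₁ := hφ.fst
  have h₂ := hΛ.fst
  refine ⟨fun x => (1 / 8) * hsInner (skew (Θ x).2) (skew (Θ x).2)
      + hsInner (((Λ x).2 + Phi S.hp c (Λ x).1 (a x).1) + Phi S.hp c (φ x).1 (Θ x).1)
        (((Λ x).2 + Phi S.hp c (Λ x).1 (a x).1) + Phi S.hp c (φ x).1 (Θ x).1)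
      + 2 * hsInner (covA S.hp c a φ x) (Phi S.hp c (Λ x).1 (Θ x).1)
      + (1 / 2) * (inner ℝ (φ x).1 (Λ x).1 * inner ℝ (φ x).1 (Λ x).1)
      + (1 / 4) * (inner ℝ (φ x).1 (φ x).1 * inner ℝ (Λ x).1 (Λ x).1)
      + (1 / 4) * (scalarCurvature nabla x * inner ℝ (Λ x).1 (Λ x).1),
    fun x => 2 * hsInner (((Λ x).2 + Phi S.hp c (Λ x).1 (a x).1) + Phi S.hp c (φ x).1 (Θ x).1)
        (Phi S.hp c (Λ x).1 (Θ x).1)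
      + (1 / 2) * (inner ℝ (φ x).1 (Λ x).1 * inner ℝ (Λ x).1 (Λ x).1),
    fun x => hsInner (Phi S.hp c (Λ x).1 (Θ x).1) (Phi S.hp c (Λ x).1 (Θ x).1)
      + (1 / 8) * (inner ℝ (Λ x).1 (Λ x).1 * inner ℝ (Λ x).1 (Λ x).1), ?_, ?_, ?_, ?_, ?_⟩
  · refine Integrable.congr ?_ (Eventually.of_forall fun x => (density_eq S c hK x).symm)
    exact (((hP.integrable.const_mul (1 / 8)).add hQ.integrable).add
      ((h₁.integrable_inner_mul_inner h₁ h₁ h₁).const_mul (1 / 8))).add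
      ((h₁.integrable_mul_inner hk h₁).const_mul (1 / 4))
  · exact (((((hP'.integrable.const_mul (1 / 8)).add hQ₁.integrable).add
      ((hQ.integrable_hsInner hQ₂).const_mul 2)).add
      ((h₁.integrable_inner_mul_inner h₂ h₁ h₂).const_mul (1 / 2))).add
      ((h₁.integrable_inner_mul_inner h₁ h₂ h₂).const_mul (1 / 4))).add
      ((h₂.integrable_mul_inner hk h₂).const_mul (1 / 4))
  · exact ((hQ₁.integrable_hsInner hQ₂).const_mul 2).add
      ((h₁.integrable_inner_mul_inner h₂ h₂ h₂).const_mul (1 / 2))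
  · exact hQ₂.integrable.add ((h₂.integrable_inner_mul_inner h₂ h₂ h₂).const_mul (1 / 8))
  · intro t x
    rw [density_eq S c hK, density_eq S c hK, covA_add_smul]
    have e1 : K x + skew ((a + t • Θ) x).2 = (K x + skew (a x).2) + t • skew (Θ x).2 := by
      simp only [Pi.add_apply, Pi.smul_apply, Prod.snd_add, Prod.smul_snd, skew_add, skew_smul]
      module
    have e2 : ((φ + t • Λ) x).1 = (φ x).1 + t • (Λ x).1 := rfl
    rw [e1, e2, formVariation, spinorVariation]
    simp only [hsInner_add_right, hsInner_smul_right, inner_add_left, inner_add_right,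
      real_inner_smul_right, real_inner_comm, hsInner_comm]
    ring

/-- The functional is differentiable along lines, and its derivative is the integral of the first
variation. -/
theorem hasDerivAt_SW {K : Π x : X, Tan x →L[ℝ] Tan x}
    (hK : ∀ x v w, lineCurvature S.hL nablaL x v w = inner ℝ (K x v) w)
    (hK2 : IsL2Hom (V := fun x : X => Tan x) R4 K) (hk : Continuous (scalarCurvature nabla))
    (ha : IsIntegrableJet (F := R4) a) (hφ : IsIntegrableJet (F := R4) φ)
    (hΘ : IsIntegrableJet (F := R4) Θ) (hΛ : IsIntegrableJet (F := R4) Λ) :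
    HasDerivAt (fun t : ℝ => SW S nabla nablaL c (a + t • Θ) (φ + t • Λ))
      (∫ x, formVariation S c a φ (fun x => K x + skew (a x).2) x (Θ x) ∂(vol : Measure X)
        + ∫ x, spinorVariation S nabla c a φ x (Λ x) ∂(vol : Measure X)) 0 := by
  obtain ⟨d₂, d₃, d₄, h0, h2, h3, h4, h⟩ := exists_density_expansion S c hK hK2 hk ha hφ hΘ hΛ
  have hf := ha.integrable_formVariation S c (P := fun x => K x + skew (a x).2)
    (hK2.add ha.snd.skew) hφ hΘ
  have hs := ha.integrable_spinorVariation S c hk hφ hΛ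
  have hSW : (fun t : ℝ => SW S nabla nablaL c (a + t • Θ) (φ + t • Λ)) = fun t =>
      ∫ x, density S nabla nablaL c a φ x ∂(vol : Measure X)
        + t * (∫ x, formVariation S c a φ (fun x => K x + skew (a x).2) x (Θ x) ∂(vol : Measure X)
          + ∫ x, spinorVariation S nabla c a φ x (Λ x) ∂(vol : Measure X))
        + t ^ 2 * ∫ x, d₂ x ∂(vol : Measure X) + t ^ 3 * ∫ x, d₃ x ∂(vol : Measure X)
        + t ^ 4 * ∫ x, d₄ x ∂(vol : Measure X) := by
    funext t
    have i1 := (hf.fun_add hs).const_mul t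
    have i2 := h2.const_mul (t ^ 2)
    have i3 := h3.const_mul (t ^ 3)
    have i4 := h4.const_mul (t ^ 4)
    simp only [SW, h]
    rw [integral_add (((h0.fun_add i1).fun_add i2).fun_add i3) i4,
      integral_add ((h0.fun_add i1).fun_add i2) i3, integral_add (h0.fun_add i1) i2,
      integral_add h0 i1, integral_const_mul, integral_const_mul, integral_const_mul,
      integral_const_mul, integral_add hf hs]
  rw [hSW]
  generalize ∫ x, formVariation S c a φ (fun x => K x + skew (a x).2) x (Θ x) ∂(vol : Measure X)
    + ∫ x, spinorVariation S nabla c a φ x (Λ x) ∂(vol : Measure X) = D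
  have hp := (((((hasDerivAt_id (0 : ℝ)).mul_const D).const_add
    (∫ x, density S nabla nablaL c a φ x ∂(vol : Measure X))).add
    ((hasDerivAt_pow 2 (0 : ℝ)).mul_const (∫ x, d₂ x ∂(vol : Measure X)))).add
    ((hasDerivAt_pow 3 (0 : ℝ)).mul_const (∫ x, d₃ x ∂(vol : Measure X)))).add
    ((hasDerivAt_pow 4 (0 : ℝ)).mul_const (∫ x, d₄ x ∂(vol : Measure X)))
  refine HasDerivAt.congr_deriv hp ?_
  simp

/-! ### The Euler–Lagrange equations -/

/-- The spinor equation says that the first variation vanishes in the direction of smooth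
spinors. -/
theorem spinorEquation_iff (hnp : nablap.ContMDiffCovariantDerivative ∞)
    (hk : Continuous (scalarCurvature nabla))
    (ha : IsIntegrableJet (F := R4) a) (hφ : IsIntegrableJet (F := R4) φ) :
    SpinorEquation S nabla nablap c a φ ↔ ∀ Λ : Π x, Sp x, IsSmoothSection R4 Λ →
      ∫ x, spinorVariation S nabla c a φ x (jet nablap Λ x) ∂(vol : Measure X) = 0 := by
  -- if the equation holds at `x` with `Δφ` for `(∇^A)* ∇^A φ`, the first variation measures the
  -- failure of `Δφ` to be the adjoint
  have key : ∀ (x : X) (Δφ : Sp x) (p : Sp x × (Tan x →L[ℝ] Sp x)),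
      Δφ + (‖(φ x).1‖ ^ 2 / 4) • (φ x).1 + (scalarCurvature nabla x / 4) • (φ x).1 = 0 →
      spinorVariation S nabla c a φ x p = 2 * (hsInner (covA S.hp c a φ x)
        (p.2 + Phi S.hp c p.1 (a x).1) - inner ℝ Δφ p.1) := by
    intro x Δφ p h
    have h1 := congrArg (fun v => inner ℝ v p.1) h
    simp only [inner_add_left, real_inner_smul_left, inner_zero_left] at h1
    rw [spinorVariation, real_inner_self_eq_norm_sq]
    linarith
  constructor
  · rintro ⟨Δφ, hΔ, heq⟩ Λ hΛ
    obtain ⟨h1, h2, h3⟩ := hΔ Λ hΛ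
    have h4 : (fun x => spinorVariation S nabla c a φ x (jet nablap Λ x)) =ᵐ[(vol : Measure X)]
        fun x => 2 * (hsInner (covA S.hp c a φ x) (covA S.hp c a (jet nablap Λ) x)
          - inner ℝ (Δφ x) (Λ x)) := by
      filter_upwards [heq] with x hx using key x (Δφ x) _ hx
    rw [integral_congr_ae h4, integral_const_mul, integral_sub h2 h1, h3]
    ring
  · intro h
    let Δφ : Π x, Sp x := fun x =>
      -((‖(φ x).1‖ ^ 2 / 4) • (φ x).1 + (scalarCurvature nabla x / 4) • (φ x).1)
    have hΔ : ∀ x, Δφ x + (‖(φ x).1‖ ^ 2 / 4) • (φ x).1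
        + (scalarCurvature nabla x / 4) • (φ x).1 = 0 := by
      intro x
      simp only [Δφ]
      abel
    refine ⟨Δφ, fun Λ hΛ => ?_, Eventually.of_forall hΔ⟩
    have hΛ' := hΛ.isIntegrableJet hnp
    have h1 : Integrable (fun x => inner ℝ (Δφ x) (Λ x)) (vol : Measure X) := by
      have := (((hφ.fst.integrable_inner_mul_inner hφ.fst hφ.fst hΛ'.fst).const_mul (1 / 4)).add
        ((hφ.fst.integrable_mul_inner hk hΛ'.fst).const_mul (1 / 4))).neg
      refine this.congr (Eventually.of_forall fun x => ?_)
      simp only [Δφ, Pi.neg_apply, Pi.add_apply, inner_neg_left, inner_add_left,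
        real_inner_smul_left, real_inner_self_eq_norm_sq, jet]
      ring
    have h2 : Integrable (fun x => hsInner (covA S.hp c a φ x) (covA S.hp c a (jet nablap Λ) x))
        (vol : Measure X) :=
      (ha.isL2Hom_covA S.hp c hφ).integrable_hsInner (ha.isL2Hom_covA S.hp c hΛ')
    refine ⟨h1, h2, ?_⟩
    have h3 := h Λ hΛ
    have h4 : ∀ x, spinorVariation S nabla c a φ x (jet nablap Λ x)
        = 2 * (hsInner (covA S.hp c a φ x) (covA S.hp c a (jet nablap Λ) x)
          - inner ℝ (Δφ x) (Λ x)) := fun x => key x (Δφ x) _ (hΔ x)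
    simp only [h4] at h3
    rw [integral_const_mul, integral_sub h2 h1] at h3
    linarith

/-- The curvature equation says that the first variation vanishes in the direction of smooth
one-forms. -/
theorem curvatureEquation_iff {K : Π x : X, Tan x →L[ℝ] Tan x}
    (hK : ∀ x v w, lineCurvature S.hL nablaL x v w = inner ℝ (K x v) w)
    (hK2 : IsL2Hom (V := fun x : X => Tan x) R4 K)
    (hn : nabla.ContMDiffCovariantDerivative ∞)
    (ha : IsIntegrableJet (F := R4) a) (hφ : IsIntegrableJet (F := R4) φ) :
    CurvatureEquation S nabla nablaL c a φ ↔ ∀ Θ : Π x : X, Tan x, IsSmoothSection R4 Θ →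
      ∫ x, formVariation S c a φ (fun x => K x + skew (a x).2) x (jet nabla Θ x)
        ∂(vol : Measure X) = 0 := by
  have hF : ∀ x (A : Tan x →L[ℝ] Tan x), formInner (curvA S.hL nablaL a x) (extD A)
      = (1 / 2) * hsInner (K x + skew (a x).2) (skew A) := by
    intro x A
    rw [← formInner_inner]
    congr 1
    · funext v w
      rw [curvA, hK, add_apply, inner_add_left, inner_skew]
    · funext v w
      rw [inner_skew]
  -- likewise, with `δF` for `d* F_A`
  have key : ∀ (x : X) (δF : Tan x) (p : Tan x × (Tan x →L[ℝ] Tan x)),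
      δF + (4 : ℝ) • PhiAdj S.hp c (φ x).1 (covA S.hp c a φ x) = 0 →
      formVariation S c a φ (fun x => K x + skew (a x).2) x p
        = (1 / 2) * (formInner (curvA S.hL nablaL a x) (extD p.2) - inner ℝ δF p.1) := by
    intro x δF p h
    have h1 := congrArg (fun v => inner ℝ v p.1) h
    simp only [inner_add_left, real_inner_smul_left, inner_zero_left, ← hsInner_Phi] at h1
    rw [formVariation, hF]
    linarith
  constructor
  · rintro ⟨δF, hδ, heq⟩ Θ hΘ
    obtain ⟨h1, h2, h3⟩ := hδ Θ hΘ
    have h4 : (fun x => formVariation S c a φ (fun x => K x + skew (a x).2) x (jet nabla Θ x))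
        =ᵐ[(vol : Measure X)] fun x => (1 / 2) * (formInner (curvA S.hL nablaL a x)
          (extD (nabla Θ x)) - inner ℝ (δF x) (Θ x)) := by
      filter_upwards [heq] with x hx using key x (δF x) _ hx
    rw [integral_congr_ae h4, integral_const_mul, integral_sub h2 h1, h3]
    ring
  · intro h
    let δF : Π x : X, Tan x := fun x => -((4 : ℝ) • PhiAdj S.hp c (φ x).1 (covA S.hp c a φ x))
    have hδ : ∀ x, δF x + (4 : ℝ) • PhiAdj S.hp c (φ x).1 (covA S.hp c a φ x) = 0 := fun x =>
      neg_add_cancel _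
    refine ⟨δF, fun Θ hΘ => ?_, Eventually.of_forall hδ⟩
    have hΘ' := hΘ.isIntegrableJet hn
    have h1 : Integrable (fun x => inner ℝ (δF x) (Θ x)) (vol : Measure X) := by
      have := ((ha.isL2Hom_covA S.hp c hφ).integrable_hsInner
        (hφ.fst.isL2Hom_Phi S.hp c hΘ'.fst)).const_mul (-4)
      refine this.congr (Eventually.of_forall fun x => ?_)
      simp only [δF, inner_neg_left, real_inner_smul_left, ← hsInner_Phi, jet]
      ring
    have h2 : Integrable (fun x => formInner (curvA S.hL nablaL a x) (extD (nabla Θ x)))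
        (vol : Measure X) := by
      simp only [hF]
      exact ((hK2.add ha.snd.skew).integrable_hsInner hΘ'.snd.skew).const_mul (1 / 2)
    refine ⟨h1, h2, ?_⟩
    have h3 := h Θ hΘ
    have h4 : ∀ x, formVariation S c a φ (fun x => K x + skew (a x).2) x (jet nabla Θ x)
        = (1 / 2) * (formInner (curvA S.hL nablaL a x) (extD (nabla Θ x))
          - inner ℝ (δF x) (Θ x)) := fun x => key x (δF x) _ (hδ x)
    simp only [h4] at h3
    rw [integral_const_mul, integral_sub h2 h1] at h3
    linarith

end Variation

end SeibergWitten

end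

open SeibergWitten in
theorem mainTheorem4
    {X : Type*} [TopologicalSpace X] [CompactSpace X] [T2Space X]
    [ChartedSpace R4 X] [IsManifold (𝓡 4) ∞ X]
    [RiemannianBundle (fun x : X => Tan x)]
    [IsContMDiffRiemannianBundle (𝓡 4) ∞ R4 (fun x : X => Tan x)]
    [MeasurableSpace X] [BorelSpace X]
    {Sp Sm L : X → Type*}
    [TopologicalSpace (TotalSpace R4 Sp)]
    [∀ x, NormedAddCommGroup (Sp x)] [∀ x, InnerProductSpace ℝ (Sp x)]
    [FiberBundle R4 Sp] [VectorBundle ℝ R4 Sp]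
    [ContMDiffVectorBundle ∞ R4 Sp (𝓡 4)] [IsContMDiffRiemannianBundle (𝓡 4) ∞ R4 Sp]
    [TopologicalSpace (TotalSpace R4 Sm)]
    [∀ x, NormedAddCommGroup (Sm x)] [∀ x, InnerProductSpace ℝ (Sm x)]
    [FiberBundle R4 Sm] [VectorBundle ℝ R4 Sm]
    [ContMDiffVectorBundle ∞ R4 Sm (𝓡 4)] [IsContMDiffRiemannianBundle (𝓡 4) ∞ R4 Sm]
    [TopologicalSpace (TotalSpace R2 L)]
    [∀ x, NormedAddCommGroup (L x)] [∀ x, InnerProductSpace ℝ (L x)]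
    [FiberBundle R2 L] [VectorBundle ℝ R2 L]
    [ContMDiffVectorBundle ∞ R2 L (𝓡 4)] [IsContMDiffRiemannianBundle (𝓡 4) ∞ R2 L]
    (S : SpincStructure Sp Sm L)
    (nabla : CovariantDerivative (𝓡 4) R4 (fun x : X => Tan x)) (hnabla : IsLeviCivita nabla)
    (nablap : CovariantDerivative (𝓡 4) R4 Sp) (nablam : CovariantDerivative (𝓡 4) R4 Sm)
    (nablaL : CovariantDerivative (𝓡 4) R2 L)
    (hspin : IsSpincConnection S nabla nablap nablam nablaL)
    (c : ℝ) :
    (∀ (a : Jet (fun x : X => Tan x)) (φ : Jet Sp), IsL12 nabla a → IsL12 nablap φ →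
      MeasureTheory.Integrable (density S nabla nablaL c a φ) vol) ∧
    ∀ (a : Jet (fun x : X => Tan x)) (φ : Jet Sp), IsL12 nabla a → IsL12 nablap φ →
      (IsCritical S nabla nablap nablaL c a φ ↔
        SpinorEquation S nabla nablap c a φ ∧ CurvatureEquation S nabla nablaL c a φ) := by
  have hk := continuous_scalarCurvature hnabla.smooth hnabla.metric
  obtain ⟨k, -, hkb⟩ := exists_abs_le_of_continuous hk
  obtain ⟨K, hK2, hK⟩ := exists_lineCurvature_hom S.hL hspin.unitaryL.smooth hspin.unitaryL.metric
  have hint : ∀ {a : Jet (fun x : X => Tan x)}, IsL12 nabla a → IsIntegrableJet (F := R4) a :=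
    fun h => h.isIntegrableJet hnabla.smooth hnabla.metric
  have hintp : ∀ {φ : Jet Sp}, IsL12 nablap φ → IsIntegrableJet (F := R4) φ :=
    fun h => h.isIntegrableJet hspin.unitaryp.smooth hspin.unitaryp.metric
  refine ⟨fun a φ ha hφ => ?_, fun a φ ha hφ => ?_⟩
  · obtain ⟨_, _, _, h, -⟩ := exists_density_expansion S c hK hK2 hk (hint ha) (hintp hφ)
      (hint ha) (hintp hφ)
    exact h
  have ha' := hint ha
  have hφ' := hintp hφ
  have hP := hK2.add ha'.snd.skew
  have hQ := ha'.isL2Hom_covA S.hp c hφ'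
  have := isFiniteMeasure_vol (X := X)
  rw [spinorEquation_iff S nablap c hspin.unitaryp.smooth hk ha' hφ',
    curvatureEquation_iff S c hK hK2 hnabla.smooth ha' hφ']
  constructor
  · intro hcrit
    have hzero : ∀ Θ Λ, IsL12 nabla Θ → IsL12 nablap Λ → _ := fun Θ Λ hΘ hΛ =>
      (hasDerivAt_SW S c hK hK2 hk ha' hφ' (hint hΘ) (hintp hΛ)).unique (hcrit Θ Λ hΘ hΛ)
    refine ⟨fun Λ hΛ => ?_, fun Θ hΘ => ?_⟩
    · have h0 : ∀ x, formVariation S c a φ (fun x => K x + skew (a x).2) x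
          0 = 0 := fun x => by
        simpa using formVariation_smul S c a φ (fun x => K x + skew (a x).2) x 0 0
      simpa [h0] using hzero 0 _ isL12_zero hΛ.isL12
    · have h0 : ∀ x, spinorVariation S nabla c a φ x 0 = 0 := fun x => by
        simpa using spinorVariation_smul S nabla c a φ x 0 0
      simpa [h0] using hzero _ 0 hΘ.isL12 isL12_zero
  · rintro ⟨hspinor, hform⟩ Θ Λ hΘ hΛ
    have e1 : ∫ x, formVariation S c a φ (fun x => K x + skew (a x).2) x (Θ x) ∂vol = 0 :=
      hΘ.integral_eq_zero_of_smooth hnabla.smooth hnabla.metric _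
        (formVariation_sub S c a φ _) (formVariation_smul S c a φ _)
        (fun u hu => ha'.integrable_formVariation S c hP hφ' hu)
        ((hP.integrable.add hQ.integrable).add (hφ'.fst.integrable.const_mul (c ^ 2)))
        (abs_formVariation_le S c _) hform
    have e2 : ∫ x, spinorVariation S nabla c a φ x (Λ x) ∂vol = 0 :=
      hΛ.integral_eq_zero_of_smooth hspin.unitaryp.smooth hspin.unitaryp.metric _
        (spinorVariation_sub S nabla c a φ) (spinorVariation_smul S nabla c a φ)
        (fun u hu => ha'.integrable_spinorVariation S c hk hφ' hu)
        (((hQ.integrable.add (ha'.fst.integrable.const_mul (2 * c ^ 2))).add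
          (hφ'.fst.integrable.const_mul 3)).add
          (((integrable_const 1).add hφ'.fst.integrable).const_mul k))
        (abs_spinorVariation_le S c hkb) hspinor
    simpa [e1, e2] using hasDerivAt_SW S c hK hK2 hk ha' hφ' (hint hΘ) (hintp hΛ)
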